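/- Let $a>0$ be an algebraic real number and let $b>0$ be a rational number, with $a\neq b$, $a\neq 1$ and $b\neq 1$, and put $A=\begin{pmatrix} a&0\\0&b\end{pmatrix}$. (1) Let $G$ be an additive subgroup of $\mathbb R^2$ with $(1,1)\in G$ and $AG=G$. Let $I(G)$ be the set of matrices $M$ of the form $\begin{pmatrix} c&0\\0&d\end{pmatrix}$ or $\begin{pmatrix} 0&c\\d&0\end{pmatrix}$ with $c,d>0$ and $MG=G$. Then $\{A^n:n\in\mathbb Z\}\subsetneq I(G)$. (2) There is no unital AF-algebra $\mathcal A$ with 2-dimensional trace space such that $K_0(\mathcal A)$ is embedded in $\mathbb R^2$ and, for some labelling $\varphi_1,\varphi_2$ of the extreme tracial states of $\mathcal A$, $F(\mathcal A)=\{\mathrm{diag}(a^n,b^n):n\in\mathbb Z\}$. Here a unital AF-algebra is a unital C*-algebra that is the closure of the union of an increasing sequence of finite-dimensional C*-subalgebras; the trace space is the space of bounded linear functionals $\tau$ on $\mathcal A$ with $\tau(xy)=\tau(yx)$; $K_0(\mathcal A)$ is embedded in $\mathbb R^2$ if $\Gamma=((\varphi_1)_*,(\varphi_2)_*):K_0(\mathcal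 A)\to\mathbb R^2$ is injective, sends $[1_{\mathcal A}]$ to $(1,1)$ and sends the positive cone $K_0(\mathcal A)^+$ into $\{(x,y):x,y\ge 0\}$; and the fundamental group $F(\mathcal A)$ is the set of real $2\times 2$ matrices which represent, in the basis $\varphi_1,\varphi_2$ of the trace space, the maps $\tau\mapsto(\mathrm{Tr}_k\otimes\tau)\circ\Phi$, where $k\in\mathbb N$, $p$ is a full projection in $M_k(\mathcal A)$ and $\Phi$ is a $*$-isomorphism of $\mathcal A$ onto $pM_k(\mathcal A)p$. -/

import Mathlib

open scoped Matrix ComplexOrder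

universe u

noncomputable section

namespace AFFund

/-! ### Murray-von Neumann equivalence of matrix projections -/

section MvN

variable {A : Type u} [Ring A] [StarRing A]
variable {l m n o : Type} [Fintype l] [Fintype m] [Fintype n] [Fintype o]

/-- Murray-von Neumann equivalence of (projection) matrices of possibly different sizes:
`p = v v*` and `q = v* v` for a rectangular matrix `v`. -/
def MvN (p : Matrix m m A) (q : Matrix n n A) : Prop :=
  ∃ v : Matrix m n A, v * vᴴ = p ∧ vᴴ * v = q

theorem isStarProjection_iff_conj {p : Matrix m m A} :
    IsStarProjection p ↔ p * p = p ∧ pᴴ = p :=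
  isStarProjection_iff'

theorem MvN.refl {p : Matrix m m A} (hp : IsStarProjection p) : MvN p p := by
  obtain ⟨h1, h2⟩ := isStarProjection_iff_conj.1 hp
  exact ⟨p, by rw [h2, h1], by rw [h2, h1]⟩

theorem MvN.symm {p : Matrix m m A} {q : Matrix n n A} (h : MvN p q) : MvN q p := by
  obtain ⟨v, h1, h2⟩ := h
  exact ⟨vᴴ, by rwa [Matrix.conjTranspose_conjTranspose],
    by rwa [Matrix.conjTranspose_conjTranspose]⟩

theorem MvN.trans {p : Matrix l l A} {q : Matrix m m A} {r : Matrix n n A}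
    (hp : IsStarProjection p) (hr : IsStarProjection r)
    (h : MvN p q) (h' : MvN q r) : MvN p r := by
  obtain ⟨hp1, -⟩ := isStarProjection_iff_conj.1 hp
  obtain ⟨hr1, -⟩ := isStarProjection_iff_conj.1 hr
  obtain ⟨v, h1, h2⟩ := h
  obtain ⟨w, h3, h4⟩ := h'
  refine ⟨v * w, ?_, ?_⟩
  · calc v * w * (v * w)ᴴ = v * (w * wᴴ) * vᴴ := by
          simp only [Matrix.conjTranspose_mul, Matrix.mul_assoc]
      _ = (v * vᴴ) * (v * vᴴ) := by rw [h3, ← h2]; simp only [Matrix.mul_assoc]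
      _ = p := by rw [h1, hp1]
  · calc (v * w)ᴴ * (v * w) = wᴴ * (vᴴ * v) * w := by
          simp only [Matrix.conjTranspose_mul, Matrix.mul_assoc]
      _ = (wᴴ * w) * (wᴴ * w) := by rw [h2, ← h3]; simp only [Matrix.mul_assoc]
      _ = r := by rw [h4, hr1]

theorem isStarProjection_submatrix {p : Matrix m m A} (hp : IsStarProjection p) (e : n ≃ m) :
    IsStarProjection (p.submatrix e e) := by
  obtain ⟨h1, h2⟩ := isStarProjection_iff_conj.1 hp
  refine isStarProjection_iff_conj.2 ⟨?_, ?_⟩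
  · rw [Matrix.submatrix_mul_equiv, h1]
  · rw [Matrix.conjTranspose_submatrix, h2]

theorem MvN.submatrix {p : Matrix m m A} (hp : IsStarProjection p) (e : n ≃ m) :
    MvN p (p.submatrix e e) := by
  obtain ⟨h1, h2⟩ := isStarProjection_iff_conj.1 hp
  refine ⟨p.submatrix id e, ?_, ?_⟩
  · rw [Matrix.conjTranspose_submatrix, h2, Matrix.submatrix_mul_equiv, h1,
      Matrix.submatrix_id_id]
  · rw [Matrix.conjTranspose_submatrix, h2,
      ← Matrix.submatrix_mul p p e id e Function.bijective_id, h1]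

theorem isStarProjection_fromBlocks {p : Matrix m m A} {q : Matrix n n A}
    (hp : IsStarProjection p) (hq : IsStarProjection q) :
    IsStarProjection (Matrix.fromBlocks p 0 0 q) := by
  obtain ⟨h1, h2⟩ := isStarProjection_iff_conj.1 hp
  obtain ⟨h3, h4⟩ := isStarProjection_iff_conj.1 hq
  refine isStarProjection_iff_conj.2 ⟨?_, ?_⟩
  · simp [Matrix.fromBlocks_multiply, h1, h3]
  · simp [Matrix.fromBlocks_conjTranspose, h2, h4]

theorem MvN.fromBlocks {p : Matrix l l A} {p' : Matrix m m A} {q : Matrix n n A}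
    {q' : Matrix o o A} (h : MvN p p') (h' : MvN q q') :
    MvN (Matrix.fromBlocks p 0 0 q) (Matrix.fromBlocks p' 0 0 q') := by
  obtain ⟨v, h1, h2⟩ := h
  obtain ⟨w, h3, h4⟩ := h'
  exact ⟨Matrix.fromBlocks v 0 0 w,
    by simp [Matrix.fromBlocks_multiply, Matrix.fromBlocks_conjTranspose, h1, h3],
    by simp [Matrix.fromBlocks_multiply, Matrix.fromBlocks_conjTranspose, h2, h4]⟩

end MvN

/-! ### The Murray-von Neumann monoid and the ordered group `K₀` -/

section K0

variable (A : Type u) [Ring A] [StarRing A]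

/-- The projections in the matrix algebras `M_k(A)`, for all `k`. -/
abbrev MatProj : Type u := Σ k : ℕ, {p : Matrix (Fin k) (Fin k) A // IsStarProjection p}

/-- Murray-von Neumann equivalence on the projections of all matrix algebras. -/
instance mvnSetoid : Setoid (MatProj A) where
  r p q := MvN p.2.1 q.2.1
  iseqv := ⟨fun p => MvN.refl p.2.2, fun h => h.symm,
    fun {p _ r} h h' => MvN.trans p.2.2 r.2.2 h h'⟩

variable {A}

/-- The diagonal sum `diag(p, q)` of two matrix projections. -/
def MatProj.dsum (p q : MatProj A) : MatProj A :=
  ⟨p.1 + q.1,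
    (Matrix.fromBlocks p.2.1 0 0 q.2.1).submatrix finSumFinEquiv.symm finSumFinEquiv.symm,
    isStarProjection_submatrix (isStarProjection_fromBlocks p.2.2 q.2.2) _⟩

variable (A)

/-- The monoid `V(A)` of Murray-von Neumann classes of projections in matrices over `A`. -/
def MvNMonoid : Type u := Quotient (mvnSetoid A)

variable {A}

theorem dsum_mvn (p q : MatProj A) :
    MvN (p.dsum q).2.1 (Matrix.fromBlocks p.2.1 0 0 q.2.1) :=
  (MvN.submatrix (isStarProjection_fromBlocks p.2.2 q.2.2) _).symm

instance : Add (MvNMonoid A) where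
  add := Quotient.map₂ MatProj.dsum (by
    intro p p' h q q' h'
    have hb := isStarProjection_fromBlocks p.2.2 q.2.2
    have hb' := isStarProjection_fromBlocks p'.2.2 q'.2.2
    exact MvN.trans (p.dsum q).2.2 (p'.dsum q').2.2 (dsum_mvn p q)
      (MvN.trans hb (p'.dsum q').2.2 (MvN.fromBlocks h h') (dsum_mvn p' q').symm))

instance : Zero (MvNMonoid A) where
  zero := Quotient.mk _ ⟨0, 0, IsStarProjection.zero _⟩

instance : AddCommMonoid (MvNMonoid A) where
  add_assoc := by
    rintro ⟨p⟩ ⟨q⟩ ⟨r⟩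
    refine Quotient.sound ?_
    change MvN ((p.dsum q).dsum r).2.1 (p.dsum (q.dsum r)).2.1
    have hL := isStarProjection_fromBlocks (isStarProjection_fromBlocks p.2.2 q.2.2) r.2.2
    have hR := isStarProjection_fromBlocks p.2.2 (isStarProjection_fromBlocks q.2.2 r.2.2)
    have h1 := dsum_mvn (p.dsum q) r
    have h2 := MvN.fromBlocks (dsum_mvn p q) (MvN.refl r.2.2)
    have h3 := MvN.submatrix hL
      (Equiv.sumAssoc (Fin p.1) (Fin q.1) (Fin r.1)).symm
    have h4 := MvN.fromBlocks (MvN.refl p.2.2) (dsum_mvn q r).symm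
    have h5 := (dsum_mvn p (q.dsum r)).symm
    have e : (Matrix.fromBlocks (Matrix.fromBlocks p.2.1 0 0 q.2.1) 0 0 r.2.1).submatrix
        (Equiv.sumAssoc (Fin p.1) (Fin q.1) (Fin r.1)).symm
        (Equiv.sumAssoc (Fin p.1) (Fin q.1) (Fin r.1)).symm =
        Matrix.fromBlocks p.2.1 0 0 (Matrix.fromBlocks q.2.1 0 0 r.2.1) := by
      ext (i | i | i) (j | j | j) <;> rfl
    rw [e] at h3
    have hp := ((p.dsum q).dsum r).2.2
    have hq := (p.dsum (q.dsum r)).2.2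
    exact MvN.trans hp hq (MvN.trans hp hR (MvN.trans hp hL h1 h2) h3)
      (MvN.trans hR hq h4 h5)
  zero_add := by
    rintro ⟨p⟩
    refine Quotient.sound ?_
    let z : MatProj A := ⟨0, 0, IsStarProjection.zero _⟩
    change MvN (z.dsum p).2.1 p.2.1
    refine MvN.trans (z.dsum p).2.2 p.2.2 (dsum_mvn z p) ?_
    have h := MvN.submatrix (isStarProjection_fromBlocks z.2.2 p.2.2)
      (Equiv.emptySum (Fin 0) (Fin p.1)).symm
    exact h
  add_zero := by
    rintro ⟨p⟩
    refine Quotient.sound ?_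
    let z : MatProj A := ⟨0, 0, IsStarProjection.zero _⟩
    change MvN (p.dsum z).2.1 p.2.1
    refine MvN.trans (p.dsum z).2.2 p.2.2 (dsum_mvn p z) ?_
    have h := MvN.submatrix (isStarProjection_fromBlocks p.2.2 z.2.2)
      (Equiv.sumEmpty (Fin p.1) (Fin 0)).symm
    exact h
  add_comm := by
    rintro ⟨p⟩ ⟨q⟩
    refine Quotient.sound ?_
    change MvN (p.dsum q).2.1 (q.dsum p).2.1
    have hb := isStarProjection_fromBlocks p.2.2 q.2.2
    have h := MvN.submatrix hb (Equiv.sumComm (Fin q.1) (Fin p.1))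
    have e : (Matrix.fromBlocks p.2.1 0 0 q.2.1).submatrix
        (Equiv.sumComm (Fin q.1) (Fin p.1)) (Equiv.sumComm (Fin q.1) (Fin p.1)) =
        Matrix.fromBlocks q.2.1 0 0 p.2.1 := by
      ext (i | i) (j | j) <;> rfl
    rw [e] at h
    exact MvN.trans (p.dsum q).2.2 (q.dsum p).2.2 (dsum_mvn p q)
      (MvN.trans hb (q.dsum p).2.2 h (dsum_mvn q p).symm)
  nsmul := nsmulRec

variable (A)

/-- `K₀(A)` of a unital C*-algebra: the Grothendieck group of the Murray-von Neumann monoid. -/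
abbrev K0 : Type u := Algebra.GrothendieckAddGroup (MvNMonoid A)

variable {A}

/-- The class `[p]` in `K₀(A)` of a projection `p` in a matrix algebra over `A`. -/
def K0.mk (p : MatProj A) : K0 A :=
  Algebra.GrothendieckAddGroup.of (Quotient.mk (mvnSetoid A) p)

variable (A)

/-- The positive cone `K₀(A)⁺ = {[p] : p a projection in some M_k(A)}`. -/
def K0.posCone : Set (K0 A) := Set.range K0.mk

/-- The class `[1_A]` in `K₀(A)`. -/
def K0.unitClass : K0 A := K0.mk ⟨1, 1, IsStarProjection.one _⟩

end K0

/-! ### Traces -/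

section Trace

variable (A : Type u) [CStarAlgebra A]

/-- The trace space of `A`: all bounded linear functionals `τ` with `τ(xy) = τ(yx)`. -/
def traceSpace : Submodule ℂ (A →L[ℂ] ℂ) where
  carrier := {τ | ∀ x y : A, τ (x * y) = τ (y * x)}
  add_mem' h h' x y := by simp [h x y, h' x y]
  zero_mem' x y := by simp
  smul_mem' c τ h x y := by simp [h x y]

/-- The tracial states of `A`: positive traces of value `1` at the unit. -/
def tracialStates : Set (traceSpace A) :=
  {τ | (∀ x : A, 0 ≤ τ.1 (star x * x)) ∧ τ.1 1 = 1}

variable {A}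

/-- `φ 0, …, φ (n-1)` lists the extreme points of the tracial state space, without repetition. -/
def EnumeratesExtremeTraces {n : ℕ} (φ : Fin n → traceSpace A) : Prop :=
  Function.Injective φ ∧ Set.range φ = (tracialStates A).extremePoints ℝ

/-- The value `∑ᵢ τ(xᵢᵢ)` of (the unnormalized extension of) a trace at a matrix over `A`. -/
def trMat {m : Type} [Fintype m] (τ : traceSpace A) (x : Matrix m m A) : ℂ :=
  ∑ i, τ.1 (x i i)

theorem trMat_mul_comm {m n : Type} [Fintype m] [Fintype n] (τ : traceSpace A)
    (x : Matrix m n A) (y : Matrix n m A) : trMat τ (x * y) = trMat τ (y * x) := by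
  simp only [trMat, Matrix.mul_apply, map_sum]
  rw [Finset.sum_comm]
  exact Finset.sum_congr rfl fun i _ => Finset.sum_congr rfl fun j _ => τ.2 _ _

theorem trMat_dsum (τ : traceSpace A) (p q : MatProj A) :
    trMat τ (p.dsum q).2.1 = trMat τ p.2.1 + trMat τ q.2.1 := by
  simp only [trMat, MatProj.dsum, Matrix.submatrix_apply]
  exact (Equiv.sum_comp finSumFinEquiv.symm
    (fun i => τ.1 (Matrix.fromBlocks p.2.1 0 0 q.2.1 i i))).trans (Fintype.sum_sum_type _)

/-- The homomorphism `V(A) → ℝⁿ`, `[p] ↦ (φ₀(p), …, φₙ₋₁(p))`. Values of tracial states at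
projections are real. -/
def gammaMonoid {n : ℕ} (φ : Fin n → traceSpace A) : MvNMonoid A →+ (Fin n → ℝ) where
  toFun := Quotient.lift (fun p : MatProj A => fun i => (trMat (φ i) p.2.1).re) (by
    rintro p q ⟨v, h1, h2⟩
    funext i
    rw [← h1, ← h2, trMat_mul_comm])
  map_zero' := by
    funext i
    change (trMat (φ i) (0 : Matrix (Fin 0) (Fin 0) A)).re = 0
    simp [trMat]
  map_add' := by
    rintro ⟨p⟩ ⟨q⟩
    funext i
    change (trMat (φ i) (p.dsum q).2.1).re = (trMat (φ i) p.2.1).re + (trMat (φ i) q.2.1).re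
    rw [trMat_dsum, Complex.add_re]

/-- The homomorphism `Γ : K₀(A) → ℝⁿ` given by the maps induced by `φ₀, …, φₙ₋₁` on `K₀(A)`. -/
def Gamma {n : ℕ} (φ : Fin n → traceSpace A) : K0 A →+ (Fin n → ℝ) :=
  Algebra.GrothendieckAddGroup.lift (gammaMonoid φ)

theorem Gamma_mk {n : ℕ} (φ : Fin n → traceSpace A) (p : MatProj A) (i : Fin n) :
    Gamma φ (K0.mk p) i = (trMat (φ i) p.2.1).re :=
  congrFun (DFunLike.congr_fun
    (Algebra.GrothendieckAddGroup.lift.symm_apply_apply (gammaMonoid φ))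
    (Quotient.mk (mvnSetoid A) p)) i

/-- `K₀(A)` is embedded in `ℝⁿ`: `Γ` is an injective unit-preserving homomorphism of ordered
abelian groups from `(K₀(A), K₀(A)⁺, [1_A])` to `(ℝⁿ, ℝⁿ₊, (1, …, 1))`. -/
def K0Embedded {n : ℕ} (φ : Fin n → traceSpace A) : Prop :=
  Function.Injective (Gamma φ) ∧ Gamma φ (K0.unitClass A) = 1 ∧
    ∀ g ∈ K0.posCone A, 0 ≤ Gamma φ g

end Trace

/-! ### AF-algebras and the fundamental group -/

section AF

/-- A unital AF-algebra: the closure of the union of an increasing sequence of finite-dimensional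
C*-subalgebras (which may be taken to contain the unit). -/
def IsAF (A : Type u) [CStarAlgebra A] : Prop :=
  ∃ B : ℕ → StarSubalgebra ℂ A, Monotone B ∧ (∀ k, FiniteDimensional ℂ (B k)) ∧
    Dense (⋃ k, (B k : Set A))

variable {A : Type u} [CStarAlgebra A]

/-- `Φ` is a `*`-isomorphism of `A` onto the corner `p M_k(A) p`, for a full projection `p` of
`M_k(A)` (a projection that generates `M_k(A)` as a two-sided ideal). -/
def IsSelfSimilar {k : ℕ} (p : Matrix (Fin k) (Fin k) A)
    (Φ : A →⋆ₙₐ[ℂ] Matrix (Fin k) (Fin k) A) : Prop :=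
  IsStarProjection p ∧ TwoSidedIdeal.span {p} = ⊤ ∧
    Function.Injective Φ ∧ Set.range Φ = {x | p * x * p = x}

/-- The fundamental group of `A` with respect to the extreme tracial states `φ`: the matrices, in
the basis `φ` of the trace space, of the maps `τ ↦ (Tr_k ⊗ τ) ∘ Φ`, for all `*`-isomorphisms
`Φ : A → p M_k(A) p` with `p` a full projection of `M_k(A)`. The `j`-th column of the matrix holds
the coordinates of the image of `φ j`. -/
def fundamentalGroup {n : ℕ} (φ : Fin n → traceSpace A) : Set (Matrix (Fin n) (Fin n) ℝ) :=
  {M | ∃ (k : ℕ) (p : Matrix (Fin k) (Fin k) A) (Φ : A →⋆ₙₐ[ℂ] Matrix (Fin k) (Fin k) A),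
    IsSelfSimilar p Φ ∧
      ∀ (j : Fin n) (x : A), trMat (φ j) (Φ x) = ∑ i, (M i j : ℂ) * (φ i).1 x}

end AF

/-! ### Invariant subgroups of the plane -/

section Plane

/-- `A G = G`. -/
def IsInvariant (A : Matrix (Fin 2) (Fin 2) ℝ) (G : AddSubgroup (Fin 2 → ℝ)) : Prop :=
  (fun v => A *ᵥ v) '' (G : Set (Fin 2 → ℝ)) = G

/-- `I(G)`: the matrices `diag(a, b)` and `antidiag(a, b)`, `a, b > 0`, that leave `G` invariant. -/
def invarianceGroup (G : AddSubgroup (Fin 2 → ℝ)) : Set (Matrix (Fin 2) (Fin 2) ℝ) :=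
  {M | (∃ a b : ℝ, 0 < a ∧ 0 < b ∧ (M = !![a, 0; 0, b] ∨ M = !![0, a; b, 0])) ∧ IsInvariant M G}

/-- `{diag(aⁿ, bⁿ) : n ∈ ℤ}`. -/
def diagPowers (a b : ℝ) : Set (Matrix (Fin 2) (Fin 2) ℝ) :=
  {M | ∃ n : ℤ, M = !![a ^ n, 0; 0, b ^ n]}

end Plane

end AFFund

end

/-! Plane part. Let `H` be the group of reals `r` with `diag(0, r) G ⊆ G` (`secondScalars`). As `a`
is algebraic and `a ≠ b`, some integer polynomial `F` has `F(a) = 0 ≠ F(b)`; since `F(A) = diag(0,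
F(b))`, the nonzero rational `F(b)` lies in `H`. Write `b = P/Q` in lowest terms. `H` is stable
under `b` and `b⁻¹`, so by Bézout it is stable under division by `P` and by `Q`
(`div_mem_of_coprime`). Its least positive integer `N` is therefore prime to both
(`exists_nat_scalar`). One of `P`, `Q` is an integer `R > 1`, because `b ≠ 1`. With `t = R ^ φ(N)`
Euler gives `N ∣ t - 1`, so `t - 1` and `(t - 1)/t` lie in `H`, and `diag(1, t) = 1 + diag(0, t -
1)` has the inverse `1 - diag(0, (t - 1)/t)` on `G` (`exists_isInvariant_nat`). Since `a ≠ 1`,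
`diag(1, t)` is no power of `A`.

C*-algebra part. If the fundamental group were `{Aⁿ}`, then `G = Γ(K₀)` would be `A`-invariant,
hence `diag(1, t)`-invariant, and it suffices to realize `diag(1, t)` in the fundamental group
(`AFSystem.mem_fundamentalGroup`). This takes two steps.

The first is that `diag(1, t)` acts on the monoid `V(A)` and not only on `G`
(`AFSystem.scalesClasses`). By approximation from finite-dimensional stages, where `V` is `ℕ^κ`,
`V(A)` is cancellative and unperforated, and strict inequality on the extreme traces implies
inequality of classes (`AFSystem.exists_eq_add_of_trace_lt`). So strictly positive vectors of `G`
are classes of projections; vectors with a zero coordinate are treated separately.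

The second is Elliott's back-and-forth argument (`IsGraph.exists_extension`,
`AFSystem.exists_starHom_matrix`). Isomorphisms between finite-dimensional subalgebras of `A` and of
the corner `p M_K(A) p`, encoded by their graphs, are extended alternately on both sides. The
closure of the union is the graph of an isomorphism that scales the two traces by `1` and `t`. -/

set_option linter.unusedSectionVars false

noncomputable section

namespace AFFund

/-! ### Matrices over a C*-algebra as a C*-algebra -/

section CStarMatrixInstance

variable {A : Type u} [CStarAlgebra A] {n : Type} [Fintype n] [DecidableEq n]

/-- The norm on square matrices over a C*-algebra as operators on the Hilbert module `A^n`. -/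
instance matrixNormedRing : NormedRing (Matrix n n A) :=
  letI := CStarAlgebra.spectralOrder A
  letI := CStarAlgebra.spectralOrderedRing A
  { norm := fun x => ‖CStarMatrix.ofMatrix x‖
    toRing := Matrix.instRing
    -- The C*-norm metric is given the entrywise uniformity definitionally, so density and
    -- continuity can be checked entry by entry.
    toMetricSpace := MetricSpace.replaceUniformity
      (inferInstanceAs (MetricSpace (CStarMatrix n n A))) (U := Matrix.instUniformSpace n n A) rfl
    dist_eq := fun x y => by
      refine (dist_comm (CStarMatrix.ofMatrix x) (CStarMatrix.ofMatrix y)).trans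
        ((dist_eq_norm (CStarMatrix.ofMatrix y) (CStarMatrix.ofMatrix x)).trans ?_)
      rw [sub_eq_neg_add]
      rfl
    norm_mul_le := fun x y => norm_mul_le (CStarMatrix.ofMatrix x) (CStarMatrix.ofMatrix y) }

instance matrixNormedAlgebra : NormedAlgebra ℂ (Matrix n n A) :=
  letI := CStarAlgebra.spectralOrder A
  letI := CStarAlgebra.spectralOrderedRing A
  { toAlgebra := Matrix.instAlgebra
    norm_smul_le := fun r x => norm_smul_le r (CStarMatrix.ofMatrix x) }

/-- Square matrices over a C*-algebra form a C*-algebra. -/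
instance matrixCStarAlgebra : CStarAlgebra (Matrix n n A) :=
  letI := CStarAlgebra.spectralOrder A
  letI := CStarAlgebra.spectralOrderedRing A
  { toNormedRing := matrixNormedRing
    toStarRing := (inferInstance : StarRing (Matrix n n A))
    toNormedAlgebra := matrixNormedAlgebra
    norm_mul_self_le := fun x => CStarRing.norm_mul_self_le (CStarMatrix.ofMatrix x)
    toCompleteSpace := inferInstanceAs (CompleteSpace (Matrix n n A))
    toStarModule := inferInstanceAs (StarModule ℂ (Matrix n n A)) }

end CStarMatrixInstance

/-! ### Perturbation of projections and partial isometries -/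

section Projections

variable {N : Type u} [CStarAlgebra N]

/-- Polar decomposition of an approximate partial isometry: `s = y*y + (1 - Q)` is positive,
invertible by the Neumann series, and commutes with `Q`, so `w = y s^(-1/2)` has `w*w = Q`. The
bound on `P - yy*` makes `yy* + (1 - P)` invertible, and cancelling it gives `ww* = P`. -/
theorem exists_partialIsometry_of_norm_lt {P Q y : N} (hP : IsStarProjection P)
    (hQ : IsStarProjection Q) (hPy : P * y = y) (hyQ : y * Q = y)
    (h1 : ‖P - y * star y‖ < 1) (h2 : ‖Q - star y * y‖ < 1) :
    ∃ w : N, w * star w = P ∧ star w * w = Q := by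
  let _ := CStarAlgebra.spectralOrder N
  let _ := CStarAlgebra.spectralOrderedRing N
  have hQs : star Q = Q := hQ.2
  have hPs : star P = P := hP.2
  have hQQ : Q * Q = Q := hQ.1
  have hPP : P * P = P := hP.1
  have hQy : Q * star y = star y := by
    rw [← hQs, ← star_mul, hyQ]
  have hyP : star y * P = star y := by
    rw [← hPs, ← star_mul, hPy]
  set s : N := star y * y + (1 - Q) with hs
  have hsu : IsUnit s := by
    have := isUnit_one_sub_of_norm_lt_one h2
    rwa [show 1 - (Q - star y * y) = s by rw [hs]; abel] at this
  have hsu' : IsUnit (y * star y + (1 - P)) := by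
    have := isUnit_one_sub_of_norm_lt_one h1
    rwa [show 1 - (P - y * star y) = y * star y + (1 - P) by abel] at this
  have hpos : IsStrictlyPositive s :=
    ⟨add_nonneg (star_mul_self_nonneg y) hQ.one_sub.nonneg, hsu⟩
  set r : N := s ^ (-(1 / 2 : ℝ)) with hr
  have hrsr : r * s * r = 1 := CFC.conjugate_rpow_neg_one_half s hpos
  have hrsa : star r = r := (CFC.rpow_nonneg (a := s)).isSelfAdjoint
  have hcomm : ∀ {z : N}, Commute s z → Commute r z := fun h => h.cfc_nnreal _
  have hrs : r * s = s * r := hcomm (Commute.refl s)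
  have hsQ : s * Q = star y * y := by
    rw [hs, add_mul, sub_mul, hQQ, one_mul, sub_self, add_zero, mul_assoc, hyQ]
  have hQs' : Q * s = star y * y := by
    rw [hs, mul_add, mul_sub, hQQ, mul_one, sub_self, add_zero, ← mul_assoc, hQy]
  have hrQ : r * Q = Q * r := hcomm (show s * Q = Q * s by rw [hsQ, hQs'])
  have hsrr : s * (r * r) = 1 := by rw [← mul_assoc, ← hrs, hrsr]
  refine ⟨y * r, ?_, ?_⟩
  · refine hsu'.mul_left_cancel ?_
    rw [star_mul, hrsa]
    have e1 : (y * star y + (1 - P)) * P = y * star y := by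
      rw [add_mul, sub_mul, hPP, one_mul, sub_self, add_zero, mul_assoc, hyP]
    have e2 : (y * star y + (1 - P)) * y = y * s := by
      rw [add_mul, sub_mul, hPy, one_mul, sub_self, add_zero, mul_assoc, hs, mul_add, mul_sub,
        hyQ, mul_one, sub_self, add_zero]
    have e3 : s * (r * (r * star y)) = star y := by
      rw [← mul_assoc r, ← mul_assoc, hsrr, one_mul]
    rw [e1, mul_assoc y r, ← mul_assoc _ y, e2, mul_assoc y, e3]
  · rw [star_mul, hrsa, mul_assoc, ← mul_assoc (star y), ← hQs', ← mul_assoc, ← mul_assoc, hrQ,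
      mul_assoc Q, mul_assoc Q, hrsr, mul_one]

theorem exists_partialIsometry_of_norm_sub_lt {P Q : N} (hP : IsStarProjection P)
    (hQ : IsStarProjection Q) (h : ‖P - Q‖ < 1) :
    ∃ w : N, w * star w = P ∧ star w * w = Q := by
  have hQs : star Q = Q := hQ.2
  have hPs : star P = P := hP.2
  have hQQ : Q * Q = Q := hQ.1
  have hPP : P * P = P := hP.1
  have key : ∀ {P Q : N}, IsStarProjection P → IsStarProjection Q → ‖P - Q‖ < 1 →
      ‖P - P * Q * P‖ < 1 := by
    intro P Q hP hQ h
    have e : P - P * Q * P = P * (P - Q) * P := by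
      rw [mul_sub, sub_mul, hP.1, hP.1]
    rw [e]
    have hPn : ‖P‖ ≤ 1 := hP.norm_le
    calc ‖P * (P - Q) * P‖ ≤ ‖P‖ * ‖P - Q‖ * ‖P‖ := norm_mul₃_le
      _ ≤ 1 * ‖P - Q‖ * 1 := by gcongr
      _ < 1 := by linarith
  refine exists_partialIsometry_of_norm_lt (y := P * Q) hP hQ (by rw [← mul_assoc, hPP])
    (by rw [mul_assoc, hQQ]) ?_ ?_
  · rw [star_mul, hQs, hPs, mul_assoc P, ← mul_assoc Q, hQQ, ← mul_assoc]
    exact key hP hQ h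
  · rw [star_mul, hQs, hPs, mul_assoc Q, ← mul_assoc P, hPP, ← mul_assoc]
    exact key hQ hP (by rwa [norm_sub_rev])

/-- The bound `3/16` puts the spectrum within `1/4` of `{0, 1}`; in particular it misses `1/2`, so
the cut-off at `1/2` is continuous on it. -/
theorem exists_isStarProjection_norm_sub_lt {x : N} (hx : IsSelfAdjoint x)
    (h : ‖x * x - x‖ < 3 / 16) : ∃ r : N, IsStarProjection r ∧ ‖r - x‖ < 1 / 2 := by
  rcases subsingleton_or_nontrivial N with hN | hN
  · exact ⟨x, ⟨Subsingleton.elim _ _, hx⟩, by simp⟩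
  let f : ℝ → ℝ := fun t => if 1 / 2 < t then 1 else 0
  have hspec : ∀ t ∈ spectrum ℝ x, |t * t - t| < 3 / 16 := by
    intro t ht
    have h1 := spectrum.subset_polynomial_aeval x (Polynomial.X * Polynomial.X - Polynomial.X)
      ⟨t, ht, rfl⟩
    have h2 := spectrum.norm_le_norm_of_mem h1
    simp only [Polynomial.eval_sub, Polynomial.eval_mul, Polynomial.eval_X, map_sub, map_mul,
      Polynomial.aeval_X, Real.norm_eq_abs] at h2
    exact h2.trans_lt h
  have hne : ∀ t ∈ spectrum ℝ x, t ≠ 1 / 2 := by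
    rintro t ht rfl
    have := hspec _ ht
    norm_num [abs_lt] at this
  have hcont : ContinuousOn f (spectrum ℝ x) := by
    intro t ht
    refine ContinuousAt.continuousWithinAt ?_
    rcases lt_or_gt_of_ne (hne t ht) with h | h
    · refine ContinuousAt.congr (continuousAt_const (y := (0 : ℝ))) ?_
      filter_upwards [eventually_lt_nhds h] with s hs
      simp only [f, if_neg (not_lt.2 hs.le)]
    · refine ContinuousAt.congr (continuousAt_const (y := (1 : ℝ))) ?_
      filter_upwards [eventually_gt_nhds h] with s hs
      simp only [f, if_pos hs]
  refine ⟨cfc f x, ⟨?_, IsSelfAdjoint.cfc⟩, ?_⟩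
  · show cfc f x * cfc f x = cfc f x
    rw [← cfc_mul f f x hcont hcont]
    refine cfc_congr fun t _ => ?_
    by_cases h : 1 / 2 < t <;> simp [f]
  · nth_rw 2 [← cfc_id ℝ x]
    rw [← cfc_sub f id x hcont continuousOn_id]
    refine norm_cfc_lt (by norm_num) fun t ht => ?_
    have h3 := abs_lt.1 (hspec t ht)
    rw [Real.norm_eq_abs, abs_lt]
    by_cases h : 1 / 2 < t
    · simp only [f, if_pos h, id]
      constructor <;> nlinarith
    · simp only [f, if_neg h, id]
      constructor <;> nlinarith

end Projections

/-! ### Calculus of Murray-von Neumann classes -/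

section Classes

variable {A : Type u} [Ring A] [StarRing A]
variable {l m n : Type} [Fintype l] [Fintype m] [Fintype n]

theorem isStarProjection_of_mul_conjTranspose {Q : Matrix n n A} {v : Matrix m n A}
    (h : vᴴ * v = Q) (hv : v * Q = v) :
    IsStarProjection (v * vᴴ) := by
  refine isStarProjection_iff_conj.2 ⟨?_, by
    rw [Matrix.conjTranspose_mul, Matrix.conjTranspose_conjTranspose]⟩
  rw [Matrix.mul_assoc, ← Matrix.mul_assoc vᴴ, h, ← Matrix.mul_assoc, hv]

/-- The partial isometry of a Murray-von Neumann equivalence can be chosen with the right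
supports. -/
theorem MvN.exists_support {P : Matrix m m A} {Q : Matrix n n A} (hP : IsStarProjection P)
    (hQ : IsStarProjection Q) (h : MvN P Q) :
    ∃ v : Matrix m n A, v * vᴴ = P ∧ vᴴ * v = Q ∧ P * v = v ∧ v * Q = v := by
  obtain ⟨h1, h2⟩ := isStarProjection_iff_conj.1 hP
  obtain ⟨v, h3, h4⟩ := h
  have e : v * (vᴴ * v) = P * v := by rw [← Matrix.mul_assoc, h3]
  refine ⟨P * v, ?_, ?_, ?_, ?_⟩
  · rw [Matrix.conjTranspose_mul, h2, Matrix.mul_assoc, ← Matrix.mul_assoc v, h3, h1, h1]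
  · rw [Matrix.conjTranspose_mul, h2, Matrix.mul_assoc, ← Matrix.mul_assoc P, h1, ← e,
      ← Matrix.mul_assoc, h4, (isStarProjection_iff_conj.1 hQ).1]
  · rw [← Matrix.mul_assoc, h1]
  · rw [← h4, Matrix.mul_assoc, e, ← Matrix.mul_assoc, h1]

/-- The class of a matrix projection in the Murray-von Neumann monoid. -/
def vmk (p : MatProj A) : MvNMonoid A := Quotient.mk (mvnSetoid A) p

open Classical in
/-- The Murray-von Neumann class of a projection matrix with an arbitrary finite index type. -/
def cls (p : Matrix m m A) : MvNMonoid A :=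
  if h : IsStarProjection p then
    vmk ⟨Fintype.card m,
      p.submatrix (Fintype.equivFin m).symm (Fintype.equivFin m).symm,
      isStarProjection_submatrix h _⟩
  else 0

theorem vmk_eq_vmk_iff {p q : MatProj A} : vmk p = vmk q ↔ MvN p.2.1 q.2.1 :=
  ⟨fun h => Quotient.exact h, fun h => Quotient.sound h⟩

theorem cls_eq_cls_iff {p : Matrix m m A} {q : Matrix n n A} (hp : IsStarProjection p)
    (hq : IsStarProjection q) : cls p = cls q ↔ MvN p q := by
  rw [cls, cls, dif_pos hp, dif_pos hq, vmk_eq_vmk_iff]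
  have h1 := MvN.submatrix hp (Fintype.equivFin m).symm
  have h2 := MvN.submatrix hq (Fintype.equivFin n).symm
  have h3 := isStarProjection_submatrix hp (Fintype.equivFin m).symm
  have h4 := isStarProjection_submatrix hq (Fintype.equivFin n).symm
  exact ⟨fun h => h1.trans hp hq (h.trans h3 hq h2.symm),
    fun h => h1.symm.trans h3 h4 (h.trans hp h4 h2)⟩

theorem cls_mk (p : MatProj A) : cls p.2.1 = vmk p := by
  rw [cls, dif_pos p.2.2, vmk_eq_vmk_iff]
  exact (MvN.submatrix p.2.2 _).symm

theorem exists_cls_eq (x : MvNMonoid A) :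
    ∃ p : MatProj A, cls p.2.1 = x := by
  obtain ⟨p, rfl⟩ := Quotient.exists_rep x
  exact ⟨p, cls_mk p⟩

theorem cls_dsum (p q : MatProj A) : cls (p.dsum q).2.1 = cls p.2.1 + cls q.2.1 := by
  rw [cls_mk, cls_mk, cls_mk]
  rfl

theorem cls_fromBlocks {p : Matrix m m A} {q : Matrix n n A} (hp : IsStarProjection p)
    (hq : IsStarProjection q) : cls (Matrix.fromBlocks p 0 0 q) = cls p + cls q := by
  obtain ⟨p', hp'⟩ := exists_cls_eq (cls p)
  obtain ⟨q', hq'⟩ := exists_cls_eq (cls q)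
  rw [← hp', ← hq', ← cls_dsum,
    cls_eq_cls_iff (isStarProjection_fromBlocks hp hq) (p'.dsum q').2.2]
  rw [cls_eq_cls_iff p'.2.2 hp] at hp'
  rw [cls_eq_cls_iff q'.2.2 hq] at hq'
  exact ((dsum_mvn p' q').trans (p'.dsum q').2.2 (isStarProjection_fromBlocks hp hq)
    (hp'.fromBlocks hq')).symm

theorem cls_zero : cls (0 : Matrix m m A) = 0 := by
  have e : (0 : MvNMonoid A) = cls (0 : Matrix (Fin 0) (Fin 0) A) :=
    (cls_mk ⟨0, 0, IsStarProjection.zero _⟩).symm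
  rw [e, cls_eq_cls_iff (IsStarProjection.zero _) (IsStarProjection.zero _)]
  exact ⟨0, by simp, by simp⟩

theorem cls_add {p q : Matrix m m A} (hp : IsStarProjection p) (hq : IsStarProjection q)
    (hpq : p * q = 0) : cls (p + q) = cls p + cls q := by
  obtain ⟨h1, h2⟩ := isStarProjection_iff_conj.1 hp
  obtain ⟨h3, h4⟩ := isStarProjection_iff_conj.1 hq
  have hqp : q * p = 0 := by
    have := congrArg Matrix.conjTranspose hpq
    rwa [Matrix.conjTranspose_mul, h2, h4, Matrix.conjTranspose_zero] at this
  rw [← cls_fromBlocks hp hq, cls_eq_cls_iff (hp.add hq hpq) (isStarProjection_fromBlocks hp hq)]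
  -- The row `(p q)` is a partial isometry from `diag(p, q)` to `p + q` because `pq = qp = 0`.
  refine ⟨Matrix.fromCols p q, ?_, ?_⟩
  · rw [Matrix.conjTranspose_fromCols_eq_fromRows_conjTranspose, Matrix.fromCols_mul_fromRows,
      h2, h4, h1, h3]
  · rw [Matrix.conjTranspose_fromCols_eq_fromRows_conjTranspose, Matrix.fromRows_mul_fromCols,
      h2, h4, h1, h3, hpq, hqp]

theorem cls_sum {ι : Type*} {p : ι → Matrix m m A} (s : Finset ι)
    (hp : ∀ i, IsStarProjection (p i)) (ho : ∀ i j, i ≠ j → p i * p j = 0) :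
    IsStarProjection (∑ i ∈ s, p i) ∧ cls (∑ i ∈ s, p i) = ∑ i ∈ s, cls (p i) := by
  classical
  induction s using Finset.induction_on with
  | empty => exact ⟨by simp, by simpa using cls_zero⟩
  | insert a s ha ih =>
    have : p a * ∑ i ∈ s, p i = 0 := by
      rw [Finset.mul_sum]
      exact Finset.sum_eq_zero fun i hi => ho a i (by rintro rfl; exact ha hi)
    rw [Finset.sum_insert ha, Finset.sum_insert ha, ← ih.2]
    exact ⟨(hp a).add ih.1 this, cls_add (hp a) ih.1 this⟩

/-- A projection whose class is a finite sum of classes has a corresponding family of columns. -/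
theorem exists_columns {ι : Type} [Fintype ι] [DecidableEq ι] {p : Matrix m m A}
    {q : ι → Matrix l l A}
    (hp : IsStarProjection p) (hq : ∀ i, IsStarProjection (q i)) (h : cls p = ∑ i, cls (q i)) :
    ∃ w : ι → Matrix m l A, (∀ i j, (w i)ᴴ * w j = if i = j then q i else 0) ∧
      (∀ i, w i * q i = w i) ∧ ∑ i, w i * (w i)ᴴ = p := by
  -- `X i` is the block column with `q i` in block `i`. The `X i (X i)ᴴ` add up to the block
  -- diagonal of the `q i`, which is equivalent to `p`; the equivalence `v` carries these columns to
  -- the ones sought.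
  let X : ι → Matrix (l × ι) l A := fun i => Matrix.of fun a b => if a.2 = i then q i a.1 b else 0
  have h1 : ∀ i, q i * q i = q i := fun i => (isStarProjection_iff_conj.1 (hq i)).1
  have h2 : ∀ i, (q i)ᴴ = q i := fun i => (isStarProjection_iff_conj.1 (hq i)).2
  have hXX : ∀ i j, (X i)ᴴ * X j = if i = j then q i else 0 := by
    intro i j
    ext a b
    rw [Matrix.mul_apply, Fintype.sum_prod_type, Finset.sum_comm]
    split_ifs with hij
    · subst hij
      have e : q i a b = ((q i)ᴴ * q i) a b := by rw [h2, h1]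
      rw [e, Matrix.mul_apply]
      rw [Finset.sum_eq_single i]
      · simp [X]
      · intro b _ hb; simp [X, hb]
      · simp
    · refine Finset.sum_eq_zero fun k _ => Finset.sum_eq_zero fun k' _ => ?_
      by_cases hk : k = i
      · subst hk; simp [X, hij]
      · simp [X, hk]
  have hXq : ∀ i, X i * q i = X i := by
    intro i
    ext a b
    rw [Matrix.mul_apply]
    by_cases ha : a.2 = i
    · simp only [X, Matrix.of_apply, ha, if_true]
      conv_rhs => rw [← h1 i, Matrix.mul_apply]
    · simp [X, ha]
  have hXp : ∀ i, IsStarProjection (X i * (X i)ᴴ) := fun i =>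
    isStarProjection_of_mul_conjTranspose (Q := q i) (by rw [hXX, if_pos rfl])
      (hXq i)
  have hXo : ∀ i j, i ≠ j → X i * (X i)ᴴ * (X j * (X j)ᴴ) = 0 := by
    intro i j hij
    rw [Matrix.mul_assoc, ← Matrix.mul_assoc (X i)ᴴ, hXX, if_neg hij, Matrix.zero_mul,
      Matrix.mul_zero]
  obtain ⟨hD, hDc⟩ := cls_sum Finset.univ hXp hXo
  have hX : ∀ i, cls (X i * (X i)ᴴ) = cls (q i) := fun i =>
    (cls_eq_cls_iff (hXp i) (hq i)).2 ⟨X i, rfl, by rw [hXX, if_pos rfl]⟩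
  simp only [hX] at hDc
  rw [← hDc, cls_eq_cls_iff hp hD] at h
  obtain ⟨v, hv1, hv2, hv3, hv4⟩ := h.exists_support hp hD
  have hDX : ∀ j, (∑ i, X i * (X i)ᴴ) * X j = X j := by
    intro j
    rw [Matrix.sum_mul, Finset.sum_eq_single j]
    · rw [Matrix.mul_assoc, hXX, if_pos rfl, hXq]
    · intro i _ hij
      rw [Matrix.mul_assoc, hXX, if_neg hij, Matrix.mul_zero]
    · simp
  refine ⟨fun i => v * X i, fun i j => ?_, fun i => ?_, ?_⟩
  · rw [Matrix.conjTranspose_mul, Matrix.mul_assoc, ← Matrix.mul_assoc vᴴ, hv2, hDX, hXX]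
  · rw [Matrix.mul_assoc, hXq]
  · simp only [Matrix.conjTranspose_mul, Matrix.mul_assoc]
    rw [← Matrix.mul_sum]
    simp only [← Matrix.mul_assoc]
    rw [← Matrix.sum_mul, ← Matrix.mul_assoc, hv4, hv1]

end Classes

/-! ### Functoriality of the class monoid -/

section Functoriality

variable {A B D : Type u} [CStarAlgebra A] [CStarAlgebra B] [CStarAlgebra D]
variable {m n : Type} [Fintype m] [Fintype n]

theorem conjTranspose_map_starAlgHom (f : A →⋆ₐ[ℂ] B) (x : Matrix m n A) :
    (x.map f)ᴴ = xᴴ.map f :=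
  (Matrix.conjTranspose_map f (fun a => map_star f a)).symm

theorem map_mul_starAlgHom {l n : Type} (f : A →⋆ₐ[ℂ] B) (x : Matrix l m A)
    (y : Matrix m n A) :
    (x * y).map f = x.map f * y.map f :=
  Matrix.map_mul

theorem IsStarProjection.matrix_map (f : A →⋆ₐ[ℂ] B) {p : Matrix m m A}
    (hp : IsStarProjection p) : IsStarProjection (p.map f) := by
  obtain ⟨h1, h2⟩ := isStarProjection_iff_conj.1 hp
  exact isStarProjection_iff_conj.2
    ⟨by rw [← map_mul_starAlgHom, h1], by rw [conjTranspose_map_starAlgHom, h2]⟩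

theorem MvN.matrix_map (f : A →⋆ₐ[ℂ] B) {p : Matrix m m A} {q : Matrix n n A} (h : MvN p q) :
    MvN (p.map f) (q.map f) := by
  obtain ⟨v, h1, h2⟩ := h
  exact ⟨v.map f, by rw [conjTranspose_map_starAlgHom, ← map_mul_starAlgHom, h1],
    by rw [conjTranspose_map_starAlgHom, ← map_mul_starAlgHom, h2]⟩

/-- The map of Murray-von Neumann monoids induced by a `*`-homomorphism. -/
def vMap (f : A →⋆ₐ[ℂ] B) : MvNMonoid A →+ MvNMonoid B where
  toFun := Quotient.map (fun p => ⟨p.1, p.2.1.map f, IsStarProjection.matrix_map f p.2.2⟩)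
    fun _ _ h => MvN.matrix_map f h
  map_zero' := Quotient.sound (s := mvnSetoid B) <| by
    change MvN _ _
    exact ⟨0, by simp, by simp⟩
  map_add' := by
    rintro ⟨p⟩ ⟨q⟩
    refine congrArg (Quotient.mk (mvnSetoid B)) (Sigma.ext rfl (heq_of_eq (Subtype.ext ?_)))
    change ((Matrix.fromBlocks p.2.1 0 0 q.2.1).map f).submatrix finSumFinEquiv.symm
        finSumFinEquiv.symm =
      (Matrix.fromBlocks (p.2.1.map f) 0 0 (q.2.1.map f)).submatrix finSumFinEquiv.symm
        finSumFinEquiv.symm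
    rw [Matrix.fromBlocks_map, Matrix.map_zero f (map_zero f), Matrix.map_zero f (map_zero f)]

theorem vMap_cls (f : A →⋆ₐ[ℂ] B) {p : Matrix m m A} (hp : IsStarProjection p) :
    vMap f (cls p) = cls (p.map f) := by
  rw [cls, cls, dif_pos hp, dif_pos (IsStarProjection.matrix_map f hp)]
  rfl

theorem vMap_comp (g : B →⋆ₐ[ℂ] D) (f : A →⋆ₐ[ℂ] B) (x : MvNMonoid A) :
    vMap (g.comp f) x = vMap g (vMap f x) := by
  obtain ⟨p, rfl⟩ := Quotient.exists_rep x
  rfl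

end Functoriality

/-! ### Minimal projections in finite dimension -/

section MinimalProjections

variable {N : Type u} [CStarAlgebra N]

/-- A minimal projection: a nonzero projection `q` with `q N q = ℂ q`. -/
def IsMinProj (q : N) : Prop :=
  IsStarProjection q ∧ q ≠ 0 ∧ ∀ x : N, ∃ z : ℂ, q * x * q = z • q

variable [FiniteDimensional ℂ N]

theorem finite_spectrum_real (y : N) : (spectrum ℝ y).Finite := by
  obtain ⟨P, hP, h0⟩ : ∃ P : Polynomial ℂ, P ≠ 0 ∧ Polynomial.aeval y P = 0 :=
    (Algebra.IsIntegral.isIntegral (R := ℂ) y).isAlgebraic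
  rcases subsingleton_or_nontrivial N with hN | hN
  · rw [spectrum.of_subsingleton]; exact Set.finite_empty
  have hfin : (spectrum ℂ y).Finite := by
    refine (Polynomial.finite_setOfPred_isRoot hP).subset fun t ht => ?_
    have := spectrum.subset_polynomial_aeval y P ⟨t, ht, rfl⟩
    rw [h0, spectrum.zero_eq] at this
    exact this
  refine (hfin.preimage (f := ((↑) : ℝ → ℂ)) Complex.ofReal_injective.injOn).subset fun t ht => ?_
  exact (spectrum.algebraMap_mem_iff ℂ).2 ht

/-- The subprojection is the spectral projection of `y` at a nonzero eigenvalue `t`: it lies under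
`p` since `y` does, and equality with `p` would force `y = t p`. Without a nonzero eigenvalue `y`
would be `0 • p`. -/
theorem exists_proper_subprojection {p y : N} (hp : IsStarProjection p) (hy : IsSelfAdjoint y)
    (hpy : p * y = y) (hne : ∀ z : ℂ, y ≠ z • p) :
    ∃ r : N, IsStarProjection r ∧ r ≠ 0 ∧ r ≠ p ∧ p * r = r := by
  have hyp : y * p = y := by
    have := congrArg star hpy
    rwa [star_mul, hy.star_eq, hp.2] at this
  have hfin := finite_spectrum_real y
  by_cases h : ∃ t ∈ spectrum ℝ y, t ≠ 0
  · obtain ⟨t, ht, ht0⟩ := h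
    let f : ℝ → ℝ := fun s => if s = t then 1 else 0
    have hf : ContinuousOn f (spectrum ℝ y) := hfin.continuousOn f
    have hyr : y * cfc f y = t • cfc f y := by
      nth_rw 1 [← cfc_id ℝ y]
      rw [← cfc_mul id f y continuousOn_id hf, ← cfc_smul t f y hf]
      refine cfc_congr fun s _ => ?_
      by_cases hs : s = t <;> simp [f, hs]
    have hr0 : cfc f y ≠ 0 := by
      intro h0
      have hN : Nontrivial N := by
        by_contra hN
        rw [not_nontrivial_iff_subsingleton] at hN
        rw [spectrum.of_subsingleton] at ht
        exact ht
      have h1 := cfc_map_spectrum f y hy hf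
      rw [h0, spectrum.zero_eq] at h1
      have h2 : f t ∈ ({0} : Set ℝ) := h1 ▸ ⟨t, ht, rfl⟩
      simp [f] at h2
    refine ⟨cfc f y, ⟨?_, IsSelfAdjoint.cfc⟩, hr0, ?_, ?_⟩
    · show cfc f y * cfc f y = cfc f y
      rw [← cfc_mul f f y hf hf]
      refine cfc_congr fun s _ => ?_
      by_cases hs : s = t <;> simp [f, hs]
    · intro hr
      refine hne (t : ℂ) ?_
      rw [hr, hyp] at hyr
      rw [hyr, Complex.coe_smul]
    · have h1 : p * (y * cfc f y) = y * cfc f y := by rw [← mul_assoc, hpy]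
      rw [hyr, mul_smul_comm] at h1
      exact smul_right_injective N ht0 h1
  · push Not at h
    exfalso
    refine hne 0 ?_
    rw [zero_smul, ← cfc_id ℝ y, ← cfc_zero ℝ y]
    exact cfc_congr fun s hs => h s hs

theorem isMinProj_of_forall_subprojection {p : N} (hp : IsStarProjection p) (h0 : p ≠ 0)
    (h : ∀ r : N, IsStarProjection r → p * r = r → r = 0 ∨ r = p) : IsMinProj p := by
  have key : ∀ x : N, IsSelfAdjoint x → ∃ z : ℂ, p * x * p = z • p := by
    intro x hx
    by_contra! hc
    obtain ⟨r, h1, h2, h3, h4⟩ := exists_proper_subprojection hp (y := p * x * p)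
      (by simpa [hp.2.star_eq] using hx.conjugate p) (by rw [← mul_assoc, ← mul_assoc, hp.1]) hc
    rcases h r h1 h4 with h5 | h5
    · exact h2 h5
    · exact h3 h5
  refine ⟨hp, h0, fun x => ?_⟩
  obtain ⟨z, hz⟩ := key _ (realPart x).2
  obtain ⟨z', hz'⟩ := key _ (imaginaryPart x).2
  refine ⟨z + Complex.I * z', ?_⟩
  rw [← realPart_add_I_smul_imaginaryPart x, mul_add, add_mul, hz, mul_smul_comm,
    smul_mul_assoc, hz', smul_smul, add_smul]

/-- The compression `x ↦ p x p`. -/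
def compress (p : N) : N →ₗ[ℂ] N := LinearMap.mulLeft ℂ p ∘ₗ LinearMap.mulRight ℂ p

theorem compress_apply (p x : N) : compress p x = p * x * p := by
  simp [compress, mul_assoc]

/-- The dimension of `pNp` is the measure that makes the inductions on subprojections terminate. -/
theorem finrank_range_compress_lt {p r : N} (hp : IsStarProjection p) (hr : IsStarProjection r)
    (hpr : p * r = r) (hne : r ≠ p) :
    Module.finrank ℂ (LinearMap.range (compress r)) <
      Module.finrank ℂ (LinearMap.range (compress p)) := by
  have hrp : r * p = r := by
    have := congrArg star hpr
    rwa [star_mul, hr.2.star_eq, hp.2.star_eq] at this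
  refine Submodule.finrank_lt_finrank_of_lt (lt_of_le_of_ne ?_ ?_)
  · rintro _ ⟨x, rfl⟩
    refine ⟨r * x * r, ?_⟩
    rw [compress_apply, compress_apply, mul_assoc, mul_assoc, hrp, ← mul_assoc, ← mul_assoc, hpr,
      mul_assoc]
  · intro h
    have : p ∈ LinearMap.range (compress r) := by
      rw [h]
      exact ⟨p, by rw [compress_apply, hp.1, hp.1]⟩
    obtain ⟨x, hx⟩ := this
    rw [compress_apply] at hx
    apply hne
    rw [← hrp, ← hx, ← mul_assoc, ← mul_assoc, hr.1]

theorem exists_isMinProj_le {p : N} (hp : IsStarProjection p) (h0 : p ≠ 0) :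
    ∃ q : N, IsMinProj q ∧ p * q = q := by
  induction hd : Module.finrank ℂ (LinearMap.range (compress p)) using Nat.strong_induction_on
    generalizing p with
  | _ d ih =>
    by_cases h : ∀ r : N, IsStarProjection r → p * r = r → r = 0 ∨ r = p
    · exact ⟨p, isMinProj_of_forall_subprojection hp h0 h, hp.1⟩
    · push Not at h
      obtain ⟨r, h1, h2, h3, h4⟩ := h
      obtain ⟨q, hq, hrq⟩ := ih _ (hd ▸ finrank_range_compress_lt hp h1 h2 h4) h1 h3 rfl
      exact ⟨q, hq, by rw [← hrq, ← mul_assoc, h2]⟩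

/-- Every projection of a finite-dimensional C*-algebra is a finite orthogonal sum of minimal
projections. -/
theorem exists_sum_isMinProj {p : N} (hp : IsStarProjection p) :
    ∃ (n : ℕ) (q : Fin n → N), (∀ i, IsMinProj (q i)) ∧ (∀ i j, i ≠ j → q i * q j = 0) ∧
      ∑ i, q i = p := by
  induction hd : Module.finrank ℂ (LinearMap.range (compress p)) using Nat.strong_induction_on
    generalizing p with
  | _ d ih =>
    by_cases h0 : p = 0
    · exact ⟨0, Fin.elim0, fun i => i.elim0, fun i => i.elim0, by simp [h0]⟩
    · obtain ⟨q, hq, hpq⟩ := exists_isMinProj_le hp h0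
      have hqp : q * p = q := by
        have := congrArg star hpq
        rwa [star_mul, hq.1.2.star_eq, hp.2.star_eq] at this
      have hpq' : IsStarProjection (p - q) := hq.1.sub_of_mul_eq_right hp hpq
      have h1 : p * (p - q) = p - q := by rw [mul_sub, hp.1, hpq]
      have h2 : p - q ≠ p := by simpa using hq.2.1
      obtain ⟨n, f, hf1, hf2, hf3⟩ := ih _ (hd ▸ finrank_range_compress_lt hp hpq' h1 h2) hpq' rfl
      have hf4 : ∀ i, (p - q) * f i = f i := by
        intro i
        rw [← hf3, Finset.sum_mul, Finset.sum_eq_single i]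
        · exact (hf1 i).1.1
        · intro j _ hj; exact hf2 j i hj
        · simp
      have hqf : ∀ i, q * f i = 0 := by
        intro i
        rw [← hf4, ← mul_assoc, mul_sub, hqp, hq.1.1, sub_self, zero_mul]
      have hfq : ∀ i, f i * q = 0 := by
        intro i
        have := congrArg star (hqf i)
        rwa [star_mul, hq.1.2.star_eq, (hf1 i).1.2.star_eq, star_zero] at this
      refine ⟨n + 1, Fin.cons q f, ?_, ?_, ?_⟩
      · intro i; induction i using Fin.cases with
        | zero => exact hq
        | succ i => exact hf1 i
      · intro i j; induction i using Fin.cases with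
        | zero => induction j using Fin.cases with
          | zero => simp
          | succ j => intro _; exact hqf j
        | succ i => induction j using Fin.cases with
          | zero => intro _; exact hfq i
          | succ j => intro h; exact hf2 i j (by simpa using h)
      · rw [Fin.sum_univ_succ]
        simp [hf3]

end MinimalProjections

/-! ### Equivalence of minimal projections -/

section Positivity

variable {N : Type u} [CStarAlgebra N]

/-- Self-adjointness of `y*y` makes `z` real. If `z ≤ 0`, then `-z q` is a square, so `y*y = z q` is
both nonnegative and nonpositive. -/
theorem eq_zero_or_pos_of_star_mul_self_eq_smul {y q : N} {z : ℂ} (hq : IsStarProjection q)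
    (h : star y * y = z • q) : y = 0 ∨ 0 < z := by
  let _ := CStarAlgebra.spectralOrder N
  let _ := CStarAlgebra.spectralOrderedRing N
  by_cases hy : y = 0
  · exact Or.inl hy
  right
  have hyy : star y * y ≠ 0 := fun h => hy (CStarRing.star_mul_self_eq_zero_iff y |>.1 h)
  have hq0 : q ≠ 0 := by rintro rfl; rw [smul_zero] at h; exact hyy h
  have hre : star z = z := by
    have h1 : star (star y * y) = star y * y := by rw [star_mul, star_star]
    rw [h, star_smul, hq.2.star_eq] at h1
    exact smul_left_injective ℂ hq0 h1
  obtain ⟨r, rfl⟩ : ∃ r : ℝ, (r : ℂ) = z := ⟨z.re, Complex.conj_eq_iff_re.1 hre⟩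
  have hr : 0 < r := by
    by_contra hr
    have h3 : ((-r : ℝ) : ℂ) • q =
        star (((Real.sqrt (-r) : ℝ) : ℂ) • q) * (((Real.sqrt (-r) : ℝ) : ℂ) • q) := by
      rw [star_smul, hq.2.star_eq, smul_mul_smul_comm, hq.1]
      congr 1
      rw [Complex.star_def, Complex.conj_ofReal, ← Complex.ofReal_mul,
        Real.mul_self_sqrt (by linarith)]
    have h4 : 0 ≤ ((-r : ℝ) : ℂ) • q := h3 ▸ star_mul_self_nonneg _
    have h5 : 0 ≤ star y * y := star_mul_self_nonneg y
    rw [h] at h5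
    rw [Complex.ofReal_neg, neg_smul, neg_nonneg] at h4
    exact hyy (h.trans (le_antisymm h4 h5))
  exact_mod_cast hr

variable {m n : Type} [Fintype m] [Fintype n] [DecidableEq m] [DecidableEq n]

theorem Matrix.eq_zero_or_pos_of_conjTranspose_mul_self_eq_smul {y : Matrix m n N}
    {q : Matrix n n N} {z : ℂ} (hq : IsStarProjection q) (h : yᴴ * y = z • q) : y = 0 ∨ 0 < z := by
  have h0 : IsStarProjection (0 : Matrix m m N) := IsStarProjection.zero _
  -- A rectangular matrix becomes an element of a C*-algebra once placed as a corner of a square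
  -- block matrix.
  refine (eq_zero_or_pos_of_star_mul_self_eq_smul (y := Matrix.fromBlocks 0 y 0 (0 : Matrix n n N))
    (isStarProjection_fromBlocks h0 hq) (z := z) ?_).imp ?_ id
  · rw [Matrix.star_eq_conjTranspose, Matrix.fromBlocks_conjTranspose, Matrix.fromBlocks_multiply,
      Matrix.fromBlocks_smul]
    simp [h]
  · intro h
    rw [← Matrix.fromBlocks_zero, Matrix.fromBlocks_inj] at h
    exact h.2.1

/-- Schur's lemma: for `y = PxQ` minimality makes `y*y` and `yy*` multiples of `Q` and `P`.
Computing `y y* y` in two ways shows that the scalars agree, positivity makes them positive, and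
rescaling `y` gives the partial isometry. -/
theorem IsMinProj.mvn {P : Matrix m m N} {Q : Matrix n n N} (hP : IsMinProj P)
    (hQ : IsMinProj Q) {x : Matrix m n N} (hx : P * x * Q ≠ 0) : MvN P Q := by
  obtain ⟨hP1, hP2⟩ := isStarProjection_iff_conj.1 hP.1
  obtain ⟨hQ1, hQ2⟩ := isStarProjection_iff_conj.1 hQ.1
  set y := P * x * Q with hy
  have hPy : P * y = y := by rw [hy, ← Matrix.mul_assoc, ← Matrix.mul_assoc, hP1]
  have hyQ : y * Q = y := by rw [hy, Matrix.mul_assoc, hQ1]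
  have hyP : yᴴ * P = yᴴ := by
    conv_rhs => rw [← hPy, Matrix.conjTranspose_mul, hP2]
  have hQy : Q * yᴴ = yᴴ := by
    conv_rhs => rw [← hyQ, Matrix.conjTranspose_mul, hQ2]
  obtain ⟨z, hz⟩ := hQ.2.2 (yᴴ * y)
  obtain ⟨z', hz'⟩ := hP.2.2 (y * yᴴ)
  rw [← Matrix.mul_assoc, hQy, Matrix.mul_assoc, hyQ] at hz
  rw [← Matrix.mul_assoc, hPy, Matrix.mul_assoc, hyP] at hz'
  have hpos := (Matrix.eq_zero_or_pos_of_conjTranspose_mul_self_eq_smul hQ.1 hz).resolve_left hx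
  have hzz : z = z' := by
    refine smul_left_injective ℂ hx ?_
    calc z • y = y * (z • Q) := by rw [Matrix.mul_smul, hyQ]
      _ = (z' • P) * y := by rw [← hz, ← hz']; exact (Matrix.mul_assoc _ _ _).symm
      _ = z' • y := by rw [Matrix.smul_mul, hPy]
  subst hzz
  obtain ⟨r, hr, rfl⟩ : ∃ r : ℝ, 0 < r ∧ (r : ℂ) = z := by
    obtain ⟨h1, h2⟩ := Complex.pos_iff.1 hpos
    exact ⟨z.re, h1, Complex.ext rfl h2⟩
  have hs : (((Real.sqrt r)⁻¹ : ℝ) : ℂ) * (((Real.sqrt r)⁻¹ : ℝ) : ℂ) * (r : ℂ) = 1 := by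
    rw [← Complex.ofReal_mul, ← Complex.ofReal_mul, ← mul_inv, Real.mul_self_sqrt hr.le,
      inv_mul_cancel₀ hr.ne', Complex.ofReal_one]
  refine ⟨(((Real.sqrt r)⁻¹ : ℝ) : ℂ) • y, ?_, ?_⟩
  · rw [Matrix.conjTranspose_smul, Complex.star_def, Complex.conj_ofReal, Matrix.smul_mul,
      Matrix.mul_smul, hz', smul_smul, smul_smul, hs, one_smul]
  · rw [Matrix.conjTranspose_smul, Complex.star_def, Complex.conj_ofReal, Matrix.smul_mul,
      Matrix.mul_smul, hz, smul_smul, smul_smul, hs, one_smul]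

end Positivity

/-! ### Systems of columns and their matrix units -/

section Systems

variable {A : Type u} [Ring A] [StarRing A]
variable {ι κ l m : Type} [Fintype ι] [DecidableEq ι] [Fintype l] [Fintype m]

/-- A family of columns `w i` with `w i* w j = δᵢⱼ q (c i)` and `∑ w i w i* = e`. The elements
`w i w j*` with `c i = c j` are matrix units with sum of diagonals `e`. -/
structure IsSystem (c : ι → κ) (w : ι → Matrix m l A) (q : κ → Matrix l l A)
    (e : Matrix m m A) : Prop where
  proj : ∀ k, IsStarProjection (q k)
  orth : ∀ i j, (w i)ᴴ * w j = if i = j then q (c i) else 0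
  right : ∀ i, w i * q (c i) = w i
  sum : ∑ i, w i * (w i)ᴴ = e

theorem IsSystem.diag {c : ι → κ} {w : ι → Matrix m l A} {q : κ → Matrix l l A}
    {e : Matrix m m A} (h : IsSystem c w q e) (i : ι) : (w i)ᴴ * w i = q (c i) := by
  rw [h.orth, if_pos rfl]

theorem IsSystem.left {c : ι → κ} {w : ι → Matrix m l A} {q : κ → Matrix l l A}
    {e : Matrix m m A} (h : IsSystem c w q e) (i : ι) : e * w i = w i := by
  rw [← h.sum, Matrix.sum_mul, Finset.sum_eq_single i]
  · rw [Matrix.mul_assoc, h.diag, h.right]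
  · intro j _ hj
    rw [Matrix.mul_assoc, h.orth, if_neg hj, Matrix.mul_zero]
  · simp

theorem IsSystem.left' {c : ι → κ} {w : ι → Matrix m l A} {q : κ → Matrix l l A}
    {e : Matrix m m A} (h : IsSystem c w q e) (i : ι) : q (c i) * (w i)ᴴ = (w i)ᴴ := by
  conv_rhs => rw [← h.right i, Matrix.conjTranspose_mul, (isStarProjection_iff_conj.1 (h.proj _)).2]

theorem IsSystem.cls_eq {c : ι → κ} {w : ι → Matrix m l A} {q : κ → Matrix l l A}
    {e : Matrix m m A} (h : IsSystem c w q e) :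
    IsStarProjection e ∧ cls e = ∑ i, cls (q (c i)) := by
  have hp : ∀ i, IsStarProjection (w i * (w i)ᴴ) := fun i =>
    isStarProjection_of_mul_conjTranspose (h.diag i) (h.right i)
  obtain ⟨h1, h2⟩ := cls_sum Finset.univ hp fun i j hij => by
    rw [Matrix.mul_assoc, ← Matrix.mul_assoc (w i)ᴴ, h.orth, if_neg hij, Matrix.zero_mul,
      Matrix.mul_zero]
  rw [h.sum] at h1 h2
  refine ⟨h1, h2.trans (Finset.sum_congr rfl fun i _ => ?_)⟩
  exact (cls_eq_cls_iff (hp i) (h.proj _)).2 ⟨w i, rfl, h.diag i⟩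

theorem exists_isSystem {c : ι → κ} {q : κ → Matrix l l A} {e : Matrix m m A}
    (hq : ∀ k, IsStarProjection (q k)) (he : IsStarProjection e)
    (h : cls e = ∑ i, cls (q (c i))) : ∃ w : ι → Matrix m l A, IsSystem c w q e := by
  obtain ⟨w, h1, h2, h3⟩ := exists_columns he (fun i => hq (c i)) h
  exact ⟨w, hq, h1, h2, h3⟩

end Systems

/-! ### Structure of finite-dimensional C*-algebras -/

section FiniteDimensional

variable {B : Type u} [CStarAlgebra B] [FiniteDimensional ℂ B]
variable {m : Type} [Fintype m] [DecidableEq m]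

/-- Wedderburn decomposition of the corner of `e`: split `e` into minimal projections, let `κ` be
their equivalence classes, and let `w i` connect the `i`-th summand to the chosen representative of
its class. Inequivalent minimal projections are orthogonal through every `x` by `IsMinProj.mvn`. -/
theorem exists_isSystem_isMinProj {e : Matrix m m B} (he : IsStarProjection e) :
    ∃ (n : ℕ) (κ : Type) (_ : Fintype κ) (_ : DecidableEq κ) (c : Fin n → κ)
      (w : Fin n → Matrix m m B) (q : κ → Matrix m m B), IsSystem c w q e ∧
      Function.Surjective c ∧ (∀ k, IsMinProj (q k)) ∧
      ∀ k k', k ≠ k' → ∀ x, q k * x * q k' = 0 := by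
  classical
  obtain ⟨n, P, hP, hPo, hPs⟩ := exists_sum_isMinProj he
  let S : Setoid (Fin n) :=
    { r := fun i j => MvN (P i) (P j)
      iseqv := ⟨fun i => MvN.refl (hP i).1, fun h => h.symm,
        fun {i j k} h h' => h.trans (hP i).1 (hP k).1 h'⟩ }
  let c : Fin n → Quotient S := Quotient.mk S
  have hc : ∀ i, MvN (P i) (P (c i).out) := fun i => MvN.symm (Quotient.mk_out (s := S) i)
  choose w hw1 hw2 hw3 hw4 using fun i => (hc i).exists_support (hP i).1 (hP _).1
  refine ⟨n, Quotient S, inferInstance, inferInstance, c, w, fun k => P k.out,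
    ⟨fun k => (hP _).1, fun i j => ?_, hw4, ?_⟩, Quotient.mk_surjective, fun k => hP _, ?_⟩
  · split_ifs with hij
    · subst hij; exact hw2 i
    · have : (w i)ᴴ * P i = (w i)ᴴ := by
        conv_rhs => rw [← hw3 i, Matrix.conjTranspose_mul, (isStarProjection_iff_conj.1 (hP i).1).2]
      rw [← this, ← hw3 j, Matrix.mul_assoc, ← Matrix.mul_assoc (P i), hPo i j hij,
        Matrix.zero_mul, Matrix.mul_zero]
  · simp only [hw1, hPs]
  · intro k k' hk x
    by_contra hx
    have := (hP _).mvn (hP _) hx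
    exact hk (by rw [← Quotient.out_eq k, ← Quotient.out_eq k']; exact Quotient.sound this)

end FiniteDimensional

section TraceClass

variable {A : Type u} [CStarAlgebra A] {m : Type} [Fintype m]

/-- The homomorphism `V(A) → ℂ` induced by a trace. -/
def vTrace (τ : traceSpace A) : MvNMonoid A →+ ℂ where
  toFun := Quotient.lift (fun p : MatProj A => trMat τ p.2.1) (by
    rintro p q ⟨v, h1, h2⟩
    rw [← h1, ← h2, trMat_mul_comm])
  map_zero' := by
    change trMat τ (0 : Matrix (Fin 0) (Fin 0) A) = 0
    simp [trMat]
  map_add' := by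
    rintro ⟨p⟩ ⟨q⟩
    exact trMat_dsum τ p q

theorem vTrace_vmk (τ : traceSpace A) (p : MatProj A) : vTrace τ (vmk p) = trMat τ p.2.1 := rfl

theorem MvN.trMat_eq {n : Type} [Fintype n] {p : Matrix m m A} {q : Matrix n n A} (h : MvN p q)
    (τ : traceSpace A) : trMat τ p = trMat τ q := by
  obtain ⟨v, h1, h2⟩ := h
  rw [← h1, ← h2, trMat_mul_comm]

theorem vTrace_cls (τ : traceSpace A) {p : Matrix m m A} (hp : IsStarProjection p) :
    vTrace τ (cls p) = trMat τ p := by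
  obtain ⟨p', hp'⟩ := exists_cls_eq (cls p)
  rw [← hp', cls_mk, vTrace_vmk]
  exact ((cls_eq_cls_iff p'.2.2 hp).1 hp').trMat_eq τ

end TraceClass

section FiniteDimensional

variable {B : Type u} [CStarAlgebra B] [FiniteDimensional ℂ B]

theorem IsMinProj.exists_coeff {N : Type u} [CStarAlgebra N] [FiniteDimensional ℂ N] {q : N}
    (hq : IsMinProj q) :
    ∃ z : N →ₗ[ℂ] ℂ, z q = 1 ∧ ∀ x, q * x * q = z x • q := by
  obtain ⟨g, hg⟩ := Module.Projective.exists_dual_eq_one ℂ hq.2.1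
  refine ⟨g ∘ₗ compress q, ?_, fun x => ?_⟩
  · rw [LinearMap.comp_apply, compress_apply, hq.1.1, hq.1.1, hg]
  · rw [LinearMap.comp_apply, compress_apply]
    obtain ⟨y, hy⟩ := hq.2.2 x
    rw [hy, map_smul, hg, smul_eq_mul, mul_one]

/-- The Murray-von Neumann monoid of a finite-dimensional C*-algebra is `ℕ^κ`, with coordinates
given by positive traces. -/
theorem exists_vMonoid_equiv (B : Type u) [CStarAlgebra B] [FiniteDimensional ℂ B] :
    ∃ (κ : Type) (_ : Fintype κ) (τ : κ → traceSpace B) (E : MvNMonoid B ≃+ (κ → ℕ)),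
      (∀ k x, 0 ≤ (τ k).1 (star x * x)) ∧ (∀ k, 0 < (τ k).1 1) ∧
      ∀ x k, vTrace (τ k) x = E x k := by
  classical
  obtain ⟨n, κ, _, _, c, w, q, hS, hc, hq, hqq⟩ :=
    exists_isSystem_isMinProj (B := B) (m := Fin 1) (IsStarProjection.one _)
  choose z hz1 hz using fun k => (hq k).exists_coeff
  -- `t k` is the usual trace of the `k`-th full matrix block: it sums the diagonal coefficients in
  -- the matrix units `w i (w j)ᴴ` with `c i = c j = k`.
  let t : κ → Matrix (Fin 1) (Fin 1) B →ₗ[ℂ] ℂ := fun k =>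
    ∑ i ∈ Finset.univ.filter (fun i => c i = k),
      z k ∘ₗ (LinearMap.mulLeft ℂ (w i)ᴴ ∘ₗ LinearMap.mulRight ℂ (w i))
  have ht : ∀ k x, t k x = ∑ i ∈ Finset.univ.filter (fun i => c i = k),
      z k ((w i)ᴴ * x * w i) := by
    intro k x
    simp only [t, LinearMap.sum_apply, LinearMap.comp_apply, LinearMap.mulLeft_apply,
      LinearMap.mulRight_apply]
    exact Finset.sum_congr rfl fun i _ => by rw [Matrix.mul_assoc]
  have hmid : ∀ i j x, (w i)ᴴ * x * w j = q (c i) * ((w i)ᴴ * x * w j) * q (c j) := by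
    intro i j x
    rw [← Matrix.mul_assoc, ← Matrix.mul_assoc, hS.left', Matrix.mul_assoc _ (w j), hS.right]
  -- Matrix multiplication in block `k`; terms from other blocks vanish, and symmetry in the two
  -- indices makes `t k` tracial.
  have hcoef : ∀ i x y k, c i = k → z k ((w i)ᴴ * (x * y) * w i) =
      ∑ j ∈ Finset.univ.filter (fun j => c j = k),
        z k ((w i)ᴴ * x * w j) * z k ((w j)ᴴ * y * w i) := by
    rintro i x y k rfl
    have e1 : (w i)ᴴ * (x * y) * w i = ∑ j, ((w i)ᴴ * x * w j) * ((w j)ᴴ * y * w i) := by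
      have : x * y = x * (∑ j, w j * (w j)ᴴ) * y := by rw [hS.sum, Matrix.mul_one]
      rw [this]
      simp only [Matrix.mul_sum, Matrix.sum_mul, Matrix.mul_assoc]
    rw [e1, map_sum, Finset.sum_filter]
    refine Finset.sum_congr rfl fun j _ => ?_
    split_ifs with hj
    · have h1 := hmid i j x
      have h2 := hmid j i y
      rw [hj, hz] at h1
      rw [hj, hz] at h2
      conv_lhs => rw [h1, h2]
      rw [smul_mul_smul_comm, (hq _).1.1, map_smul, hz1, smul_eq_mul, mul_one]
    · rw [hmid i j x, hqq _ _ (Ne.symm hj), Matrix.zero_mul, map_zero]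
  have htr : ∀ k x y, t k (x * y) = t k (y * x) := by
    intro k x y
    rw [ht, ht, Finset.sum_congr rfl fun i hi => hcoef i x y k (Finset.mem_filter.1 hi).2,
      Finset.sum_congr rfl fun i hi => hcoef i y x k (Finset.mem_filter.1 hi).2, Finset.sum_comm]
    exact Finset.sum_congr rfl fun i _ => Finset.sum_congr rfl fun j _ => mul_comm _ _
  have hone : ∀ i, z (c i) ((w i)ᴴ * 1 * w i) = 1 := by
    intro i
    rw [Matrix.mul_one, hS.diag, hz1]
  have htq : ∀ k k', t k (q k') = if k' = k then 1 else 0 := by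
    intro k k'
    obtain ⟨i, rfl⟩ := hc k'
    rw [← hS.diag i, htr, ht]
    have : ∀ j, z k ((w j)ᴴ * (w i * (w i)ᴴ) * w j) = if j = i then z k (q (c i)) else 0 := by
      intro j
      rw [← Matrix.mul_assoc, Matrix.mul_assoc, hS.orth, hS.orth]
      split_ifs with h1 h2 h2
      · subst h1; rw [(hq _).1.1]
      · exact absurd h1.symm h2
      · exact absurd h2.symm h1
      · rw [Matrix.zero_mul, map_zero]
    simp only [this]
    rw [Finset.sum_filter]
    by_cases hk : c i = k
    · subst hk
      rw [Finset.sum_eq_single i (fun j _ hj => by simp [hj]) (by simp)]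
      simp [hz1]
    · rw [if_neg hk]
      refine Finset.sum_eq_zero fun j _ => ?_
      split_ifs with h1 h2
      · subst h2; exact absurd h1 hk
      · rfl
      · rfl
  let ε : B →ₗ[ℂ] Matrix (Fin 1) (Fin 1) B :=
    { toFun := fun b => Matrix.of fun _ _ => b
      map_add' := fun _ _ => rfl
      map_smul' := fun _ _ => rfl }
  have hεa : ∀ x i j, ε x i j = x := fun _ _ _ => rfl
  have hεm : ∀ x y, ε (x * y) = ε x * ε y := by
    intro x y
    ext i j
    simp [hεa, Matrix.mul_apply]
  have hε1 : ε 1 = 1 := by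
    ext i j
    rw [Subsingleton.elim i j]
    rw [hεa, Matrix.one_apply_eq]
  have hεs : ∀ x, ε (star x) = (ε x)ᴴ := fun x => rfl
  let τ : κ → traceSpace B := fun k =>
    ⟨LinearMap.toContinuousLinearMap (t k ∘ₗ ε), fun x y => by
      change t k (ε (x * y)) = t k (ε (y * x))
      rw [hεm, hεm, htr]⟩
  have hτ : ∀ k x, (τ k).1 x = t k (ε x) := fun k x => rfl
  have hεε : ∀ x : Matrix (Fin 1) (Fin 1) B, ε (x 0 0) = x := by
    intro x
    ext i j
    rw [Subsingleton.elim i 0, Subsingleton.elim j 0]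
    rfl
  have hτM : ∀ k (x : Matrix (Fin 1) (Fin 1) B), trMat (τ k) x = t k x := by
    intro k x
    rw [trMat, Fin.sum_univ_one, hτ, hεε]
  have hV : ∀ x : MvNMonoid B, ∃ ν : κ → ℕ, ∑ k, ν k • cls (q k) = x := by
    -- If `P` were inequivalent to every `q k`, inserting `1 = ∑ w i (w i)ᴴ` would give `P Y = 0`
    -- for all columns `Y`; the coordinate columns then give `P = 0`.
    have hmin : ∀ {d : ℕ} {P : Matrix (Fin d) (Fin d) B}, IsMinProj P → ∃ k, cls P = cls (q k) := by
      intro d P hP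
      by_contra! hcon
      have h0 : ∀ (Y : Matrix (Fin d) (Fin 1) B), P * Y = 0 := by
        intro Y
        have e : P * Y = ∑ i, P * (Y * w i) * q (c i) * (w i)ᴴ := by
          have : P * Y = P * Y * ∑ i, w i * (w i)ᴴ := by rw [hS.sum, Matrix.mul_one]
          rw [this, Matrix.mul_sum]
          refine Finset.sum_congr rfl fun i _ => ?_
          rw [Matrix.mul_assoc P (Y * w i), Matrix.mul_assoc Y, hS.right]
          simp only [Matrix.mul_assoc]
        rw [e]
        refine Finset.sum_eq_zero fun i _ => ?_
        by_contra hne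
        refine hcon (c i) ((cls_eq_cls_iff hP.1 (hq _).1).2 (hP.mvn (hq (c i)) (x := Y * w i) ?_))
        intro h; rw [h, Matrix.zero_mul] at hne; exact hne rfl
      apply hP.2.1
      ext i j
      have := congrFun (congrFun (h0 (Matrix.of fun a _ => if a = j then 1 else 0)) i) 0
      simpa [Matrix.mul_apply] using this
    intro x
    obtain ⟨p, rfl⟩ := exists_cls_eq x
    obtain ⟨d, P, hP, hPo, hPs⟩ := exists_sum_isMinProj p.2.2
    choose f hf using fun a => hmin (hP a)
    refine ⟨fun k => (Finset.univ.filter fun a => f a = k).card, ?_⟩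
    rw [← hPs, (cls_sum Finset.univ (fun a => (hP a).1) hPo).2]
    simp only [hf]
    rw [← Finset.sum_fiberwise (s := Finset.univ) (g := f)]
    refine Finset.sum_congr rfl fun k _ => ?_
    rw [Finset.sum_congr rfl (g := fun _ => cls (q k)) fun a ha => by
      rw [(Finset.mem_filter.1 ha).2], Finset.sum_const]
  let F : (κ → ℕ) →+ MvNMonoid B :=
    { toFun := fun ν => ∑ k, ν k • cls (q k)
      map_zero' := by simp
      map_add' := fun ν μ => by simp [add_smul, Finset.sum_add_distrib] }
  have hF : ∀ ν k, vTrace (τ k) (F ν) = ν k := by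
    intro ν k
    change vTrace (τ k) (∑ k, ν k • cls (q k)) = ν k
    rw [map_sum, Finset.sum_eq_single k]
    · rw [map_nsmul, vTrace_cls _ (hq k).1, hτM, htq, if_pos rfl, nsmul_eq_mul, mul_one]
    · intro k' _ hk
      rw [map_nsmul, vTrace_cls _ (hq k').1, hτM, htq, if_neg hk, smul_zero]
    · simp
  have hFb : Function.Bijective F := by
    refine ⟨fun ν μ h => ?_, hV⟩
    funext k
    have := hF ν k
    rw [h, hF] at this
    exact_mod_cast this.symm
  refine ⟨κ, inferInstance, τ, (AddEquiv.ofBijective F hFb).symm, ?_, ?_, ?_⟩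
  · intro k x
    rw [hτ, hεm, hεs, ht]
    refine Finset.sum_nonneg fun i hi => ?_
    obtain rfl := (Finset.mem_filter.1 hi).2
    have e := hz (c i) ((w i)ᴴ * ((ε x)ᴴ * ε x) * w i)
    rw [← hmid] at e
    have e' : (ε x * w i)ᴴ * (ε x * w i) = (w i)ᴴ * ((ε x)ᴴ * ε x) * w i := by
      simp only [Matrix.conjTranspose_mul, Matrix.mul_assoc]
    rcases Matrix.eq_zero_or_pos_of_conjTranspose_mul_self_eq_smul (hq _).1 (e'.trans e) with h | h
    · rw [← e', h, Matrix.mul_zero, map_zero]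
    · exact h.le
  · intro k
    obtain ⟨i, rfl⟩ := hc k
    rw [hτ, hε1, ht]
    refine Finset.sum_pos (fun j hj => ?_) ⟨i, by simp⟩
    rw [← (Finset.mem_filter.1 hj).2, hone]
    exact one_pos
  · intro x k
    obtain ⟨ν, rfl⟩ := hFb.2 x
    rw [hF, show F ν = AddEquiv.ofBijective F hFb ν from rfl, AddEquiv.symm_apply_apply]

end FiniteDimensional

/-! ### Exhaustion of AF-algebras by finite-dimensional stages -/

section MatrixMap

variable {A B : Type u} [CStarAlgebra A] [CStarAlgebra B]
variable {m : Type} [Fintype m] [DecidableEq m]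

/-- The entrywise extension of a `*`-homomorphism to square matrices. -/
def matMap (f : B →⋆ₐ[ℂ] A) : Matrix m m B →⋆ₐ[ℂ] Matrix m m A :=
  { (f : B →ₐ[ℂ] A).mapMatrix with
    map_star' := fun x => (conjTranspose_map_starAlgHom f x).symm }

theorem norm_matMap {f : B →⋆ₐ[ℂ] A} (hf : Function.Injective f) (x : Matrix m m B) :
    ‖matMap f x‖ = ‖x‖ :=
  NonUnitalStarAlgHom.norm_map (matMap f) (Matrix.map_injective hf) x

end MatrixMap

/-- A direct system of finite-dimensional C*-algebras that exhausts `A`. -/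
structure AFSystem (A : Type u) [CStarAlgebra A] where
  B : ℕ → Type u
  [cstar : ∀ n, CStarAlgebra (B n)]
  [fd : ∀ n, FiniteDimensional ℂ (B n)]
  f : ∀ n, B n →⋆ₐ[ℂ] A
  inj : ∀ n, Function.Injective (f n)
  incl : ∀ n m, n ≤ m → ∃ g : B n →⋆ₐ[ℂ] B m, ∀ x, f m (g x) = f n x
  dense : Dense (⋃ n, Set.range (f n))

attribute [instance] AFSystem.cstar AFSystem.fd

theorem IsAF.nonempty_afSystem {A : Type u} [CStarAlgebra A] (h : IsAF A) :
    Nonempty (AFSystem A) := by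
  obtain ⟨B, hB, hfd, hd⟩ := h
  have hcl : ∀ n, IsClosed (B n : Set A) := fun n =>
    Submodule.closed_of_finiteDimensional (B n).toSubalgebra.toSubmodule
  refine ⟨{
    B := fun n => B n
    cstar := fun n => StarSubalgebra.cstarAlgebra (B n) (h_closed := hcl n)
    fd := hfd
    f := fun n => (B n).subtype
    inj := fun n => Subtype.val_injective
    incl := fun n m h => ⟨StarSubalgebra.inclusion (hB h), fun x => rfl⟩
    dense := ?_ }⟩
  convert hd using 2
  funext n
  exact Subtype.range_val

namespace AFSystem

variable {A : Type u} [CStarAlgebra A] (D : AFSystem A)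
variable {m : Type} [Fintype m] [DecidableEq m]

/-- The matrix topology is entrywise, so density passes to matrices, and finitely many entries fit
into one stage. -/
theorem exists_matrix_mem {U : Set (Matrix m m A)} (hU : IsOpen U) (hne : U.Nonempty) (n₀ : ℕ) :
    ∃ n, n₀ ≤ n ∧ ∃ y : Matrix m m (D.B n), matMap (D.f n) y ∈ U := by
  have hd : Dense (Set.pi Set.univ fun _ : m => Set.pi Set.univ fun _ : m =>
      ⋃ n, Set.range (D.f n)) :=
    dense_pi _ fun _ _ => dense_pi _ fun _ _ => D.dense
  obtain ⟨x, hxU, hx⟩ := hd.inter_open_nonempty U hU hne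
  have h1 : ∀ i j, ∃ n, ∃ y : D.B n, D.f n y = x i j := fun i j =>
    Set.mem_iUnion.1 (hx i trivial j trivial)
  choose ν hν using h1
  obtain ⟨n, hn⟩ : ∃ n, n₀ ≤ n ∧ ∀ i j, ν i j ≤ n := by
    refine ⟨n₀ + ∑ i, ∑ j, ν i j, by omega, fun i j => ?_⟩
    have h1 := Finset.single_le_sum (f := fun i => ∑ j, ν i j) (fun _ _ => Nat.zero_le _)
      (Finset.mem_univ i)
    have h2 := Finset.single_le_sum (f := fun j => ν i j) (fun _ _ => Nat.zero_le _)
      (Finset.mem_univ j)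
    omega
  have h2 : ∀ i j, ∃ y : D.B n, D.f n y = x i j := by
    intro i j
    obtain ⟨y, hy⟩ := hν i j
    obtain ⟨g, hg⟩ := D.incl _ _ (hn.2 i j)
    exact ⟨g y, by rw [hg, hy]⟩
  choose y hy using h2
  refine ⟨n, hn.1, Matrix.of y, ?_⟩
  have : matMap (D.f n) (Matrix.of y) = x := Matrix.ext hy
  rwa [this]

/-- A self-adjoint `x` from a stage within `1/20` of `p` is nearly idempotent, hence within `1/2` of
a projection of that stage, which is then at distance less than `1` from `p`. Estimates move between
`A` and the stage because the embedding is isometric. -/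
theorem exists_isStarProjection_mvn {p : Matrix m m A} (hp : IsStarProjection p) (n₀ : ℕ) :
    ∃ n, n₀ ≤ n ∧ ∃ q : Matrix m m (D.B n), IsStarProjection q ∧ MvN (q.map (D.f n)) p := by
  obtain ⟨n, hn, y, hy⟩ := D.exists_matrix_mem (U := Metric.ball p (1 / 20)) Metric.isOpen_ball
    ⟨p, Metric.mem_ball_self (by norm_num)⟩ n₀
  rw [Metric.mem_ball, dist_eq_norm] at hy
  let x : Matrix m m (D.B n) := (2⁻¹ : ℂ) • (y + star y)
  have hxs : IsSelfAdjoint x := by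
    rw [IsSelfAdjoint, star_smul, star_add, star_star, add_comm (star y)]
    simp [x]
  have hxp : ‖matMap (D.f n) x - p‖ < 1 / 20 := by
    have e : matMap (D.f n) x - p =
        (2⁻¹ : ℂ) • ((matMap (D.f n) y - p) + star (matMap (D.f n) y - p)) := by
      rw [map_smul, map_add, map_star, star_sub, hp.2.star_eq]
      have : p = (2⁻¹ : ℂ) • (p + p) := by rw [← two_smul ℂ p, smul_smul]; norm_num
      conv_lhs => rw [this]
      rw [← smul_sub]
      congr 1
      abel
    rw [e, norm_smul]
    have h1 := norm_add_le (matMap (D.f n) y - p) (star (matMap (D.f n) y - p))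
    rw [norm_star] at h1
    have h2 : ‖(2⁻¹ : ℂ)‖ = 2⁻¹ := by norm_num
    rw [h2]
    linarith
  set X := matMap (D.f n) x with hX
  have hxx : ‖x * x - x‖ < 3 / 16 := by
    rw [← norm_matMap (D.inj n), map_sub, map_mul, ← hX]
    have e : X * X - X = (X - p) * X + p * (X - p) - (X - p) := by
      have : p * p = p := hp.1
      rw [sub_mul, mul_sub, this]
      abel
    have hpn : ‖p‖ ≤ 1 := hp.norm_le
    have hXn : ‖X‖ ≤ 1 + 1 / 20 := by
      calc ‖X‖ = ‖p + (X - p)‖ := by rw [add_sub_cancel]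
        _ ≤ ‖p‖ + ‖X - p‖ := norm_add_le _ _
        _ ≤ 1 + 1 / 20 := by linarith
    rw [e]
    calc ‖(X - p) * X + p * (X - p) - (X - p)‖
        ≤ ‖(X - p) * X‖ + ‖p * (X - p)‖ + ‖X - p‖ :=
          (norm_sub_le _ _).trans (by gcongr; exact norm_add_le _ _)
      _ ≤ ‖X - p‖ * ‖X‖ + ‖p‖ * ‖X - p‖ + ‖X - p‖ := by
          gcongr <;> exact norm_mul_le _ _
      _ ≤ (1 / 20) * (1 + 1 / 20) + 1 * (1 / 20) + 1 / 20 := by gcongr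
      _ < 3 / 16 := by norm_num
  obtain ⟨q, hq, hqx⟩ := exists_isStarProjection_norm_sub_lt hxs hxx
  refine ⟨n, hn, q, hq, ?_⟩
  refine exists_partialIsometry_of_norm_sub_lt (IsStarProjection.matrix_map (D.f n) hq) hp ?_
  rw [← norm_matMap (D.inj n), map_sub] at hqx
  calc ‖matMap (D.f n) q - p‖ = ‖(matMap (D.f n) q - X) + (X - p)‖ := by rw [sub_add_sub_cancel]
    _ ≤ ‖matMap (D.f n) q - X‖ + ‖X - p‖ := norm_add_le _ _
    _ < 1 := by linarith

/-- The norm conditions of `exists_partialIsometry_of_norm_lt` on `P y Q` are open and hold at the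
given partial isometry with both norms zero, so they hold for some `y` of a later stage. -/
theorem exists_mvn_descent {n : ℕ} {P Q : Matrix m m (D.B n)} (hP : IsStarProjection P)
    (hQ : IsStarProjection Q) (h : MvN (P.map (D.f n)) (Q.map (D.f n))) :
    ∃ n', n ≤ n' ∧ ∃ g : D.B n →⋆ₐ[ℂ] D.B n', (∀ x, D.f n' (g x) = D.f n x) ∧
      MvN (P.map g) (Q.map g) := by
  have hP' := IsStarProjection.matrix_map (D.f n) hP
  have hQ' := IsStarProjection.matrix_map (D.f n) hQ
  obtain ⟨v, hv1, hv2, hv3, hv4⟩ := h.exists_support hP' hQ'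
  set P' := P.map (D.f n)
  set Q' := Q.map (D.f n)
  let z : Matrix m m A → Matrix m m A := fun y => P' * y * Q'
  have hz : Continuous z := by fun_prop
  let U : Set (Matrix m m A) := {y | ‖P' - z y * star (z y)‖ < 1 ∧ ‖Q' - star (z y) * z y‖ < 1}
  have hU : IsOpen U := by
    refine IsOpen.inter ?_ ?_
    · exact isOpen_lt (f := fun y => ‖P' - z y * star (z y)‖) (by fun_prop) continuous_const
    · exact isOpen_lt (f := fun y => ‖Q' - star (z y) * z y‖) (by fun_prop) continuous_const
  have hzv : z v = v := by simp only [z, hv3, hv4]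
  obtain ⟨n', hn, y, hy1, hy2⟩ := D.exists_matrix_mem hU ⟨v, by
    change _ ∧ _
    rw [hzv, Matrix.star_eq_conjTranspose, hv1, hv2]
    simp⟩ n
  obtain ⟨g, hg⟩ := D.incl n n' hn
  refine ⟨n', hn, g, hg, ?_⟩
  have hPg : matMap (D.f n') (P.map g) = P' := by
    ext i j; exact hg _
  have hQg : matMap (D.f n') (Q.map g) = Q' := by
    ext i j; exact hg _
  have hzg : matMap (D.f n') (P.map g * y * Q.map g) = z (matMap (D.f n') y) := by
    rw [map_mul, map_mul, hPg, hQg]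
  have h1 := IsStarProjection.matrix_map g hP
  have h2 := IsStarProjection.matrix_map g hQ
  refine exists_partialIsometry_of_norm_lt (y := P.map g * y * Q.map g) h1 h2 ?_ ?_ ?_ ?_
  · rw [← mul_assoc, ← mul_assoc, h1.1]
  · rw [mul_assoc, h2.1]
  · rw [← norm_matMap (D.inj n'), map_sub, map_mul, map_star, hzg, hPg]
    exact hy1
  · rw [← norm_matMap (D.inj n'), map_sub, map_mul, map_star, hzg, hQg]
    exact hy2

theorem exists_vMap_eq (x : MvNMonoid A) (n₀ : ℕ) :
    ∃ n, n₀ ≤ n ∧ ∃ y : MvNMonoid (D.B n), vMap (D.f n) y = x := by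
  obtain ⟨p, rfl⟩ := exists_cls_eq x
  obtain ⟨n, hn, q, hq, hqp⟩ := D.exists_isStarProjection_mvn p.2.2 n₀
  exact ⟨n, hn, cls q, by
    rw [vMap_cls _ hq, cls_eq_cls_iff (IsStarProjection.matrix_map _ hq) p.2.2]; exact hqp⟩

theorem exists_vMap_descent {n : ℕ} {x y : MvNMonoid (D.B n)}
    (h : vMap (D.f n) x = vMap (D.f n) y) :
    ∃ n', n ≤ n' ∧ ∃ g : D.B n →⋆ₐ[ℂ] D.B n', (∀ x, D.f n' (g x) = D.f n x) ∧
      vMap g x = vMap g y := by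
  obtain ⟨p, rfl⟩ := exists_cls_eq x
  obtain ⟨q, rfl⟩ := exists_cls_eq y
  have h0 : ∀ {k : ℕ}, IsStarProjection (0 : Matrix (Fin k) (Fin k) (D.B n)) :=
    IsStarProjection.zero _
  -- Padding with zeros brings both projections to the same size.
  have hP := isStarProjection_fromBlocks p.2.2 (h0 (k := q.1))
  have hQ := isStarProjection_fromBlocks (h0 (k := p.1)) q.2.2
  have e1 := cls_fromBlocks p.2.2 (h0 (k := q.1))
  have e2 := cls_fromBlocks (h0 (k := p.1)) q.2.2
  rw [cls_zero, add_zero] at e1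
  rw [cls_zero, zero_add] at e2
  rw [← e1, ← e2, vMap_cls _ hP, vMap_cls _ hQ, cls_eq_cls_iff (IsStarProjection.matrix_map _ hP)
    (IsStarProjection.matrix_map _ hQ)] at h
  obtain ⟨n', hn, g, hg, hm⟩ := D.exists_mvn_descent hP hQ h
  refine ⟨n', hn, g, hg, ?_⟩
  rw [← e1, ← e2, vMap_cls _ hP, vMap_cls _ hQ, cls_eq_cls_iff (IsStarProjection.matrix_map _ hP)
    (IsStarProjection.matrix_map _ hQ)]
  exact hm

theorem vMap_incl {n n' : ℕ} {g : D.B n →⋆ₐ[ℂ] D.B n'} (hg : ∀ x, D.f n' (g x) = D.f n x)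
    (x : MvNMonoid (D.B n)) : vMap (D.f n') (vMap g x) = vMap (D.f n) x := by
  rw [← vMap_comp]
  exact congrArg (fun φ => vMap φ x) (StarAlgHom.ext (f := (D.f n').comp g) (g := D.f n) hg)

/-- Finitely many classes come from one finite-dimensional stage. -/
theorem exists_vMap_eq_family {ι : Type*} (s : Finset ι) (x : ι → MvNMonoid A) (n₀ : ℕ) :
    ∃ n, n₀ ≤ n ∧ ∀ i ∈ s, ∃ y : MvNMonoid (D.B n), vMap (D.f n) y = x i := by
  classical
  induction s using Finset.induction_on with
  | empty => exact ⟨n₀, le_rfl, by simp⟩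
  | insert a s ha ih =>
    obtain ⟨n, hn, h⟩ := ih
    obtain ⟨n', hn', y, hy⟩ := D.exists_vMap_eq (x a) n
    refine ⟨n', hn.trans hn', fun i hi => ?_⟩
    rcases Finset.mem_insert.1 hi with rfl | hi
    · exact ⟨y, hy⟩
    · obtain ⟨g, hg⟩ := D.incl n n' hn'
      obtain ⟨y, hy⟩ := h i hi
      exact ⟨vMap g y, by rw [D.vMap_incl hg, hy]⟩

end AFSystem

/-! ### Boundedness of positive functionals -/

section PositiveFunctional

variable {N : Type u} [CStarAlgebra N]

/-- For self-adjoint `x`, apply `σ` to `-‖x‖ ≤ x ≤ ‖x‖`. Splitting into real and imaginary parts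
costs the factor `2`, which is harmless since only a uniform bound is used. -/
theorem norm_le_of_positive {σ : N →ₗ[ℂ] ℂ} (hσ : ∀ x, 0 ≤ σ (star x * x)) (h1 : σ 1 = 1) (b : N) :
    ‖σ b‖ ≤ 2 * ‖b‖ := by
  let _ := CStarAlgebra.spectralOrder N
  let _ := CStarAlgebra.spectralOrderedRing N
  have hpos : ∀ x : N, 0 ≤ x → 0 ≤ σ x := by
    intro x hx
    obtain ⟨y, rfl⟩ := CStarAlgebra.nonneg_iff_eq_star_mul_self.1 hx
    exact hσ y
  have hsa : ∀ x : N, IsSelfAdjoint x → ‖σ x‖ ≤ ‖x‖ := by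
    intro x hx
    have e : σ (algebraMap ℝ N ‖x‖) = (‖x‖ : ℂ) := by
      rw [Algebra.algebraMap_eq_smul_one, ← Complex.coe_smul, map_smul, h1, smul_eq_mul, mul_one]
    have h2 := hpos _ (sub_nonneg.2 hx.le_algebraMap_norm_self)
    have h3 := hpos _ (sub_nonneg.2 hx.neg_algebraMap_norm_le_self)
    rw [map_sub, e, Complex.nonneg_iff] at h2
    rw [sub_neg_eq_add, map_add, e, Complex.nonneg_iff] at h3
    obtain ⟨h2, h2'⟩ := h2
    obtain ⟨h3, -⟩ := h3
    simp only [Complex.sub_re, Complex.ofReal_re, Complex.sub_im, Complex.ofReal_im,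
      Complex.add_re] at h2 h2' h3
    have h4 : σ x = ((σ x).re : ℂ) := Complex.ext rfl (by simp; linarith)
    rw [h4, Complex.norm_real, Real.norm_eq_abs, abs_le]
    constructor <;> linarith
  rw [← realPart_add_I_smul_imaginaryPart b, map_add, map_smul]
  calc ‖σ (realPart b) + Complex.I • σ (imaginaryPart b)‖
      ≤ ‖σ (realPart b)‖ + ‖Complex.I • σ (imaginaryPart b)‖ := norm_add_le _ _
    _ = ‖σ (realPart b)‖ + ‖σ (imaginaryPart b)‖ := by rw [norm_smul, Complex.norm_I, one_mul]
    _ ≤ ‖(realPart b : N)‖ + ‖(imaginaryPart b : N)‖ :=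
        add_le_add (hsa _ (realPart b).2) (hsa _ (imaginaryPart b).2)
    _ ≤ ‖b‖ + ‖b‖ := add_le_add (realPart.norm_le b) (imaginaryPart.norm_le b)
    _ = 2 * ‖realPart b + Complex.I • (imaginaryPart b : N)‖ := by
        rw [realPart_add_I_smul_imaginaryPart, two_mul]

end PositiveFunctional

/-! ### Cancellation and unperforation -/

namespace AFSystem

variable {A : Type u} [CStarAlgebra A]

/-- The equation already holds at some finite-dimensional stage, whose monoid `ℕ^κ` is cancellative.
-/
theorem v_add_right_cancel (D : AFSystem A) {x y z : MvNMonoid A} (h : x + z = y + z) : x = y := by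
  obtain ⟨n, -, hn⟩ := D.exists_vMap_eq_family Finset.univ ![x, y, z] 0
  obtain ⟨x', hx⟩ := hn 0 (Finset.mem_univ _)
  obtain ⟨y', hy⟩ := hn 1 (Finset.mem_univ _)
  obtain ⟨z', hz⟩ := hn 2 (Finset.mem_univ _)
  simp only [Matrix.cons_val] at hx hy hz
  rw [← hx, ← hy, ← hz, ← map_add, ← map_add] at h
  obtain ⟨n', -, g, hg, he⟩ := D.exists_vMap_descent h
  obtain ⟨κ, _, τ, E, -⟩ := exists_vMonoid_equiv (D.B n')
  rw [map_add, map_add] at he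
  have h2 := congrArg E he
  rw [map_add, map_add] at h2
  have h3 : vMap g x' = vMap g y' := E.injective (add_right_cancel h2)
  rw [← hx, ← hy, ← D.vMap_incl hg, ← D.vMap_incl hg, h3]

theorem v_unperforated (D : AFSystem A) {x y r : MvNMonoid A} {d : ℕ} (hd : d ≠ 0) (h : d • x = d • y + r) :
    ∃ r', x = y + r' := by
  obtain ⟨n, -, hn⟩ := D.exists_vMap_eq_family Finset.univ ![x, y, r] 0
  obtain ⟨x', hx⟩ := hn 0 (Finset.mem_univ _)
  obtain ⟨y', hy⟩ := hn 1 (Finset.mem_univ _)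
  obtain ⟨z', hz⟩ := hn 2 (Finset.mem_univ _)
  simp only [Matrix.cons_val] at hx hy hz
  rw [← hx, ← hy, ← hz, ← map_nsmul, ← map_nsmul, ← map_add] at h
  obtain ⟨n', -, g, hg, he⟩ := D.exists_vMap_descent h
  obtain ⟨κ, _, τ, E, -⟩ := exists_vMonoid_equiv (D.B n')
  have h2 := congrArg E he
  simp only [map_nsmul, map_add] at h2
  have h3 : E (vMap g y') ≤ E (vMap g x') := by
    intro k
    have := congrFun h2 k
    simp only [Pi.smul_apply, Pi.add_apply, smul_eq_mul] at this
    exact Nat.le_of_mul_le_mul_left (by omega) (Nat.pos_of_ne_zero hd)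
  refine ⟨vMap (D.f n') (E.symm (E (vMap g x') - E (vMap g y'))), ?_⟩
  rw [← hx, ← hy, ← D.vMap_incl hg x', ← D.vMap_incl hg y', ← map_add]
  congr 1
  apply E.injective
  rw [map_add, AddEquiv.apply_symm_apply, add_tsub_cancel_of_le h3]

end AFSystem

/-! ### Comparison of classes by tracial states -/

namespace AFSystem

variable {A : Type u} [CStarAlgebra A] (D : AFSystem A)

/-- A normalized positive functional on a stage extends to a bounded functional on `A`. -/
theorem exists_extension {n : ℕ} {σ : D.B n →ₗ[ℂ] ℂ} (hσ : ∀ x, 0 ≤ σ (star x * x))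
    (h1 : σ 1 = 1) : ∃ ψ : StrongDual ℂ A, ‖ψ‖ ≤ 2 ∧ ∀ b, ψ (D.f n b) = σ b := by
  let F : D.B n →ₗ[ℂ] A := ((D.f n : D.B n →ₐ[ℂ] A)).toLinearMap
  let e : D.B n ≃ₗ[ℂ] LinearMap.range F := LinearEquiv.ofInjective F (D.inj n)
  have hF : ∀ b, ‖F b‖ = ‖b‖ := NonUnitalStarAlgHom.norm_map (D.f n) (D.inj n)
  have hbound : ∀ y, ‖(σ ∘ₗ e.symm.toLinearMap) y‖ ≤ 2 * ‖y‖ := by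
    intro y
    obtain ⟨b, rfl⟩ := e.surjective y
    have : ‖e b‖ = ‖b‖ := hF b
    rw [this, LinearMap.comp_apply, LinearEquiv.coe_coe, e.symm_apply_apply]
    exact norm_le_of_positive hσ h1 b
  obtain ⟨ψ, hψ, hn⟩ := exists_extension_norm_eq _ (LinearMap.mkContinuous _ 2 hbound)
  refine ⟨ψ, ?_, fun b => ?_⟩
  · rw [hn]
    exact LinearMap.mkContinuous_norm_le _ (by norm_num) _
  · have := hψ (e b)
    rw [LinearMap.mkContinuous_apply, LinearMap.comp_apply, LinearEquiv.coe_coe,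
      e.symm_apply_apply] at this
    exact this

theorem dense_range_pairs : Dense {z : A × A | ∃ n, ∃ x y, z = (D.f n x, D.f n y)} := by
  refine (D.dense.prod D.dense).mono ?_
  rintro ⟨a, b⟩ ⟨ha, hb⟩
  obtain ⟨n, x, hx⟩ := Set.mem_iUnion.1 ha
  obtain ⟨n', y, hy⟩ := Set.mem_iUnion.1 hb
  obtain ⟨g, hg⟩ := D.incl n (max n n') (le_max_left _ _)
  obtain ⟨g', hg'⟩ := D.incl n' (max n n') (le_max_right _ _)
  exact ⟨max n n', g x, g' y, by rw [hg, hg', hx, hy]⟩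

/-- Failure of `y ≤ x` persists at every later stage, where it shows in one coordinate of `ℕ^κ`,
that is, in a positive trace of the stage. Normalized, extended to `A` by Hahn-Banach and passed to
a weak-* limit, these traces yield the tracial state. -/
theorem exists_tracialState_le (D : AFSystem A) {x y : MvNMonoid A} (h : ¬ ∃ r, x = y + r) :
    ∃ τ ∈ tracialStates A, (vTrace τ x).re ≤ (vTrace τ y).re := by
  obtain ⟨n, -, hn⟩ := D.exists_vMap_eq_family Finset.univ ![x, y] 0
  obtain ⟨x', hx⟩ := hn 0 (Finset.mem_univ _)
  obtain ⟨y', hy⟩ := hn 1 (Finset.mem_univ _)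
  simp only [Matrix.cons_val] at hx hy
  obtain ⟨p, rfl⟩ := exists_cls_eq x'
  obtain ⟨q, rfl⟩ := exists_cls_eq y'
  have hstage : ∀ j, ∃ ψ : StrongDual ℂ A, ‖ψ‖ ≤ 2 ∧ ψ 1 = 1 ∧
      (∀ a b : D.B (n + j), ψ (D.f _ (a * b)) = ψ (D.f _ (b * a))) ∧
      (∀ a : D.B (n + j), 0 ≤ ψ (D.f _ (star a * a))) ∧
      (∑ i, ψ (D.f n (p.2.1 i i))).re ≤ (∑ i, ψ (D.f n (q.2.1 i i))).re := by
    intro j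
    obtain ⟨g, hg⟩ := D.incl n (n + j) (Nat.le_add_right _ _)
    obtain ⟨κ, _, τ, E, hτ, hτ1, hE⟩ := exists_vMonoid_equiv (D.B (n + j))
    obtain ⟨k, hk⟩ : ∃ k, E (vMap g (cls p.2.1)) k < E (vMap g (cls q.2.1)) k := by
      by_contra! hcon
      apply h
      have h3 : E (vMap g (cls q.2.1)) ≤ E (vMap g (cls p.2.1)) := hcon
      refine ⟨vMap (D.f _) (E.symm (E (vMap g (cls p.2.1)) - E (vMap g (cls q.2.1)))), ?_⟩
      rw [← hx, ← hy, ← D.vMap_incl hg, ← D.vMap_incl hg (cls q.2.1), ← map_add]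
      congr 1
      apply E.injective
      rw [map_add, AddEquiv.apply_symm_apply, add_tsub_cancel_of_le h3]
    obtain ⟨c, hc, hc1⟩ : ∃ c : ℝ, 0 < c ∧ (τ k).1 1 = c := by
      obtain ⟨h1, h2⟩ := Complex.pos_iff.1 (hτ1 k)
      exact ⟨_, h1, Complex.ext rfl h2.symm⟩
    have hc' : 0 < c⁻¹ := inv_pos.2 hc
    let σ : D.B (n + j) →ₗ[ℂ] ℂ := ((c⁻¹ : ℝ) : ℂ) • ((τ k).1 : D.B (n + j) →ₗ[ℂ] ℂ)
    have hσ : ∀ a, σ a = ((c⁻¹ : ℝ) : ℂ) * (τ k).1 a := fun a => rfl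
    have hσp : ∀ a, 0 ≤ σ (star a * a) := by
      intro a
      rw [hσ]
      exact mul_nonneg (by exact_mod_cast hc'.le) (hτ k a)
    have hσ1 : σ 1 = 1 := by
      rw [hσ, hc1, ← Complex.ofReal_mul, inv_mul_cancel₀ hc.ne', Complex.ofReal_one]
    obtain ⟨ψ, hψn, hψ⟩ := D.exists_extension hσp hσ1
    refine ⟨ψ, hψn, ?_, fun a b => ?_, fun a => ?_, ?_⟩
    · rw [← map_one (D.f (n + j)), hψ, hσ1]
    · rw [hψ, hψ, hσ, hσ, (τ k).2]
    · rw [hψ]; exact hσp a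
    · have hcalc : ∀ p : MatProj (D.B n), ∑ i, ψ (D.f n (p.2.1 i i)) =
          ((c⁻¹ : ℝ) : ℂ) * (E (vMap g (cls p.2.1)) k : ℂ) := by
        intro p
        rw [← hE, vMap_cls _ p.2.2, vTrace_cls _ (IsStarProjection.matrix_map _ p.2.2), trMat,
          Finset.mul_sum]
        refine Finset.sum_congr rfl fun i _ => ?_
        rw [← hg, hψ, hσ]
        rfl
      rw [hcalc, hcalc, ← Complex.ofReal_natCast, ← Complex.ofReal_natCast, ← Complex.ofReal_mul,
        ← Complex.ofReal_mul, Complex.ofReal_re, Complex.ofReal_re]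
      have : (E (vMap g (cls p.2.1)) k : ℝ) ≤ E (vMap g (cls q.2.1)) k := by exact_mod_cast hk.le
      gcongr
  choose ψ hψn hψ1 hψt hψp hψl using hstage
  -- The extension `ψ j` is known to be tracial and positive only on stage `n + j`. The limit
  -- inherits both properties on every stage, hence on `A` by density.
  obtain ⟨ω, -, hω⟩ := (WeakDual.isCompact_closedBall (𝕜 := ℂ) (E := A) 0 2).ultrafilter_le_nhds
    ((Filter.hyperfilter ℕ).map fun j => StrongDual.toWeakDual (ψ j)) (by
      refine Filter.le_principal_iff.2 (Filter.mem_map.2 (Filter.univ_mem' fun j => ?_))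
      simpa using hψn j)
  have hlim : ∀ a : A, Filter.Tendsto (fun j => ψ j a) (Filter.hyperfilter ℕ) (nhds (ω a)) :=
    fun a => ((WeakDual.eval_continuous a).tendsto ω).comp hω
  have hev : ∀ j₀, ∀ᶠ j in (Filter.hyperfilter ℕ : Filter ℕ), j₀ ≤ j := fun j₀ =>
    Nat.hyperfilter_le_atTop (Filter.eventually_ge_atTop j₀)
  let ω' : StrongDual ℂ A := WeakDual.toStrongDual ω
  have hω' : ∀ a, ω' a = ω a := fun _ => rfl
  have htr : ∀ a b, ω' (a * b) = ω' (b * a) := by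
    have hcl : IsClosed {z : A × A | ω' (z.1 * z.2) = ω' (z.2 * z.1)} :=
      isClosed_eq (by fun_prop) (by fun_prop)
    have : {z : A × A | ω' (z.1 * z.2) = ω' (z.2 * z.1)} = Set.univ := by
      refine hcl.closure_eq ▸ (D.dense_range_pairs.mono ?_).closure_eq
      rintro _ ⟨d, a, b, rfl⟩
      refine tendsto_nhds_unique (hlim _) ((hlim _).congr' ?_)
      filter_upwards [hev d] with j hj
      obtain ⟨g, hg⟩ := D.incl d (n + j) (by omega)
      rw [← map_mul, ← map_mul, ← hg, ← hg, map_mul g, map_mul g, hψt]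
    intro a b
    have h1 : (a, b) ∈ {z : A × A | ω' (z.1 * z.2) = ω' (z.2 * z.1)} := this ▸ trivial
    exact h1
  have hpos : ∀ a, 0 ≤ ω' (star a * a) := by
    have hcl : IsClosed {a : A | 0 ≤ ω' (star a * a)} :=
      isClosed_le continuous_const (by fun_prop)
    have : {a : A | 0 ≤ ω' (star a * a)} = Set.univ := by
      refine hcl.closure_eq ▸ (D.dense.mono ?_).closure_eq
      intro a ha
      obtain ⟨d, a, rfl⟩ := Set.mem_iUnion.1 ha
      refine ge_of_tendsto (hlim _) ?_
      filter_upwards [hev d] with j hj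
      obtain ⟨g, hg⟩ := D.incl d (n + j) (by omega)
      rw [← hg, ← map_star, ← map_mul]
      exact hψp j _
    intro a
    have h1 : a ∈ {a : A | 0 ≤ ω' (star a * a)} := this ▸ trivial
    exact h1
  refine ⟨⟨ω', htr⟩, ⟨hpos, ?_⟩, ?_⟩
  · refine tendsto_nhds_unique (hlim 1) ?_
    simp only [hψ1]
    exact tendsto_const_nhds
  · rw [← hx, ← hy, vMap_cls _ p.2.2, vMap_cls _ q.2.2,
      vTrace_cls _ (IsStarProjection.matrix_map _ p.2.2),
      vTrace_cls _ (IsStarProjection.matrix_map _ q.2.2)]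
    have hsum : ∀ p : MatProj (D.B n), Filter.Tendsto
        (fun j => (∑ i, ψ j (D.f n (p.2.1 i i))).re) (Filter.hyperfilter ℕ)
        (nhds (∑ i, ω (D.f n (p.2.1 i i))).re) := fun p =>
      (Complex.continuous_re.tendsto _).comp (tendsto_finsetSum _ fun i _ => hlim _)
    exact le_of_tendsto_of_tendsto' (hsum p) (hsum q) fun j => hψl j

end AFSystem

/-! ### Reduction to extreme traces -/

section ExtremeTraces

variable {A : Type u} [CStarAlgebra A]

instance : ContinuousSMul ℝ (traceSpace A) where
  continuous_smul := by
    have : Continuous (fun p : ℝ × traceSpace A => ((p.1 : ℂ), p.2)) := by fun_prop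
    exact (continuous_smul (M := ℂ) (X := traceSpace A)).comp this

instance : LocallyConvexSpace ℝ (traceSpace A) :=
  NormedSpace.toLocallyConvexSpace (E := traceSpace A)

theorem convex_tracialStates : Convex ℝ (tracialStates A) := by
  rintro τ ⟨h1, h2⟩ σ ⟨h3, h4⟩ s t hs ht hst
  have e : ∀ x, (s • τ + t • σ).1 x = (s : ℂ) * τ.1 x + (t : ℂ) * σ.1 x := fun x => rfl
  refine ⟨fun x => ?_, ?_⟩
  · rw [e]
    exact add_nonneg (mul_nonneg (by exact_mod_cast hs) (h1 x))
      (mul_nonneg (by exact_mod_cast ht) (h3 x))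
  · rw [e, h2, h4, mul_one, mul_one]
    exact_mod_cast hst

theorem isCompact_tracialStates [FiniteDimensional ℂ (traceSpace A)] :
    IsCompact (tracialStates A) := by
  have : ProperSpace (traceSpace A) := FiniteDimensional.proper ℂ (traceSpace A)
  refine Metric.isCompact_of_isClosed_isBounded ?_ ?_
  · refine IsClosed.inter ?_ ?_
    · have : {τ : traceSpace A | ∀ x : A, 0 ≤ τ.1 (star x * x)} =
          ⋂ x : A, {τ : traceSpace A | 0 ≤ τ.1 (star x * x)} := by
        ext τ
        simp
      change IsClosed {τ : traceSpace A | ∀ x : A, 0 ≤ τ.1 (star x * x)}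
      rw [this]
      refine isClosed_iInter fun x => isClosed_le continuous_const ?_
      exact (ContinuousLinearMap.apply ℂ ℂ (star x * x)).continuous.comp continuous_subtype_val
    · refine isClosed_eq ?_ continuous_const
      exact (ContinuousLinearMap.apply ℂ ℂ (1 : A)).continuous.comp continuous_subtype_val
  · refine (Metric.isBounded_closedBall (x := 0) (r := 2)).subset ?_
    rintro τ ⟨h1, h2⟩
    change dist τ.1 0 ≤ 2
    rw [dist_zero_right]
    exact ContinuousLinearMap.opNorm_le_bound τ.1 (by norm_num)
      (norm_le_of_positive (σ := (τ.1 : A →ₗ[ℂ] ℂ)) h1 h2)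

/-- Krein-Milman; the closure can be dropped because the hull of finitely many points is closed. -/
theorem EnumeratesExtremeTraces.subset_convexHull [FiniteDimensional ℂ (traceSpace A)] {n : ℕ}
    {φ : Fin n → traceSpace A} (h : EnumeratesExtremeTraces φ) :
    tracialStates A ⊆ convexHull ℝ (Set.range φ) := by
  have hcl : IsClosed (convexHull ℝ (Set.range φ)) :=
    (Set.finite_range φ).isClosed_convexHull (𝕜 := ℝ)
  rw [← hcl.closure_eq, h.2,
    closure_convexHull_extremePoints (isCompact_tracialStates (A := A)) convex_tracialStates]

theorem EnumeratesExtremeTraces.mem {n : ℕ} {φ : Fin n → traceSpace A}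
    (h : EnumeratesExtremeTraces φ) (i : Fin n) : φ i ∈ tracialStates A :=
  (extremePoints_subset (h.2 ▸ Set.mem_range_self i) : φ i ∈ tracialStates A)

/-- A class that dominates another one strictly on all extreme traces is larger. -/
theorem AFSystem.exists_eq_add_of_trace_lt (D : AFSystem A) [FiniteDimensional ℂ (traceSpace A)]
    {n : ℕ} {φ : Fin n → traceSpace A} (h : EnumeratesExtremeTraces φ) {x y : MvNMonoid A}
    (hxy : ∀ i, (vTrace (φ i) y).re < (vTrace (φ i) x).re) : ∃ r, x = y + r := by
  by_contra hcon
  obtain ⟨τ, hτ, hle⟩ := D.exists_tracialState_le hcon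
  obtain ⟨p, rfl⟩ := exists_cls_eq x
  obtain ⟨q, rfl⟩ := exists_cls_eq y
  have hL : ∀ (τ σ : traceSpace A) (s t : ℝ) (p : MatProj A),
      vTrace (s • τ + t • σ) (cls p.2.1) =
        (s : ℂ) * vTrace τ (cls p.2.1) + (t : ℂ) * vTrace σ (cls p.2.1) := by
    intro τ σ s t p
    simp only [vTrace_cls _ p.2.2, trMat, Finset.mul_sum, ← Finset.sum_add_distrib]
    rfl
  have hconv : Convex ℝ {τ : traceSpace A |
      (vTrace τ (cls q.2.1)).re < (vTrace τ (cls p.2.1)).re} := by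
    intro τ hτ σ hσ s t hs ht hst
    simp only [Set.mem_ofPred_eq, hL, Complex.add_re, Complex.re_ofReal_mul] at hτ hσ ⊢
    rcases hs.eq_or_lt with rfl | hs
    · have : t = 1 := by linarith
      subst this; linarith
    · nlinarith [mul_pos hs (sub_pos.2 hτ), mul_nonneg ht (sub_pos.2 hσ).le]
  have := convexHull_min (s := Set.range φ) (by rintro _ ⟨i, rfl⟩; exact hxy i) hconv
    (h.subset_convexHull hτ)
  exact absurd hle (not_le.2 this)

end ExtremeTraces

/-! ### Conjugation of systems -/

section Conjugation

variable {A : Type u} [Ring A] [StarRing A]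
variable {ι κ l l' m k : Type} [Fintype ι] [DecidableEq ι] [Fintype l] [Fintype m] [Fintype l']
  [Fintype k]

/-- Systems of the same shape with equivalent minimal projections are conjugate. -/
theorem IsSystem.exists_conj {c : ι → κ} {w : ι → Matrix m l A} {q : κ → Matrix l l A}
    {e : Matrix m m A} {w' : ι → Matrix k l' A} {q' : κ → Matrix l' l' A} {e' : Matrix k k A}
    (h : IsSystem c w q e) (h' : IsSystem c w' q' e') (hq : ∀ j, MvN (q' j) (q j)) :
    ∃ u : Matrix k m A, u * uᴴ = e' ∧ uᴴ * u = e ∧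
      ∀ i j, c i = c j → u * (w i * (w j)ᴴ) * uᴴ = w' i * (w' j)ᴴ := by
  choose v hv1 hv2 hv3 hv4 using fun j => (hq j).exists_support (h'.proj j) (h.proj j)
  -- `u` takes column `w i` to `w' i`, with `v (c i)` between them to identify the two minimal
  -- supports; using one `v` per class makes all matrix units correspond.
  let u : Matrix k m A := ∑ i, w' i * v (c i) * (w i)ᴴ
  have hu : ∀ j, u * w j = w' j * v (c j) := by
    intro j
    simp only [u, Matrix.sum_mul]
    rw [Finset.sum_eq_single j]
    · rw [Matrix.mul_assoc, h.diag, Matrix.mul_assoc, hv4]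
    · intro i _ hij
      rw [Matrix.mul_assoc, h.orth, if_neg hij, Matrix.mul_zero]
    · simp
  have hus : uᴴ = ∑ i, w i * (v (c i))ᴴ * (w' i)ᴴ := by
    simp only [u, Matrix.conjTranspose_sum, Matrix.conjTranspose_mul,
      Matrix.conjTranspose_conjTranspose, Matrix.mul_assoc]
  have hu' : ∀ j, uᴴ * w' j = w j * (v (c j))ᴴ := by
    intro j
    rw [hus, Matrix.sum_mul, Finset.sum_eq_single j]
    · rw [Matrix.mul_assoc, h'.diag, Matrix.mul_assoc]
      congr 1
      conv_rhs => rw [← hv3, Matrix.conjTranspose_mul,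
        (isStarProjection_iff_conj.1 (h'.proj _)).2]
    · intro i _ hij
      rw [Matrix.mul_assoc, h'.orth, if_neg hij, Matrix.mul_zero]
    · simp
  have hwu : ∀ j, (w j)ᴴ * uᴴ = (v (c j))ᴴ * (w' j)ᴴ := by
    intro j
    rw [← Matrix.conjTranspose_mul, hu, Matrix.conjTranspose_mul]
  refine ⟨u, ?_, ?_, ?_⟩
  · rw [← h'.sum, hus, Matrix.mul_sum]
    refine Finset.sum_congr rfl fun i _ => ?_
    rw [← Matrix.mul_assoc, ← Matrix.mul_assoc, hu, Matrix.mul_assoc (w' i), hv1, h'.right]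
  · rw [← h.sum]
    simp only [u, Matrix.mul_sum]
    refine Finset.sum_congr rfl fun i _ => ?_
    rw [← Matrix.mul_assoc, ← Matrix.mul_assoc, hu', Matrix.mul_assoc (w i), hv2, h.right]
  · intro i j hij
    rw [← Matrix.mul_assoc, hu, Matrix.mul_assoc, hwu, hij, Matrix.mul_assoc,
      ← Matrix.mul_assoc (v _), hv1, h'.left']

theorem IsSystem.conj {c : ι → κ} {w : ι → Matrix m l A} {q : κ → Matrix l l A}
    {e : Matrix m m A} {e' : Matrix k k A} (h : IsSystem c w q e) {u : Matrix k m A}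
    (he' : IsStarProjection e') (hu : u * uᴴ = e') (hu' : uᴴ * u = e) :
    IsSystem c (fun i => u * w i) q e' where
  proj := h.proj
  orth i j := by
    rw [Matrix.conjTranspose_mul, Matrix.mul_assoc, ← Matrix.mul_assoc uᴴ, hu', h.left, h.orth]
  right i := by rw [Matrix.mul_assoc, h.right]
  sum := by
    have : ∑ i, u * w i * (u * w i)ᴴ = u * (∑ i, w i * (w i)ᴴ) * uᴴ := by
      simp only [Matrix.mul_sum, Matrix.sum_mul, Matrix.conjTranspose_mul, Matrix.mul_assoc]
    rw [this, h.sum, ← hu', ← Matrix.mul_assoc, Matrix.mul_assoc _ u, hu,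
      (isStarProjection_iff_conj.1 he').1]

end Conjugation

/-! ### Graphs of partial isomorphisms -/

section Graph

variable {A : Type u} [CStarAlgebra A]
variable {m k : Type} [Fintype m] [Fintype k] [DecidableEq m] [DecidableEq k]

theorem eq_zero_of_mvn_zero {l : Type} [Fintype l] {P : Matrix m m A} (hP : IsStarProjection P)
    (h : MvN P (0 : Matrix l l A)) : P = 0 := by
  obtain ⟨v, h1, -, -, h2⟩ := h.exists_support hP (IsStarProjection.zero _)
  rw [← h1, ← h2, Matrix.mul_zero, Matrix.zero_mul]

theorem eq_zero_of_cls_eq_zero {P : Matrix m m A} (hP : IsStarProjection P) (h : cls P = 0) :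
    P = 0 := by
  rw [← cls_zero (m := m), cls_eq_cls_iff hP (IsStarProjection.zero _)] at h
  exact eq_zero_of_mvn_zero hP h

theorem exists_cls_eq_of_le {x : MvNMonoid A} {p : MatProj A} (hp : cls p.2.1 = x) {l : ℕ}
    (hl : p.1 ≤ l) : ∃ q : Matrix (Fin l) (Fin l) A, IsStarProjection q ∧ cls q = x := by
  obtain ⟨r, rfl⟩ := Nat.exists_eq_add_of_le hl
  let z : MatProj A := ⟨r, 0, IsStarProjection.zero _⟩
  refine ⟨(p.dsum z).2.1, (p.dsum z).2.2, ?_⟩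
  refine (cls_dsum p z).trans ?_
  rw [hp]
  change x + cls (0 : Matrix (Fin r) (Fin r) A) = x
  rw [cls_zero, add_zero]

/-- A finite family of classes is realized by projections of a common size. -/
theorem exists_cls_eq_family {κ : Type} [Fintype κ] (x : κ → MvNMonoid A) :
    ∃ (l : ℕ) (q : κ → Matrix (Fin l) (Fin l) A), ∀ j, IsStarProjection (q j) ∧ cls (q j) = x j := by
  choose p hp using fun j => exists_cls_eq (x j)
  refine ⟨∑ j, (p j).1, ?_⟩
  choose q hq using fun j => exists_cls_eq_of_le (hp j)
    (Finset.single_le_sum (f := fun j => (p j).1) (fun _ _ => Nat.zero_le _) (Finset.mem_univ j))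
  exact ⟨q, hq⟩

/-- The pairs of corresponding matrix units of two systems of the same shape. -/
def unitPairs {ι κ l l' : Type} [Fintype l] [Fintype l'] (c : ι → κ) (w : ι → Matrix m l A)
    (w' : ι → Matrix k l' A) : Set (Matrix m m A × Matrix k k A) :=
  {z | ∃ i j, c i = c j ∧ z = (w i * (w j)ᴴ, w' i * (w' j)ᴴ)}

variable {J : Type} (φ : J → traceSpace A) (μ : J → ℂ)

/-- `T` is the graph of an isomorphism between finite-dimensional C*-subalgebras with units `e`
and `p`, that scales the trace `φ j` by `μ j`. -/
def IsGraph (e : Matrix m m A) (p : Matrix k k A)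
    (T : Submodule ℂ (Matrix m m A × Matrix k k A)) : Prop :=
  ∃ (n : ℕ) (κ : Type) (_ : Fintype κ) (l l' : ℕ) (c : Fin n → κ)
    (w : Fin n → Matrix m (Fin l) A) (q : κ → Matrix (Fin l) (Fin l) A)
    (w' : Fin n → Matrix k (Fin l') A) (q' : κ → Matrix (Fin l') (Fin l') A),
    Function.Surjective c ∧ IsSystem c w q e ∧ IsSystem c w' q' p ∧
    (∀ i, q i ≠ 0) ∧ (∀ i, q' i ≠ 0) ∧
    (∀ i j, trMat (φ j) (q' i) = μ j * trMat (φ j) (q i)) ∧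
    T = Submodule.span ℂ (unitPairs c w w')

variable {φ μ} {e : Matrix m m A} {p : Matrix k k A}
  {T : Submodule ℂ (Matrix m m A × Matrix k k A)}

theorem IsGraph.swap (hμ : ∀ j, μ j ≠ 0) (h : IsGraph φ μ e p T) :
    IsGraph φ (fun j => (μ j)⁻¹) p e
      (T.map (LinearEquiv.prodComm ℂ (Matrix m m A) (Matrix k k A)).toLinearMap) := by
  obtain ⟨n, κ, _, l, l', c, w, q, w', q', hc, h1, h2, h3, h4, h5, rfl⟩ := h
  refine ⟨n, κ, inferInstance, l', l, c, w', q', w, q, hc, h2, h1, h4, h3, fun i j => ?_, ?_⟩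
  · rw [h5, inv_mul_cancel_left₀ (hμ j)]
  · rw [Submodule.map_span]
    congr 1
    ext z
    constructor
    · rintro ⟨_, ⟨i, j, hij, rfl⟩, rfl⟩
      exact ⟨i, j, hij, rfl⟩
    · rintro ⟨i, j, hij, rfl⟩
      exact ⟨_, ⟨i, j, hij, rfl⟩, rfl⟩

theorem trMat_add {m : Type} [Fintype m] (τ : traceSpace A) (x y : Matrix m m A) :
    trMat τ (x + y) = trMat τ x + trMat τ y := by
  simp [trMat, Finset.sum_add_distrib]

theorem trMat_smul {m : Type} [Fintype m] (τ : traceSpace A) (r : ℂ) (x : Matrix m m A) :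
    trMat τ (r • x) = r * trMat τ x := by
  simp [trMat, Finset.mul_sum]

theorem IsGraph.trMat_eq (h : IsGraph φ μ e p T) {z} (hz : z ∈ T) (j : J) :
    trMat (φ j) z.2 = μ j * trMat (φ j) z.1 := by
  obtain ⟨n, κ, _, l, l', c, w, q, w', q', hc, h1, h2, h3, h4, h5, rfl⟩ := h
  induction hz using Submodule.span_induction with
  | mem z hz =>
    obtain ⟨i, i', hi, rfl⟩ := hz
    change trMat (φ j) (w' i * (w' i')ᴴ) = μ j * trMat (φ j) (w i * (w i')ᴴ)
    rw [trMat_mul_comm, trMat_mul_comm _ (w i), h1.orth, h2.orth]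
    split_ifs
    · exact h5 _ _
    · simp [trMat]
  | zero => simp [trMat]
  | add x y _ _ hx hy => rw [Prod.snd_add, Prod.fst_add, trMat_add, trMat_add, hx, hy, mul_add]
  | smul r x _ hx => rw [Prod.smul_snd, Prod.smul_fst, trMat_smul, trMat_smul, hx]; ring

theorem IsGraph.star_mem (h : IsGraph φ μ e p T) {z} (hz : z ∈ T) : star z ∈ T := by
  obtain ⟨n, κ, _, l, l', c, w, q, w', q', hc, h1, h2, h3, h4, h5, rfl⟩ := h
  induction hz using Submodule.span_induction with
  | mem z hz =>
    obtain ⟨i, j, hij, rfl⟩ := hz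
    refine Submodule.subset_span ⟨j, i, hij.symm, ?_⟩
    refine Prod.ext ?_ ?_
    · change (w i * (w j)ᴴ)ᴴ = _
      rw [Matrix.conjTranspose_mul, Matrix.conjTranspose_conjTranspose]
    · change (w' i * (w' j)ᴴ)ᴴ = _
      rw [Matrix.conjTranspose_mul, Matrix.conjTranspose_conjTranspose]
  | zero => simp
  | add x y _ _ hx hy => rw [star_add]; exact add_mem hx hy
  | smul r x _ hx => rw [star_smul]; exact Submodule.smul_mem _ _ hx

theorem IsGraph.mul_mem (h : IsGraph φ μ e p T) {z z'} (hz : z ∈ T) (hz' : z' ∈ T) :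
    z * z' ∈ T := by
  obtain ⟨n, κ, _, l, l', c, w, q, w', q', hc, h1, h2, h3, h4, h5, rfl⟩ := h
  induction hz, hz' using Submodule.span_induction₂ with
  | mem_mem z z' hz hz' =>
    obtain ⟨i, j, hij, rfl⟩ := hz
    obtain ⟨i', j', hij', rfl⟩ := hz'
    by_cases hj : j = i'
    · subst hj
      refine Submodule.subset_span ⟨i, j', hij.trans hij', Prod.ext ?_ ?_⟩
      · change w i * (w j)ᴴ * (w j * (w j')ᴴ) = _
        rw [Matrix.mul_assoc, ← Matrix.mul_assoc _ (w j), h1.diag, hij', h1.left']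
      · change w' i * (w' j)ᴴ * (w' j * (w' j')ᴴ) = _
        rw [Matrix.mul_assoc, ← Matrix.mul_assoc _ (w' j), h2.diag, hij', h2.left']
    · have : ((w i * (w j)ᴴ, w' i * (w' j)ᴴ) : Matrix m m A × Matrix k k A) *
          (w i' * (w j')ᴴ, w' i' * (w' j')ᴴ) = 0 := by
        refine Prod.ext ?_ ?_
        · change w i * (w j)ᴴ * (w i' * (w j')ᴴ) = 0
          rw [Matrix.mul_assoc, ← Matrix.mul_assoc _ (w i'), h1.orth, if_neg hj, Matrix.zero_mul,
            Matrix.mul_zero]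
        · change w' i * (w' j)ᴴ * (w' i' * (w' j')ᴴ) = 0
          rw [Matrix.mul_assoc, ← Matrix.mul_assoc _ (w' i'), h2.orth, if_neg hj, Matrix.zero_mul,
            Matrix.mul_zero]
      rw [this]
      exact zero_mem _
  | zero_left y _ => rw [zero_mul]; exact zero_mem _
  | zero_right x _ => rw [mul_zero]; exact zero_mem _
  | add_left x y z _ _ _ h h' => rw [add_mul]; exact add_mem h h'
  | add_right x y z _ _ _ h h' => rw [mul_add]; exact add_mem h h'
  | smul_left r x y _ _ h => rw [smul_mul_assoc]; exact Submodule.smul_mem _ _ h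
  | smul_right r x y _ _ h => rw [mul_smul_comm]; exact Submodule.smul_mem _ _ h

theorem IsGraph.unit_mem (h : IsGraph φ μ e p T) : (e, p) ∈ T := by
  obtain ⟨n, κ, _, l, l', c, w, q, w', q', hc, h1, h2, h3, h4, h5, rfl⟩ := h
  have : (e, p) = ∑ i, (w i * (w i)ᴴ, w' i * (w' i)ᴴ) := by
    rw [← h1.sum, ← h2.sum]
    exact Prod.ext (by rw [Prod.fst_sum]) (by rw [Prod.snd_sum])
  rw [this]
  exact sum_mem fun i _ => Submodule.subset_span ⟨i, i, rfl, rfl⟩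

theorem IsGraph.corner (h : IsGraph φ μ e p T) {z} (hz : z ∈ T) :
    e * z.1 * e = z.1 ∧ p * z.2 * p = z.2 := by
  obtain ⟨n, κ, _, l, l', c, w, q, w', q', hc, h1, h2, h3, h4, h5, rfl⟩ := h
  have he := (isStarProjection_iff_conj.1 h1.cls_eq.1).2
  have hp := (isStarProjection_iff_conj.1 h2.cls_eq.1).2
  have h1' : ∀ i, (w i)ᴴ * e = (w i)ᴴ := fun i => by
    conv_rhs => rw [← h1.left i, Matrix.conjTranspose_mul, he]
  have h2' : ∀ i, (w' i)ᴴ * p = (w' i)ᴴ := fun i => by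
    conv_rhs => rw [← h2.left i, Matrix.conjTranspose_mul, hp]
  induction hz using Submodule.span_induction with
  | mem z hz =>
    obtain ⟨i, j, hij, rfl⟩ := hz
    constructor
    · change e * (w i * (w j)ᴴ) * e = w i * (w j)ᴴ
      rw [← Matrix.mul_assoc, h1.left, Matrix.mul_assoc, h1']
    · change p * (w' i * (w' j)ᴴ) * p = w' i * (w' j)ᴴ
      rw [← Matrix.mul_assoc, h2.left, Matrix.mul_assoc, h2']
  | zero => simp
  | add x y _ _ hx hy =>
    simp only [Prod.fst_add, Prod.snd_add, mul_add, add_mul, hx.1, hx.2, hy.1, hy.2, and_self]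
  | smul r x _ hx =>
    simp only [Prod.smul_fst, Prod.smul_snd, mul_smul_comm, smul_mul_assoc, hx.1, hx.2, and_self]

/-- Compressing the two components by the columns `i`, `j` reads off the same scalar `r`, against `q
(c i)` on the left and `q' (c i)` on the right. As `q (c i) ≠ 0`, a zero first component kills every
`r`. -/
theorem IsGraph.snd_eq_zero (h : IsGraph φ μ e p T) {z} (hz : z ∈ T) (h0 : z.1 = 0) :
    z.2 = 0 := by
  have hcor := (h.corner hz).2
  obtain ⟨n, κ, _, l, l', c, w, q, w', q', hc, h1, h2, h3, h4, h5, rfl⟩ := h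
  have key : ∀ z ∈ Submodule.span ℂ (unitPairs c w w'), ∀ i j, ∃ r : ℂ,
      (w i)ᴴ * z.1 * w j = r • q (c i) ∧ (w' i)ᴴ * z.2 * w' j = r • q' (c i) := by
    intro z hz i j
    induction hz using Submodule.span_induction with
    | mem z hz =>
      obtain ⟨a, b, hab, rfl⟩ := hz
      have e1 : (w i)ᴴ * (w a * (w b)ᴴ) * w j = ((w i)ᴴ * w a) * ((w b)ᴴ * w j) := by
        simp only [Matrix.mul_assoc]
      have e2 : (w' i)ᴴ * (w' a * (w' b)ᴴ) * w' j = ((w' i)ᴴ * w' a) * ((w' b)ᴴ * w' j) := by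
        simp only [Matrix.mul_assoc]
      by_cases hia : i = a ∧ b = j
      · obtain ⟨rfl, rfl⟩ := hia
        refine ⟨1, ?_, ?_⟩
        · change (w i)ᴴ * (w i * (w b)ᴴ) * w b = _
          rw [e1, h1.diag, h1.diag, ← hab, one_smul, (h1.proj _).1]
        · change (w' i)ᴴ * (w' i * (w' b)ᴴ) * w' b = _
          rw [e2, h2.diag, h2.diag, ← hab, one_smul, (h2.proj _).1]
      · refine ⟨0, ?_, ?_⟩
        · change (w i)ᴴ * (w a * (w b)ᴴ) * w j = _
          rw [e1, h1.orth, h1.orth, zero_smul]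
          split_ifs with ha hb
          · exact absurd ⟨ha, hb⟩ hia
          all_goals simp
        · change (w' i)ᴴ * (w' a * (w' b)ᴴ) * w' j = _
          rw [e2, h2.orth, h2.orth, zero_smul]
          split_ifs with ha hb
          · exact absurd ⟨ha, hb⟩ hia
          all_goals simp
    | zero => exact ⟨0, by simp, by simp⟩
    | add x y _ _ hx hy =>
      obtain ⟨r, hr, hr'⟩ := hx
      obtain ⟨s, hs, hs'⟩ := hy
      refine ⟨r + s, ?_, ?_⟩
      · rw [Prod.fst_add, Matrix.mul_add, Matrix.add_mul, hr, hs, add_smul]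
      · rw [Prod.snd_add, Matrix.mul_add, Matrix.add_mul, hr', hs', add_smul]
    | smul s x _ hx =>
      obtain ⟨r, hr, hr'⟩ := hx
      refine ⟨s * r, ?_, ?_⟩
      · rw [Prod.smul_fst, Matrix.mul_smul, Matrix.smul_mul, hr, smul_smul]
      · rw [Prod.smul_snd, Matrix.mul_smul, Matrix.smul_mul, hr', smul_smul]
  have hzero : ∀ i j, (w' i)ᴴ * z.2 * w' j = 0 := by
    intro i j
    obtain ⟨r, hr, hr'⟩ := key z hz i j
    rw [h0, Matrix.mul_zero, Matrix.zero_mul] at hr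
    rw [hr', (smul_eq_zero.1 hr.symm).resolve_right (h3 _), zero_smul]
  have hexp : p * z.2 * p = ∑ i, ∑ j, w' i * ((w' i)ᴴ * z.2 * w' j) * (w' j)ᴴ := by
    rw [← h2.sum]
    simp only [Matrix.mul_sum, Matrix.sum_mul, Matrix.mul_assoc]
    exact Finset.sum_comm
  rw [← hcor, hexp]
  simp [hzero]

theorem IsGraph.fst_eq_zero (h : IsGraph φ μ e p T) (hμ : ∀ j, μ j ≠ 0) {z} (hz : z ∈ T)
    (h0 : z.2 = 0) : z.1 = 0 :=
  (h.swap hμ).snd_eq_zero (z := z.swap) ⟨z, hz, rfl⟩ h0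

theorem IsGraph.snd_eq_snd (h : IsGraph φ μ e p T) {x y y'} (hz : (x, y) ∈ T)
    (hz' : (x, y') ∈ T) : y = y' :=
  sub_eq_zero.1 (h.snd_eq_zero (sub_mem hz hz') (sub_self x))

end Graph

/-! ### Matrix units and refinement of subalgebras -/

section MatrixUnits

variable {A : Type u} [CStarAlgebra A]
variable {ι κ l m : Type} [Fintype ι] [DecidableEq ι] [Fintype l] [Fintype m]

theorem IsSystem.map {B : Type u} [CStarAlgebra B] (f : B →⋆ₐ[ℂ] A) {c : ι → κ}
    {w : ι → Matrix m l B} {q : κ → Matrix l l B} {e : Matrix m m B} (h : IsSystem c w q e) :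
    IsSystem c (fun i => (w i).map f) (fun k => (q k).map f) (e.map f) where
  proj k := IsStarProjection.matrix_map f (h.proj k)
  orth i j := by
    rw [conjTranspose_map_starAlgHom, ← map_mul_starAlgHom, h.orth]
    split_ifs
    · rfl
    · exact Matrix.map_zero _ (map_zero f)
  right i := by rw [← map_mul_starAlgHom, h.right]
  sum := by
    rw [← h.sum]
    simp only [conjTranspose_map_starAlgHom, ← map_mul_starAlgHom]
    ext i j
    rw [Matrix.sum_apply, Matrix.map_apply, Matrix.sum_apply, map_sum]
    rfl

/-- The matrix units attached to a system of columns. -/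
def matUnits (c : ι → κ) (w : ι → Matrix m l A) : Set (Matrix m m A) :=
  {z | ∃ i j, c i = c j ∧ z = w i * (w j)ᴴ}

/-- Expand with `e = ∑ w i (w i)ᴴ`: minimality of the `q k` turns each middle factor within a class
into a scalar, and orthogonality removes the factors between different classes. -/
theorem IsSystem.mul_mul_mem_span {c : ι → κ} {w : ι → Matrix m l A} {q : κ → Matrix l l A}
    {e : Matrix m m A} (h : IsSystem c w q e) (hq : ∀ k x, ∃ z : ℂ, q k * x * q k = z • q k)
    (hqq : ∀ k k', k ≠ k' → ∀ x, q k * x * q k' = 0) (x : Matrix m m A) :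
    e * x * e ∈ Submodule.span ℂ (matUnits c w) := by
  have hexp : e * x * e = ∑ i, ∑ j, w i * ((w i)ᴴ * x * w j) * (w j)ᴴ := by
    rw [← h.sum]
    simp only [Matrix.mul_sum, Matrix.sum_mul, Matrix.mul_assoc]
    exact Finset.sum_comm
  rw [hexp]
  refine sum_mem fun i _ => sum_mem fun j _ => ?_
  have e1 : (w i)ᴴ * x * w j = q (c i) * ((w i)ᴴ * x * w j) * q (c j) := by
    rw [← Matrix.mul_assoc, ← Matrix.mul_assoc, h.left', Matrix.mul_assoc _ (w j),
      h.right]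
  by_cases hij : c i = c j
  · rw [e1, ← hij]
    obtain ⟨z, hz⟩ := hq (c i) ((w i)ᴴ * x * w j)
    rw [hz, Matrix.mul_smul, h.right, Matrix.smul_mul]
    exact Submodule.smul_mem _ _ (Submodule.subset_span ⟨i, j, hij, rfl⟩)
  · rw [e1, hqq _ _ hij, Matrix.mul_zero, Matrix.zero_mul]
    exact zero_mem _

end MatrixUnits

namespace AFSystem

variable {A : Type u} [CStarAlgebra A] (D : AFSystem A)
variable {m : Type} [Fintype m] [DecidableEq m]

theorem exists_isStarProjection_family {κ l : Type} [Fintype κ] [Fintype l] [DecidableEq l]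
    {e : Matrix m m A} {q : κ → Matrix l l A} (he : IsStarProjection e)
    (hq : ∀ k, IsStarProjection (q k)) :
    ∃ (n : ℕ) (e' : Matrix m m (D.B n)) (q' : κ → Matrix l l (D.B n)), IsStarProjection e' ∧
      (∀ k, IsStarProjection (q' k)) ∧ MvN (e'.map (D.f n)) e ∧
      ∀ k, MvN ((q' k).map (D.f n)) (q k) := by
  obtain ⟨n₁, -, e₁, he₁, hee⟩ := D.exists_isStarProjection_mvn he 0
  choose ν _ q₁ hq₁ hqq using fun k => D.exists_isStarProjection_mvn (hq k) 0
  have h1 : n₁ ≤ n₁ + ∑ k, ν k := Nat.le_add_right _ _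
  have h2 : ∀ k, ν k ≤ n₁ + ∑ k, ν k := fun k =>
    (Finset.single_le_sum (f := ν) (fun _ _ => Nat.zero_le _) (Finset.mem_univ k)).trans
      (Nat.le_add_left _ _)
  obtain ⟨g, hg⟩ := D.incl _ _ h1
  choose g' hg' using fun k => D.incl _ _ (h2 k)
  refine ⟨_, e₁.map g, fun k => (q₁ k).map (g' k), IsStarProjection.matrix_map g he₁,
    fun k => IsStarProjection.matrix_map (g' k) (hq₁ k), ?_, fun k => ?_⟩
  · have : (e₁.map g).map (D.f (n₁ + ∑ k, ν k)) = e₁.map (D.f n₁) := Matrix.ext fun i j => hg _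
    rwa [this]
  · have : ((q₁ k).map (g' k)).map (D.f (n₁ + ∑ k, ν k)) = (q₁ k).map (D.f (ν k)) :=
      Matrix.ext fun i j => hg' _ _
    rw [this]
    exact hqq k

/-- A finite-dimensional subalgebra with given matrix units can be enlarged so as to approximate
a given element of the corner. -/
theorem exists_refinement (D : AFSystem A) {n : ℕ} {κ l : Type} [Fintype κ] [Fintype l] [DecidableEq l]
    {c : Fin n → κ}
    {w : Fin n → Matrix m l A} {q : κ → Matrix l l A} {e : Matrix m m A} (h : IsSystem c w q e)
    {x : Matrix m m A} (hx : e * x * e = x) {ε : ℝ} (hε : 0 < ε) :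
    ∃ (n₂ : ℕ) (κ₂ : Type) (_ : Fintype κ₂) (c₂ : Fin n₂ → κ₂) (w₂ : Fin n₂ → Matrix m m A)
      (q₂ : κ₂ → Matrix m m A), Function.Surjective c₂ ∧ IsSystem c₂ w₂ q₂ e ∧ (∀ k, q₂ k ≠ 0) ∧
      matUnits c w ⊆ Submodule.span ℂ (matUnits c₂ w₂) ∧
      ∃ y ∈ Submodule.span ℂ (matUnits c₂ w₂), ‖y - x‖ < ε := by
  obtain ⟨he, hcls⟩ := h.cls_eq
  obtain ⟨N, e₀, q₀, he₀, hq₀, hee, hqq⟩ := D.exists_isStarProjection_family he h.proj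
  have hv : vMap (D.f N) (cls e₀) = vMap (D.f N) (∑ i, cls (q₀ (c i))) := by
    rw [map_sum, vMap_cls _ he₀,
      (cls_eq_cls_iff (IsStarProjection.matrix_map _ he₀) he).2 hee, hcls]
    refine Finset.sum_congr rfl fun i _ => ?_
    rw [vMap_cls _ (hq₀ _)]
    exact ((cls_eq_cls_iff (IsStarProjection.matrix_map _ (hq₀ _)) (h.proj _)).2 (hqq _)).symm
  -- At stage `N'` the class of `e₀` is the sum prescribed by the shape `c`, so a system of the same
  -- shape exists there; `u` conjugates the given system to it.
  obtain ⟨N', -, g, hg, hv'⟩ := D.exists_vMap_descent hv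
  rw [map_sum, vMap_cls _ he₀] at hv'
  obtain ⟨w₁, h₁⟩ := exists_isSystem (c := c) (q := fun k => (q₀ k).map g) (e := e₀.map g)
    (fun k => IsStarProjection.matrix_map g (hq₀ k)) (IsStarProjection.matrix_map g he₀)
    (by rw [hv']; exact Finset.sum_congr rfl fun i _ => vMap_cls _ (hq₀ _))
  set e₁ := e₀.map g
  obtain ⟨u, hu, hu', huw⟩ := h.exists_conj (h₁.map (D.f N')) (fun k => by
    have : ((q₀ k).map g).map (D.f N') = (q₀ k).map (D.f N) := Matrix.ext fun i j => hg _
    change MvN (((q₀ k).map g).map (D.f N')) (q k)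
    rw [this]
    exact hqq k)
  set E := e₁.map (D.f N')
  have hE : IsStarProjection E := (h₁.map (D.f N')).cls_eq.1
  have hEu : E * u = u * e := by rw [← hu, ← hu', Matrix.mul_assoc]
  have hEE : uᴴ * E * u = e := by
    rw [Matrix.mul_assoc, hEu, ← Matrix.mul_assoc, hu', he.1]
  have hL : Continuous fun Y : Matrix m m A => uᴴ * (E * Y * E) * u - x :=
    by fun_prop
  obtain ⟨N'', hN, y, hy⟩ := D.exists_matrix_mem
    (U := {Y : Matrix m m A | ‖uᴴ * (E * Y * E) * u - x‖ < ε})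
    (isOpen_lt hL.norm continuous_const) ⟨u * x * uᴴ, by
      have : uᴴ * (E * (u * x * uᴴ) * E) * u = (uᴴ * E * u) * x * (uᴴ * E * u) := by
        simp only [Matrix.mul_assoc]
      change ‖uᴴ * (E * (u * x * uᴴ) * E) * u - x‖ < ε
      rw [this, hEE, hx, sub_self, norm_zero]
      exact hε⟩ N'
  obtain ⟨g', hg'⟩ := D.incl _ _ hN
  have h₂ := h₁.map g'
  -- The refined subalgebra is the whole corner of `e₂` at stage `N''`, conjugated back by `uᴴ`. It
  -- contains the old matrix units and the approximant of `x`.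
  obtain ⟨n₂, κ₂, _, _, c₂, w₂, q₂, h₃, hc₂, hmin, horth⟩ := exists_isSystem_isMinProj h₂.cls_eq.1
  set e₂ := e₁.map g'
  have he₂ : e₂.map (D.f N'') = E := Matrix.ext fun i j => hg' _
  have h₄ := h₃.map (D.f N'')
  rw [he₂] at h₄
  have h₅ := h₄.conj (u := uᴴ) he (by rw [Matrix.conjTranspose_conjTranspose, hu'])
    (by rw [Matrix.conjTranspose_conjTranspose, hu])
  have hspan : ∀ z : Matrix m m (D.B N''), uᴴ * (e₂ * z * e₂).map (D.f N'') * u ∈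
      Submodule.span ℂ (matUnits c₂ fun i => uᴴ * (w₂ i).map (D.f N'')) := by
    intro z
    have hz := h₃.mul_mul_mem_span (fun k => (hmin k).2.2) horth z
    generalize e₂ * z * e₂ = z' at hz
    induction hz using Submodule.span_induction with
    | mem z hz =>
      obtain ⟨i, j, hij, rfl⟩ := hz
      refine Submodule.subset_span ⟨i, j, hij, ?_⟩
      rw [map_mul_starAlgHom, Matrix.conjTranspose_mul, Matrix.conjTranspose_conjTranspose,
        conjTranspose_map_starAlgHom]
      simp only [Matrix.mul_assoc]
    | zero =>
      rw [Matrix.map_zero _ (map_zero _), Matrix.mul_zero, Matrix.zero_mul]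
      exact zero_mem _
    | add a b _ _ ha hb =>
      have : (a + b).map (D.f N'') = a.map (D.f N'') + b.map (D.f N'') :=
        map_add (matMap (D.f N'')) a b
      rw [this, Matrix.mul_add, Matrix.add_mul]
      exact add_mem ha hb
    | smul r a _ ha =>
      have : (r • a).map (D.f N'') = r • a.map (D.f N'') := map_smul (matMap (D.f N'')) r a
      rw [this, Matrix.mul_smul, Matrix.smul_mul]
      exact Submodule.smul_mem _ _ ha
  refine ⟨n₂, κ₂, inferInstance, c₂, _, _, hc₂, h₅, fun k hk => (hmin k).2.1 ?_, ?_, ?_⟩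
  · refine Matrix.map_injective (D.inj N'') ?_
    exact hk.trans (Matrix.map_zero _ (map_zero _)).symm
  · rintro _ ⟨i, j, hij, rfl⟩
    have h6 := hspan (((w₁ i) * (w₁ j)ᴴ).map g')
    have h7 : e₂ * ((w₁ i) * (w₁ j)ᴴ).map g' * e₂ = ((w₁ i) * (w₁ j)ᴴ).map g' := by
      have h8 : ((w₁ j).map g')ᴴ * e₂ = ((w₁ j).map g')ᴴ := by
        conv_rhs => rw [← h₂.left j, Matrix.conjTranspose_mul,
          (isStarProjection_iff_conj.1 h₂.cls_eq.1).2]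
      rw [map_mul_starAlgHom, ← conjTranspose_map_starAlgHom, ← Matrix.mul_assoc, h₂.left,
        Matrix.mul_assoc, h8]
    have h9 : (((w₁ i) * (w₁ j)ᴴ).map g').map (D.f N'') = u * (w i * (w j)ᴴ) * uᴴ := by
      rw [huw i j hij, conjTranspose_map_starAlgHom, ← map_mul_starAlgHom]
      exact Matrix.ext fun i j => hg' _
    have h10 : (w j)ᴴ * e = (w j)ᴴ := by
      conv_rhs => rw [← h.left j, Matrix.conjTranspose_mul, (isStarProjection_iff_conj.1 he).2]
    have h11 : uᴴ * (u * (w i * (w j)ᴴ) * uᴴ) * u = w i * (w j)ᴴ := by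
      calc uᴴ * (u * (w i * (w j)ᴴ) * uᴴ) * u = (uᴴ * u) * w i * ((w j)ᴴ * (uᴴ * u)) := by
            simp only [Matrix.mul_assoc]
        _ = _ := by rw [hu', h.left, h10]
    rw [h7, h9, h11] at h6
    exact h6
  · refine ⟨_, hspan y, ?_⟩
    rw [map_mul_starAlgHom, map_mul_starAlgHom, he₂]
    exact hy

end AFSystem

/-! ### The extension step of the back-and-forth argument -/

section Extension

variable {A : Type u} [CStarAlgebra A]
variable {J : Type} {φ : J → traceSpace A} {μ : J → ℂ}

variable (φ μ) in
/-- The traces `φ` separate classes of projections, and scaling the values of `φ j` by `μ j` is an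
automorphism of the set of values on classes. -/
structure ScalesClasses : Prop where
  sep : ∀ x y : MvNMonoid A, (∀ j, vTrace (φ j) x = vTrace (φ j) y) → x = y
  ne : ∀ j, μ j ≠ 0
  fwd : ∀ x : MvNMonoid A, ∃ y, ∀ j, vTrace (φ j) y = μ j * vTrace (φ j) x
  bwd : ∀ x : MvNMonoid A, ∃ y, ∀ j, vTrace (φ j) y = (μ j)⁻¹ * vTrace (φ j) x

theorem ScalesClasses.symm (H : ScalesClasses φ μ) : ScalesClasses φ (fun j => (μ j)⁻¹) where
  sep := H.sep
  ne j := inv_ne_zero (H.ne j)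
  fwd := H.bwd
  bwd := by simpa only [inv_inv] using H.fwd

theorem ScalesClasses.cls_eq {m n : Type} [Fintype m] [Fintype n]
    (H : ScalesClasses φ μ) {x : Matrix m m A} {y : Matrix n n A} (hx : IsStarProjection x)
    (hy : IsStarProjection y) (h : ∀ j, trMat (φ j) x = trMat (φ j) y) : cls x = cls y :=
  H.sep _ _ fun j => by rw [vTrace_cls _ hx, vTrace_cls _ hy, h]

theorem exists_mem_span_unitPairs {ι κ l l' m k : Type} [Fintype l] [Fintype l']
    [DecidableEq m] [DecidableEq k] [Fintype m] [Fintype k]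
    {c : ι → κ} {w : ι → Matrix m l A} (w' : ι → Matrix k l' A) {a : Matrix m m A}
    (ha : a ∈ Submodule.span ℂ (matUnits c w)) :
    ∃ b, (a, b) ∈ Submodule.span ℂ (unitPairs c w w') := by
  induction ha using Submodule.span_induction with
  | mem a ha =>
    obtain ⟨i, j, hij, rfl⟩ := ha
    exact ⟨_, Submodule.subset_span ⟨i, j, hij, rfl⟩⟩
  | zero => exact ⟨0, zero_mem _⟩
  | add x y _ _ hx hy =>
    obtain ⟨b, hb⟩ := hx
    obtain ⟨b', hb'⟩ := hy
    exact ⟨b + b', add_mem hb hb'⟩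
  | smul r x _ hx =>
    obtain ⟨b, hb⟩ := hx
    exact ⟨r • b, Submodule.smul_mem _ r hb⟩

variable {m k : Type} [Fintype m] [Fintype k] [DecidableEq m] [DecidableEq k]
  {e : Matrix m m A} {p : Matrix k k A} {T : Submodule ℂ (Matrix m m A × Matrix k k A)}

/-- A graph transports a system of columns to a system of the same shape. -/
theorem IsGraph.exists_transport (hT : IsGraph φ μ e p T) {ι κ l : Type} [Fintype ι]
    [DecidableEq ι] [Fintype l] {c : ι → κ} (hc : Function.Surjective c)
    {w : ι → Matrix m l A} {q : κ → Matrix l l A} (h : IsSystem c w q e)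
    (hw : ∀ i j, c i = c j → ∃ b, (w i * (w j)ᴴ, b) ∈ T) :
    ∃ (g : ι → Matrix k k A) (s : κ → Matrix k k A), IsSystem c g s p ∧
      (∀ i j, c i = c j → (w i * (w j)ᴴ, g i * (g j)ᴴ) ∈ T) ∧
      ∀ i j, trMat (φ j) (s i) = μ j * trMat (φ j) (q i) := by
  obtain ⟨σ, hσ⟩ := hc.hasRightInverse
  choose g hg using fun i => hw i (σ (c i)) (hσ _).symm
  choose s hs using fun i => hw (σ i) (σ i) rfl
  have hst : ∀ {x y}, (x, y) ∈ T → (xᴴ, yᴴ) ∈ T := fun hz => hT.star_mem hz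
  have hml : ∀ {x y x' y'}, (x, y) ∈ T → (x', y') ∈ T → (x * x', y * y') ∈ T :=
    fun hz hz' => hT.mul_mem hz hz'
  have hwp : ∀ i, (w (σ i) * (w (σ i))ᴴ) * (w (σ i) * (w (σ i))ᴴ) = w (σ i) * (w (σ i))ᴴ := by
    intro i
    rw [Matrix.mul_assoc, ← Matrix.mul_assoc _ (w _), h.diag, h.left']
  have hww : ∀ i j, c i = c j →
      w i * (w (σ (c i)))ᴴ * (w j * (w (σ (c j)))ᴴ)ᴴ = w i * (w j)ᴴ := by
    intro i j hij
    rw [Matrix.conjTranspose_mul, Matrix.conjTranspose_conjTranspose, Matrix.mul_assoc, hij,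
      ← Matrix.mul_assoc _ (w (σ (c j))), h.diag, hσ, h.left']
  have hgg : ∀ i j, c i = c j → (w i * (w j)ᴴ, g i * (g j)ᴴ) ∈ T := by
    intro i j hij
    have := hml (hg i) (hst (hg j))
    rwa [hww i j hij] at this
  refine ⟨g, s, ⟨fun i => ?_, fun i j => ?_, fun i => ?_, ?_⟩, hgg, fun i j => ?_⟩
  · refine isStarProjection_iff_conj.2 ⟨?_, ?_⟩
    · have h1 := hml (hs i) (hs i)
      rw [hwp] at h1
      exact hT.snd_eq_snd h1 (hs i)
    · have h1 := hst (hs i)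
      rw [Matrix.conjTranspose_mul, Matrix.conjTranspose_conjTranspose] at h1
      exact hT.snd_eq_snd h1 (hs i)
  · have h1 := hml (hst (hg i)) (hg j)
    have h2 : (w i * (w (σ (c i)))ᴴ)ᴴ * (w j * (w (σ (c j)))ᴴ) =
        w (σ (c i)) * ((w i)ᴴ * w j) * (w (σ (c j)))ᴴ := by
      rw [Matrix.conjTranspose_mul, Matrix.conjTranspose_conjTranspose]
      simp only [Matrix.mul_assoc]
    rw [h2, h.orth] at h1
    split_ifs with hij
    · subst hij
      rw [if_pos rfl, Matrix.mul_assoc] at h1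
      have h3 := h.left' (σ (c i))
      rw [hσ] at h3
      rw [h3] at h1
      exact hT.snd_eq_snd h1 (hs _)
    · rw [if_neg hij, Matrix.mul_zero, Matrix.zero_mul] at h1
      exact hT.snd_eq_zero h1 rfl
  · have h1 := hml (hg i) (hs (c i))
    have h2 : w i * (w (σ (c i)))ᴴ * (w (σ (c i)) * (w (σ (c i)))ᴴ) = w i * (w (σ (c i)))ᴴ := by
      rw [Matrix.mul_assoc, ← Matrix.mul_assoc _ (w (σ (c i))), h.diag, h.left']
    rw [h2] at h1
    exact hT.snd_eq_snd h1 (hg i)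
  · have h1 : (∑ i, w i * (w i)ᴴ, ∑ i, g i * (g i)ᴴ) ∈ T := by
      have : (∑ i, w i * (w i)ᴴ, ∑ i, g i * (g i)ᴴ) = ∑ i, (w i * (w i)ᴴ, g i * (g i)ᴴ) :=
        Prod.ext (by rw [Prod.fst_sum]) (by rw [Prod.snd_sum])
      rw [this]
      exact sum_mem fun i _ => hgg i i rfl
    rw [h.sum] at h1
    exact hT.snd_eq_snd h1 hT.unit_mem
  · have h1 := hT.trMat_eq (hs i) j
    rw [trMat_mul_comm _ (w _), h.diag, hσ] at h1
    exact h1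

/-- Refine the left subalgebra and scale the classes of its minimal projections by `μ`. They add up
to the class of `p`, which yields a system of the refined shape under `p`. The resulting graph need
not contain `T`, but it sends the old left matrix units to a system with the traces of the old right
one. Traces separate classes, so a unitary `u` of the corner corrects the discrepancy. -/
theorem IsGraph.exists_extension (D : AFSystem A) (H : ScalesClasses φ μ) {M K : ℕ}
    {e : Matrix (Fin M) (Fin M) A} {p : Matrix (Fin K) (Fin K) A}
    {T : Submodule ℂ (Matrix (Fin M) (Fin M) A × Matrix (Fin K) (Fin K) A)}
    (hT : IsGraph φ μ e p T) {x : Matrix (Fin M) (Fin M) A} (hx : e * x * e = x) {ε : ℝ}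
    (hε : 0 < ε) : ∃ T', T ≤ T' ∧ IsGraph φ μ e p T' ∧ ∃ z ∈ T', ‖z.1 - x‖ < ε := by
  have htr := hT.trMat_eq hT.unit_mem
  obtain ⟨n, κ, _, l, l', c, w, q, w', q', hc, h1, h2, h3, h4, h5, rfl⟩ := hT
  obtain ⟨n₂, κ₂, _, c₂, w₂, q₂, hc₂, hS, hq0, hsub, y, hy, hyx⟩ := D.exists_refinement h1 hx hε
  obtain ⟨hp, -⟩ := h2.cls_eq
  obtain ⟨he, hecls⟩ := hS.cls_eq
  choose Y hY using fun k => H.fwd (cls (q₂ k))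
  obtain ⟨L, r, hr⟩ := exists_cls_eq_family Y
  have hpcls : cls p = ∑ i, cls (r (c₂ i)) := by
    refine H.sep _ _ fun j => ?_
    rw [vTrace_cls _ hp, htr, ← vTrace_cls _ he, hecls, map_sum, map_sum, Finset.mul_sum]
    exact Finset.sum_congr rfl fun i _ => by rw [(hr _).2, hY]
  obtain ⟨t, ht⟩ := exists_isSystem (fun k => (hr k).1) hp hpcls
  have hr0 : ∀ i, r i ≠ 0 := by
    intro i hi
    refine hq0 i (eq_zero_of_cls_eq_zero (hS.proj i) (H.sep _ _ fun j => ?_))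
    have h6 := hY i j
    rw [← (hr i).2, hi, cls_zero, map_zero] at h6
    rw [(mul_eq_zero.1 h6.symm).resolve_left (H.ne j), map_zero]
  have hrt : ∀ i j, trMat (φ j) (r i) = μ j * trMat (φ j) (q₂ i) := by
    intro i j
    rw [← vTrace_cls _ (hr i).1, (hr i).2, hY, vTrace_cls _ (hS.proj i)]
  have hG : IsGraph φ μ e p (Submodule.span ℂ (unitPairs c₂ w₂ t)) :=
    ⟨n₂, κ₂, inferInstance, M, L, c₂, w₂, q₂, t, r, hc₂, hS, ht, hq0, hr0, hrt, rfl⟩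
  -- `g` is the image of the old left system under the new graph; `u` moves it onto the old right
  -- system.
  obtain ⟨g, s, hg, hgT, hst⟩ := hG.exists_transport hc h1 fun i j hij =>
    exists_mem_span_unitPairs t (hsub ⟨i, j, hij, rfl⟩)
  obtain ⟨u, hu, hu', hug⟩ := hg.exists_conj h2 fun i =>
    (cls_eq_cls_iff (h2.proj i) (hg.proj i)).1 (H.cls_eq (h2.proj i) (hg.proj i) fun j => by
      rw [h5, hst])
  refine ⟨Submodule.span ℂ (unitPairs c₂ w₂ fun i => u * t i), ?_,
    ⟨n₂, κ₂, inferInstance, M, L, c₂, w₂, q₂, _, r, hc₂, hS, ht.conj hp hu hu', hq0, hr0, hrt, rfl⟩,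
    ?_⟩
  · have hconj : ∀ z ∈ Submodule.span ℂ (unitPairs c₂ w₂ t),
        (z.1, u * z.2 * uᴴ) ∈ Submodule.span ℂ (unitPairs c₂ w₂ fun i => u * t i) := by
      intro z hz
      induction hz using Submodule.span_induction with
      | mem z hz =>
        obtain ⟨i, j, hij, rfl⟩ := hz
        refine Submodule.subset_span ⟨i, j, hij, Prod.ext rfl ?_⟩
        simp only [Matrix.conjTranspose_mul, Matrix.mul_assoc]
      | zero =>
        rw [Prod.fst_zero, Prod.snd_zero, Matrix.mul_zero, Matrix.zero_mul]
        exact zero_mem _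
      | add a b _ _ ha hb =>
        rw [Prod.fst_add, Prod.snd_add, Matrix.mul_add, Matrix.add_mul]
        exact add_mem ha hb
      | smul r a _ ha =>
        rw [Prod.smul_fst, Prod.smul_snd, Matrix.mul_smul, Matrix.smul_mul]
        exact Submodule.smul_mem _ r ha
    rw [Submodule.span_le]
    rintro _ ⟨i, j, hij, rfl⟩
    rw [← hug i j hij]
    exact hconj _ (hgT i j hij)
  · obtain ⟨b, hb⟩ := exists_mem_span_unitPairs (fun i => u * t i) hy
    exact ⟨_, hb, hyx⟩

theorem IsGraph.exists_extension_snd (D : AFSystem A) (H : ScalesClasses φ μ) {M K : ℕ}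
    {e : Matrix (Fin M) (Fin M) A} {p : Matrix (Fin K) (Fin K) A}
    {T : Submodule ℂ (Matrix (Fin M) (Fin M) A × Matrix (Fin K) (Fin K) A)}
    (hT : IsGraph φ μ e p T) {x : Matrix (Fin K) (Fin K) A} (hx : p * x * p = x) {ε : ℝ}
    (hε : 0 < ε) : ∃ T', T ≤ T' ∧ IsGraph φ μ e p T' ∧ ∃ z ∈ T', ‖z.2 - x‖ < ε := by
  obtain ⟨T', h1, h2, z, hz, hzx⟩ := (hT.swap H.ne).exists_extension D H.symm hx hε
  have h3 := h2.swap H.symm.ne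
  simp only [inv_inv] at h3
  refine ⟨_, fun y hy => ?_, h3, z.swap, ⟨z, hz, rfl⟩, hzx⟩
  exact ⟨y.swap, h1 ⟨y, hy, rfl⟩, rfl⟩

end Extension

/-! ### Isometry of graphs and the initial graph -/

section GraphNorm

variable {A : Type u} [CStarAlgebra A]
variable {J : Type} {φ : J → traceSpace A} {μ : J → ℂ}
variable {m k : Type} [Fintype m] [Fintype k] [DecidableEq m] [DecidableEq k]
  {e : Matrix m m A} {p : Matrix k k A} {T : Submodule ℂ (Matrix m m A × Matrix k k A)}

theorem IsGraph.finiteDimensional (h : IsGraph φ μ e p T) : FiniteDimensional ℂ T := by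
  obtain ⟨n, κ, _, l, l', c, w, q, w', q', hc, h1, h2, h3, h4, h5, rfl⟩ := h
  refine FiniteDimensional.span_of_finite ℂ ?_
  refine (Set.finite_range fun ij : Fin n × Fin n =>
    ((w ij.1 * (w ij.2)ᴴ, w' ij.1 * (w' ij.2)ᴴ) : Matrix m m A × Matrix k k A)).subset ?_
  rintro _ ⟨i, j, -, rfl⟩
  exact ⟨(i, j), rfl⟩

/-- The finite-dimensional C*-algebra underlying a graph. -/
def IsGraph.subalgebra (h : IsGraph φ μ e p T) :
    NonUnitalStarSubalgebra ℂ (Matrix m m A × Matrix k k A) :=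
  { T with
    mul_mem' := h.mul_mem
    star_mem' := h.star_mem }

/-- `T` is a finite-dimensional, hence closed, *-subalgebra, and both coordinate projections are
injective *-homomorphisms on it, therefore isometric. -/
theorem IsGraph.norm_eq (h : IsGraph φ μ e p T) (hμ : ∀ j, μ j ≠ 0) {z} (hz : z ∈ T) :
    ‖z.1‖ = ‖z.2‖ := by
  have := h.finiteDimensional
  have hcl : IsClosed (h.subalgebra : Set (Matrix m m A × Matrix k k A)) :=
    Submodule.closed_of_finiteDimensional T
  let _ : NonUnitalCStarAlgebra h.subalgebra :=
    NonUnitalStarSubalgebra.nonUnitalCStarAlgebra h.subalgebra (h_closed := hcl)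
  let F₁ : h.subalgebra →⋆ₙₐ[ℂ] Matrix m m A :=
    (NonUnitalStarAlgHom.fst ℂ _ _).comp (NonUnitalStarSubalgebraClass.subtype h.subalgebra)
  let F₂ : h.subalgebra →⋆ₙₐ[ℂ] Matrix k k A :=
    (NonUnitalStarAlgHom.snd ℂ _ _).comp (NonUnitalStarSubalgebraClass.subtype h.subalgebra)
  have h1 : Function.Injective F₁ := by
    rw [injective_iff_map_eq_zero]
    intro x hx
    exact Subtype.ext (Prod.ext hx (h.snd_eq_zero x.2 hx))
  have h2 : Function.Injective F₂ := by
    rw [injective_iff_map_eq_zero]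
    intro x hx
    exact Subtype.ext (Prod.ext (h.fst_eq_zero hμ x.2 hx) hx)
  exact (NonUnitalStarAlgHom.norm_map F₁ h1 ⟨z, hz⟩).trans
    (NonUnitalStarAlgHom.norm_map F₂ h2 ⟨z, hz⟩).symm

/-- The one-dimensional graph spanned by `(e, p)`, where the back-and-forth starts. -/
theorem isGraph_of_isStarProjection {M K : ℕ} {e : Matrix (Fin M) (Fin M) A}
    {p : Matrix (Fin K) (Fin K) A} (he : IsStarProjection e) (hp : IsStarProjection p)
    (he0 : e ≠ 0) (hp0 : p ≠ 0) (h : ∀ j, trMat (φ j) p = μ j * trMat (φ j) e) :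
    ∃ T, IsGraph φ μ e p T := by
  have hs : ∀ {L : ℕ} {e : Matrix (Fin L) (Fin L) A}, IsStarProjection e →
      IsSystem (fun _ : Fin 1 => ()) (fun _ => e) (fun _ => e) e := by
    intro L e he
    obtain ⟨h1, h2⟩ := isStarProjection_iff_conj.1 he
    exact ⟨fun _ => he, fun i j => by rw [h2, h1, if_pos (Subsingleton.elim i j)],
      fun _ => h1, by simp [h2, h1]⟩
  exact ⟨_, 1, Unit, inferInstance, M, K, _, _, _, _, _, fun _ => ⟨0, rfl⟩, hs he, hs hp,
    fun _ => he0, fun _ => hp0, fun _ => h, rfl⟩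

end GraphNorm

/-! ### The limit isomorphism -/

section Limit

variable {N₁ N₂ : Type u} [CStarAlgebra N₁] [CStarAlgebra N₂]

/-- The closure of an increasing union of graphs of isometric `*`-isomorphisms is the graph of a
`*`-isomorphism onto a corner, provided that the projections of the union are dense. -/
theorem exists_starHom_of_graphs {p : N₂} {T : ℕ → Submodule ℂ (N₁ × N₂)} (hmono : Monotone T)
    (hmul : ∀ n, ∀ z ∈ T n, ∀ z' ∈ T n, z * z' ∈ T n) (hstar : ∀ n, ∀ z ∈ T n, star z ∈ T n)
    (hnorm : ∀ n, ∀ z ∈ T n, ‖z.1‖ = ‖z.2‖) (hcor : ∀ n, ∀ z ∈ T n, p * z.2 * p = z.2)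
    (h₁ : ∀ x : N₁, ∀ ε > 0, ∃ n, ∃ z ∈ T n, ‖z.1 - x‖ < ε)
    (h₂ : ∀ x : N₂, p * x * p = x → ∀ ε > 0, ∃ n, ∃ z ∈ T n, ‖z.2 - x‖ < ε) :
    ∃ Φ : N₁ →⋆ₙₐ[ℂ] N₂, Function.Injective Φ ∧ Set.range Φ = {x | p * x * p = x} ∧
      ∀ x, (x, Φ x) ∈ closure (⋃ n, (T n : Set (N₁ × N₂))) := by
  let S : Submodule ℂ (N₁ × N₂) := (⨆ n, T n).topologicalClosure
  have hS : (S : Set (N₁ × N₂)) = closure (⋃ n, (T n : Set (N₁ × N₂))) := by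
    rw [Submodule.topologicalClosure_coe, Submodule.coe_iSup_of_directed T hmono.directed_le]
  have hmem : ∀ {z}, z ∈ S ↔ z ∈ closure (⋃ n, (T n : Set (N₁ × N₂))) := by
    intro z
    rw [← hS]
    rfl
  have hle : ∀ {n z}, z ∈ T n → z ∈ S := fun {n z} hz =>
    hmem.2 (subset_closure (Set.mem_iUnion.2 ⟨n, hz⟩))
  have hSn : ∀ z ∈ S, ‖z.1‖ = ‖z.2‖ := by
    intro z hz
    refine closure_minimal (t := {z : N₁ × N₂ | ‖z.1‖ = ‖z.2‖}) ?_
      (isClosed_eq (by fun_prop) (by fun_prop)) (hmem.1 hz)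
    exact Set.iUnion_subset fun n z hz => hnorm n z hz
  have hSc : ∀ z ∈ S, p * z.2 * p = z.2 := by
    intro z hz
    refine closure_minimal (t := {z : N₁ × N₂ | p * z.2 * p = z.2}) ?_
      (isClosed_eq (by fun_prop) (by fun_prop)) (hmem.1 hz)
    exact Set.iUnion_subset fun n z hz => hcor n z hz
  have hSs : ∀ z ∈ S, star z ∈ S := by
    intro z hz
    refine hmem.2 (map_mem_closure continuous_star (hmem.1 hz) fun y hy => ?_)
    obtain ⟨n, hn⟩ := Set.mem_iUnion.1 hy
    exact Set.mem_iUnion.2 ⟨n, hstar n y hn⟩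
  have hSm : ∀ z ∈ S, ∀ z' ∈ S, z * z' ∈ S := by
    intro z hz z' hz'
    refine hmem.2 (map_mem_closure₂ continuous_mul (hmem.1 hz) (hmem.1 hz') fun y hy y' hy' => ?_)
    obtain ⟨n, hn⟩ := Set.mem_iUnion.1 hy
    obtain ⟨n', hn'⟩ := Set.mem_iUnion.1 hy'
    exact Set.mem_iUnion.2 ⟨max n n', hmul _ _ (hmono (le_max_left _ _) hn) _
      (hmono (le_max_right _ _) hn')⟩
  have hScl : IsClosed (S : Set (N₁ × N₂)) := Submodule.isClosed_topologicalClosure _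
  have : CompleteSpace S := hScl.completeSpace_coe
  let F₁ : S →ₗ[ℂ] N₁ := LinearMap.fst ℂ N₁ N₂ ∘ₗ S.subtype
  let F₂ : S →ₗ[ℂ] N₂ := LinearMap.snd ℂ N₁ N₂ ∘ₗ S.subtype
  -- An isometry on a complete space has closed range, so approximation by the graphs becomes
  -- surjectivity.
  have hF₁ : Isometry F₁ := AddMonoidHomClass.isometry_of_norm F₁ fun z => by
    change ‖z.1.1‖ = max ‖z.1.1‖ ‖z.1.2‖
    rw [← hSn z.1 z.2, max_self]
  have hF₂ : Isometry F₂ := AddMonoidHomClass.isometry_of_norm F₂ fun z => by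
    change ‖z.1.2‖ = max ‖z.1.1‖ ‖z.1.2‖
    rw [hSn z.1 z.2, max_self]
  have hs₁ : ∀ x : N₁, ∃ y, (x, y) ∈ S := by
    intro x
    have : x ∈ closure (Set.range F₁) := Metric.mem_closure_iff.2 fun ε hε => by
      obtain ⟨n, z, hz, hzx⟩ := h₁ x ε hε
      exact ⟨_, ⟨⟨z, hle hz⟩, rfl⟩, by rw [dist_comm, dist_eq_norm]; exact hzx⟩
    rw [hF₁.isClosedEmbedding.isClosed_range.closure_eq] at this
    obtain ⟨z, rfl⟩ := this
    exact ⟨z.1.2, z.2⟩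
  have hs₂ : ∀ y : N₂, p * y * p = y → ∃ x, (x, y) ∈ S := by
    intro y hy
    have : y ∈ closure (Set.range F₂) := Metric.mem_closure_iff.2 fun ε hε => by
      obtain ⟨n, z, hz, hzx⟩ := h₂ y hy ε hε
      exact ⟨_, ⟨⟨z, hle hz⟩, rfl⟩, by rw [dist_comm, dist_eq_norm]; exact hzx⟩
    rw [hF₂.isClosedEmbedding.isClosed_range.closure_eq] at this
    obtain ⟨z, rfl⟩ := this
    exact ⟨z.1.1, z.2⟩
  have hu₂ : ∀ {x y y'}, (x, y) ∈ S → (x, y') ∈ S → y = y' := by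
    intro x y y' h h'
    have := hSn _ (sub_mem h h')
    rw [Prod.fst_sub, Prod.snd_sub, sub_self, norm_zero] at this
    exact sub_eq_zero.1 (norm_eq_zero.1 this.symm)
  have hu₁ : ∀ {x x' y}, (x, y) ∈ S → (x', y) ∈ S → x = x' := by
    intro x x' y h h'
    have := hSn _ (sub_mem h h')
    rw [Prod.fst_sub, Prod.snd_sub, sub_self, norm_zero] at this
    exact sub_eq_zero.1 (norm_eq_zero.1 this)
  choose Φ hΦ using hs₁
  let Ψ : N₁ →⋆ₙₐ[ℂ] N₂ :=
    { toFun := Φ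
      map_smul' := fun r x => hu₂ (hΦ _) (S.smul_mem r (hΦ x))
      map_zero' := hu₂ (hΦ 0) S.zero_mem
      map_add' := fun x y => hu₂ (hΦ _) (S.add_mem (hΦ x) (hΦ y))
      map_mul' := fun x y => hu₂ (hΦ _) (hSm _ (hΦ x) _ (hΦ y))
      map_star' := fun x => hu₂ (hΦ _) (hSs _ (hΦ x)) }
  refine ⟨Ψ, fun x x' h => hu₁ (hΦ x) ?_, Set.ext fun y => ⟨?_, fun hy => ?_⟩,
    fun x => hmem.1 (hΦ x)⟩
  · have := hΦ x'
    rwa [show Φ x' = Φ x from h.symm] at this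
  · rintro ⟨x, rfl⟩
    exact hSc _ (hΦ x)
  · obtain ⟨x, hx⟩ := hs₂ y hy
    exact ⟨x, hu₂ (hΦ x) hx⟩

theorem AFSystem.separableSpace {A : Type u} [CStarAlgebra A] (D : AFSystem A) :
    TopologicalSpace.SeparableSpace A := by
  have h1 : ∀ n, TopologicalSpace.IsSeparable (Set.range (D.f n)) := fun n => by
    have : ProperSpace (D.B n) := FiniteDimensional.proper ℂ (D.B n)
    exact TopologicalSpace.isSeparable_range (NonUnitalStarAlgHom.isometry (D.f n) (D.inj n)).continuous
  have h2 := (TopologicalSpace.IsSeparable.iUnion h1).closure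
  rw [D.dense.closure_eq] at h2
  exact TopologicalSpace.isSeparable_univ_iff.1 h2

theorem norm_corner_le {p : N₁} (hp : IsStarProjection p) (x : N₁) : ‖p * x * p‖ ≤ ‖x‖ := by
  calc ‖p * x * p‖ ≤ ‖p‖ * ‖x‖ * ‖p‖ :=
        (norm_mul_le _ _).trans (by gcongr; exact norm_mul_le _ _)
    _ ≤ 1 * ‖x‖ * 1 := by gcongr <;> exact hp.norm_le
    _ = ‖x‖ := by ring

end Limit

/-! ### Back-and-forth construction of the corner isomorphism -/

section Corner

variable {A : Type u} [CStarAlgebra A]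
variable {J : Type} {φ : J → traceSpace A} {μ : J → ℂ}

/-- Elliott's back-and-forth argument. -/
theorem AFSystem.exists_starHom_matrix (D : AFSystem A) (H : ScalesClasses φ μ) {M K : ℕ}
    {p : Matrix (Fin K) (Fin K) A}
    {T : Submodule ℂ (Matrix (Fin M) (Fin M) A × Matrix (Fin K) (Fin K) A)}
    (hT : IsGraph φ μ 1 p T) :
    ∃ Φ : Matrix (Fin M) (Fin M) A →⋆ₙₐ[ℂ] Matrix (Fin K) (Fin K) A,
      Function.Injective Φ ∧ Set.range Φ = {x | p * x * p = x} ∧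
      ∀ j x, trMat (φ j) (Φ x) = μ j * trMat (φ j) x := by
  have hp : IsStarProjection p := by
    obtain ⟨n, κ, _, l, l', c, w, q, w', q', hc, h1, h2, -⟩ := hT
    exact h2.cls_eq.1
  have := D.separableSpace
  have : TopologicalSpace.SeparableSpace (Matrix (Fin M) (Fin M) A) :=
    inferInstanceAs (TopologicalSpace.SeparableSpace (Fin M → Fin M → A))
  have : TopologicalSpace.SeparableSpace (Matrix (Fin K) (Fin K) A) :=
    inferInstanceAs (TopologicalSpace.SeparableSpace (Fin K → Fin K → A))
  let a := TopologicalSpace.denseSeq (Matrix (Fin M) (Fin M) A)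
  let b := TopologicalSpace.denseSeq (Matrix (Fin K) (Fin K) A)
  -- Indexing by `n.unpair.1` visits each member of the dense sequences infinitely often while the
  -- tolerance `1/(n+1)` tends to zero.
  have hstep : ∀ (n : ℕ) (T : {T // IsGraph φ μ (1 : Matrix (Fin M) (Fin M) A) p T}),
      ∃ T' : {T // IsGraph φ μ (1 : Matrix (Fin M) (Fin M) A) p T}, T.1 ≤ T'.1 ∧
        (∃ z ∈ T'.1, ‖z.1 - a n.unpair.1‖ < 1 / ((n : ℝ) + 1)) ∧
        ∃ z ∈ T'.1, ‖z.2 - p * b n.unpair.1 * p‖ < 1 / ((n : ℝ) + 1) := by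
    rintro n ⟨T, hT⟩
    obtain ⟨T₁, hle₁, hT₁, z, hz, hza⟩ := hT.exists_extension D H (x := a n.unpair.1) (by simp)
      (Nat.one_div_pos_of_nat (α := ℝ) (n := n))
    obtain ⟨T₂, hle₂, hT₂, z', hz', hzb⟩ := hT₁.exists_extension_snd D H
      (x := p * b n.unpair.1 * p)
      (by rw [← mul_assoc, ← mul_assoc, hp.1, mul_assoc, hp.1])
      (Nat.one_div_pos_of_nat (α := ℝ) (n := n))
    exact ⟨⟨T₂, hT₂⟩, hle₁.trans hle₂, ⟨z, hle₂ hz, hza⟩, z', hz', hzb⟩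
  choose G hG₁ hG₂ hG₃ using hstep
  let U : ℕ → {T // IsGraph φ μ (1 : Matrix (Fin M) (Fin M) A) p T} :=
    fun n => Nat.rec ⟨T, hT⟩ (fun n T => G n T) n
  have hmono : Monotone fun n => (U n).1 := monotone_nat_of_le_succ fun n => hG₁ n (U n)
  have hexists : ∀ (i : ℕ) (ε : ℝ), 0 < ε → ∃ n : ℕ, n.unpair.1 = i ∧ 1 / ((n : ℝ) + 1) < ε := by
    intro i ε hε
    obtain ⟨k, hk⟩ := exists_nat_one_div_lt hε
    refine ⟨Nat.pair i k, by rw [Nat.unpair_pair], lt_of_le_of_lt ?_ hk⟩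
    have : (k : ℝ) ≤ (Nat.pair i k : ℕ) := by exact_mod_cast Nat.right_le_pair i k
    exact one_div_le_one_div_of_le (by positivity) (by linarith)
  obtain ⟨Φ, h1, h2, h3⟩ := exists_starHom_of_graphs (p := p) (T := fun n => (U n).1) hmono
    (fun n z hz z' hz' => (U n).2.mul_mem hz hz') (fun n z hz => (U n).2.star_mem hz)
    (fun n z hz => (U n).2.norm_eq H.ne hz) (fun n z hz => ((U n).2.corner hz).2)
    (fun x ε hε => by
      obtain ⟨_, hi, i, rfl⟩ := Metric.dense_iff.1
        (TopologicalSpace.denseRange_denseSeq (Matrix (Fin M) (Fin M) A)) x (ε / 2) (half_pos hε)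
      obtain ⟨n, hn, hne⟩ := hexists i (ε / 2) (half_pos hε)
      obtain ⟨z, hz, hza⟩ := hG₂ n (U n)
      refine ⟨n + 1, z, hz, ?_⟩
      have hx : ‖a i - x‖ < ε / 2 := by rw [← dist_eq_norm]; exact hi
      rw [hn] at hza
      calc ‖z.1 - x‖ = ‖(z.1 - a i) + (a i - x)‖ := by rw [sub_add_sub_cancel]
        _ ≤ ‖z.1 - a i‖ + ‖a i - x‖ := norm_add_le _ _
        _ < ε := by linarith)
    (fun x hx ε hε => by
      obtain ⟨_, hi, i, rfl⟩ := Metric.dense_iff.1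
        (TopologicalSpace.denseRange_denseSeq (Matrix (Fin K) (Fin K) A)) x (ε / 2) (half_pos hε)
      obtain ⟨n, hn, hne⟩ := hexists i (ε / 2) (half_pos hε)
      obtain ⟨z, hz, hzb⟩ := hG₃ n (U n)
      refine ⟨n + 1, z, hz, ?_⟩
      have hx' : ‖b i - x‖ < ε / 2 := by rw [← dist_eq_norm]; exact hi
      rw [hn] at hzb
      have h4 := norm_corner_le hp (b i - x)
      rw [mul_sub, sub_mul, hx] at h4
      calc ‖z.2 - x‖ = ‖(z.2 - p * b i * p) + (p * b i * p - x)‖ := by rw [sub_add_sub_cancel]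
        _ ≤ ‖z.2 - p * b i * p‖ + ‖p * b i * p - x‖ := norm_add_le _ _
        _ < ε := by linarith)
  refine ⟨Φ, h1, h2, fun j x => ?_⟩
  have hcont : ∀ {L : ℕ}, Continuous fun y : Matrix (Fin L) (Fin L) A => trMat (φ j) y := by
    intro L
    unfold trMat
    exact continuous_finsetSum _ fun i _ => (φ j).1.continuous.comp (by fun_prop)
  refine closure_minimal (t := {z : Matrix (Fin M) (Fin M) A × Matrix (Fin K) (Fin K) A |
    trMat (φ j) z.2 = μ j * trMat (φ j) z.1}) ?_ (isClosed_eq (hcont.comp continuous_snd)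
    (continuous_const.mul (hcont.comp continuous_fst))) (h3 x)
  exact Set.iUnion_subset fun n z hz => (U n).2.trMat_eq hz j

/-- A projection whose trace values match the scaling is the image of the unit under an
isomorphism onto its corner that scales the traces. -/
theorem AFSystem.exists_starHom_corner (D : AFSystem A) (H : ScalesClasses φ μ) {K : ℕ}
    {p : Matrix (Fin K) (Fin K) A} (hp : IsStarProjection p) (hJ : ∃ j, (φ j).1 1 ≠ 0)
    (hpt : ∀ j, trMat (φ j) p = μ j * (φ j).1 1) :
    ∃ Φ : A →⋆ₙₐ[ℂ] Matrix (Fin K) (Fin K) A,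
      Function.Injective Φ ∧ Set.range Φ = {x | p * x * p = x} ∧
      ∀ j x, trMat (φ j) (Φ x) = μ j * (φ j).1 x := by
  obtain ⟨j, hj⟩ := hJ
  have htr1 : ∀ j, trMat (φ j) (1 : Matrix (Fin 1) (Fin 1) A) = (φ j).1 1 := fun j => by
    simp [trMat]
  obtain ⟨T, hT⟩ := isGraph_of_isStarProjection (φ := φ) (μ := μ)
    (e := (1 : Matrix (Fin 1) (Fin 1) A)) (IsStarProjection.one _) hp
    (by
      intro h
      rw [← htr1, h] at hj
      exact hj (by simp [trMat]))
    (by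
      rintro rfl
      refine mul_ne_zero (H.ne j) hj ?_
      rw [← hpt]
      simp [trMat])
    (fun j => by rw [htr1, hpt])
  obtain ⟨Φ, h1, h2, h3⟩ := D.exists_starHom_matrix H hT
  let F : A →⋆ₙₐ[ℂ] Matrix (Fin 1) (Fin 1) A :=
    { toFun := fun x => Matrix.of fun _ _ => x
      map_smul' := fun _ _ => rfl
      map_zero' := rfl
      map_add' := fun _ _ => rfl
      map_mul' := fun x y => by ext i j; simp [Matrix.mul_apply]
      map_star' := fun _ => rfl }
  have hF : Function.Bijective F := by
    refine ⟨fun x y h => congrFun (congrFun h 0) 0, fun x => ⟨x 0 0, ?_⟩⟩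
    ext i j
    rw [Subsingleton.elim i 0, Subsingleton.elim j 0]
    rfl
  refine ⟨Φ.comp F, h1.comp hF.1, ?_, fun j x => ?_⟩
  · rw [← h2]
    exact hF.2.range_comp Φ
  · refine (h3 j (F x)).trans ?_
    congr 1
    exact Fin.sum_univ_one _

end Corner

/-! ### Invariant subgroups of the plane -/

section Plane

variable {G : AddSubgroup (Fin 2 → ℝ)}

theorem diag_mulVec (c d : ℝ) (v : Fin 2 → ℝ) :
    !![c, 0; 0, d] *ᵥ v = ![c * v 0, d * v 1] := by
  ext i
  fin_cases i <;> simp [Matrix.mulVec, dotProduct]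

theorem isInvariant_diag_iff {c d : ℝ} (hc : c ≠ 0) (hd : d ≠ 0) :
    IsInvariant !![c, 0; 0, d] G ↔
      (∀ v ∈ G, ![c * v 0, d * v 1] ∈ G) ∧ ∀ v ∈ G, ![c⁻¹ * v 0, d⁻¹ * v 1] ∈ G := by
  have hinv : ∀ v : Fin 2 → ℝ, ![c⁻¹ * (c * v 0), d⁻¹ * (d * v 1)] = v := by
    intro v
    rw [inv_mul_cancel_left₀ hc, inv_mul_cancel_left₀ hd]
    exact (List.ofFn_inj.1 rfl)
  constructor
  · intro h
    refine ⟨fun v hv => ?_, fun v hv => ?_⟩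
    · have : !![c, 0; 0, d] *ᵥ v ∈ (G : Set (Fin 2 → ℝ)) := h ▸ Set.mem_image_of_mem _ hv
      rwa [diag_mulVec] at this
    · have hv' : v ∈ (G : Set (Fin 2 → ℝ)) := hv
      rw [← h] at hv'
      obtain ⟨w, hw, rfl⟩ := hv'
      simp only [diag_mulVec]
      exact (hinv w).symm ▸ hw
  · rintro ⟨h1, h2⟩
    refine Set.Subset.antisymm ?_ fun v hv => ⟨_, h2 v hv, ?_⟩
    · rintro _ ⟨v, hv, rfl⟩
      simp only [diag_mulVec]
      exact h1 v hv
    · simp only [diag_mulVec]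
      change ![c * (c⁻¹ * v 0), d * (d⁻¹ * v 1)] = v
      rw [mul_inv_cancel_left₀ hc, mul_inv_cancel_left₀ hd]
      exact (List.ofFn_inj.1 rfl)

/-- The scalars `r` such that `diag(0, r)` maps `G` to `G`. -/
def secondScalars (G : AddSubgroup (Fin 2 → ℝ)) : AddSubgroup ℝ where
  carrier := {r | ∀ v ∈ G, ![0, r * v 1] ∈ G}
  add_mem' {r s} hr hs v hv := by
    have := G.add_mem (hr v hv) (hs v hv)
    convert this using 1
    ext i
    fin_cases i <;> simp [add_mul]
  zero_mem' v hv := by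
    convert G.zero_mem using 1
    ext i
    fin_cases i <;> simp
  neg_mem' {r} hr v hv := by
    have := G.neg_mem (hr v hv)
    convert this using 1
    ext i
    fin_cases i <;> simp

theorem zpow_mem_of_isInvariant {a b : ℝ} (ha : a ≠ 0) (hb : b ≠ 0)
    (h : IsInvariant !![a, 0; 0, b] G) (n : ℤ) {v : Fin 2 → ℝ} (hv : v ∈ G) :
    ![a ^ n * v 0, b ^ n * v 1] ∈ G := by
  obtain ⟨h1, h2⟩ := (isInvariant_diag_iff ha hb).1 h
  induction n using Int.induction_on with
  | zero =>
    convert hv using 1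
    ext i
    fin_cases i <;> simp
  | succ n ih =>
    have := h1 _ ih
    convert this using 1
    ext i
    fin_cases i <;> simp [zpow_add_one₀ ha, zpow_add_one₀ hb] <;> ring
  | pred n ih =>
    have := h2 _ ih
    convert this using 1
    ext i
    fin_cases i <;> simp [zpow_sub_one₀ ha, zpow_sub_one₀ hb] <;> ring

theorem diagPowers_subset {a b : ℝ} (ha : 0 < a) (hb : 0 < b)
    (h : IsInvariant !![a, 0; 0, b] G) : diagPowers a b ⊆ invarianceGroup G := by
  rintro _ ⟨n, rfl⟩
  refine ⟨⟨a ^ n, b ^ n, zpow_pos ha n, zpow_pos hb n, Or.inl rfl⟩,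
    (isInvariant_diag_iff (zpow_pos ha n).ne' (zpow_pos hb n).ne').2
      ⟨fun v hv => zpow_mem_of_isInvariant ha.ne' hb.ne' h n hv, fun v hv => ?_⟩⟩
  rw [← zpow_neg, ← zpow_neg]
  exact zpow_mem_of_isInvariant ha.ne' hb.ne' h (-n) hv

theorem aeval_mem_of_isInvariant {a b : ℝ} (ha : a ≠ 0) (hb : b ≠ 0)
    (h : IsInvariant !![a, 0; 0, b] G) (F : Polynomial ℤ) {v : Fin 2 → ℝ} (hv : v ∈ G) :
    ![Polynomial.aeval a F * v 0, Polynomial.aeval b F * v 1] ∈ G := by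
  induction F using Polynomial.induction_on' with
  | add p q hp hq =>
    convert G.add_mem hp hq using 1
    ext i
    fin_cases i <;> simp [add_mul]
  | monomial n c =>
    convert G.zsmul_mem (zpow_mem_of_isInvariant ha hb h n hv) c using 1
    ext i
    fin_cases i <;> simp [Polynomial.aeval_monomial, mul_assoc]

/-- The minimal polynomial of `a` is irreducible over `ℚ`, so a rational root would equal `a`;
clearing denominators makes it integral. -/
theorem exists_int_polynomial {a : ℝ} {b : ℚ} (ha : IsAlgebraic ℚ a) (hab : a ≠ (b : ℝ)) :
    ∃ F : Polynomial ℤ, Polynomial.aeval a F = 0 ∧ Polynomial.aeval b F ≠ 0 := by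
  have hb : (minpoly ℚ a).eval b ≠ 0 := fun h =>
    hab (minpoly.root ha.isIntegral (y := b) h).symm
  obtain ⟨c, hc, hF⟩ := IsLocalization.integerNormalization_spec (nonZeroDivisors ℤ) (minpoly ℚ a)
  refine ⟨IsLocalization.integerNormalization (nonZeroDivisors ℤ) (minpoly ℚ a), ?_, ?_⟩
  · rw [← Polynomial.aeval_map_algebraMap ℚ, hF, map_zsmul, minpoly.aeval, smul_zero]
  · rw [← Polynomial.aeval_map_algebraMap ℚ, hF, map_zsmul, Polynomial.coe_aeval_eq_eval]
    exact smul_ne_zero (nonZeroDivisors.ne_zero hc) hb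

/-- Take the least positive integer `N` in `H`. A prime `p` dividing both `N` and `R = pS` would put
the smaller `N/p = S (N/R)` into `H`. -/
theorem exists_nat_scalar {H : AddSubgroup ℝ} {P Q : ℕ} (hP : 0 < P) (hQ : 0 < Q)
    (hPH : ∀ r ∈ H, r / P ∈ H) (hQH : ∀ r ∈ H, r / Q ∈ H) {N₀ : ℕ} (hN₀ : 0 < N₀)
    (hN₀H : (N₀ : ℝ) ∈ H) :
    ∃ N : ℕ, 0 < N ∧ (N : ℝ) ∈ H ∧ N.Coprime P ∧ N.Coprime Q := by
  classical
  have hex : ∃ N : ℕ, 0 < N ∧ (N : ℝ) ∈ H := ⟨N₀, hN₀, hN₀H⟩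
  obtain ⟨h1, h2⟩ := Nat.find_spec hex
  have key : ∀ R : ℕ, 0 < R → (∀ r ∈ H, r / R ∈ H) → (Nat.find hex).Coprime R := by
    intro R hR hRH
    refine Nat.coprime_of_dvd fun p hp hpN hpR => ?_
    obtain ⟨M, hM⟩ := hpN
    obtain ⟨S, rfl⟩ := hpR
    have hM0 : 0 < M := Nat.pos_of_ne_zero fun h => by rw [hM, h, mul_zero] at h1; exact h1.ne rfl
    have hS0 : 0 < S := Nat.pos_of_ne_zero fun h => by rw [h, mul_zero] at hR; exact hR.ne rfl
    refine Nat.find_min hex (m := M) ?_ ⟨hM0, ?_⟩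
    · rw [hM]
      nlinarith [hp.two_le]
    · have h3 := H.nsmul_mem (hRH _ h2) S
      convert h3 using 1
      have hp0 : (p : ℝ) ≠ 0 := by exact_mod_cast hp.ne_zero
      have hS0' : (S : ℝ) ≠ 0 := by exact_mod_cast hS0.ne'
      rw [hM, nsmul_eq_mul]
      push_cast
      field_simp
  exact ⟨_, h1, h2, key P hP hPH, key Q hQ hQH⟩

/-- With a Bézout relation `1 = P x + Q y`, one has `r/Q = x (P/Q) r + y r`. -/
theorem div_mem_of_coprime {H : AddSubgroup ℝ} {P Q : ℕ} (hQ : 0 < Q)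
    (hco : P.Coprime Q) (h : ∀ r ∈ H, (P / Q : ℝ) * r ∈ H) {r : ℝ} (hr : r ∈ H) : r / Q ∈ H := by
  have hb := Nat.gcd_eq_gcd_ab P Q
  rw [hco.gcd_eq_one] at hb
  have h1 := H.add_mem (H.zsmul_mem (h r hr) (P.gcdA Q)) (H.zsmul_mem hr (P.gcdB Q))
  convert h1 using 1
  have hb' : (1 : ℝ) = P * P.gcdA Q + Q * P.gcdB Q := by exact_mod_cast hb
  have hQ0 : (Q : ℝ) ≠ 0 := by exact_mod_cast hQ.ne'
  rw [zsmul_eq_mul, zsmul_eq_mul]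
  field_simp
  linear_combination r * hb'

theorem exists_isInvariant_nat {a : ℝ} {b : ℚ} (ha : 0 < a) (hb : 0 < b)
    (ha_alg : IsAlgebraic ℚ a) (hab : a ≠ (b : ℝ)) (hb1 : b ≠ 1)
    (h : IsInvariant !![a, 0; 0, (b : ℝ)] G) :
    ∃ t : ℕ, 1 < t ∧ IsInvariant !![1, 0; 0, (t : ℝ)] G := by
  have hbR : (0 : ℝ) < b := by exact_mod_cast hb
  obtain ⟨h1, h2⟩ := (isInvariant_diag_iff ha.ne' hbR.ne').1 h
  obtain ⟨F, hFa, hFb⟩ := exists_int_polynomial ha_alg hab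
  set H := secondScalars G with hH
  have hmul : ∀ r ∈ H, (b : ℝ) * r ∈ H := by
    intro r hr v hv
    convert h1 _ (hr v hv) using 1
    ext i
    fin_cases i <;> simp [mul_assoc]
  have hdiv : ∀ r ∈ H, (b : ℝ)⁻¹ * r ∈ H := by
    intro r hr v hv
    convert h2 _ (hr v hv) using 1
    ext i
    fin_cases i <;> simp [mul_assoc]
  obtain ⟨P, hP⟩ : ∃ P : ℕ, (P : ℤ) = b.num := ⟨b.num.toNat, Int.toNat_of_nonneg (Rat.num_pos.2 hb).le⟩
  have hP0 : 0 < P := by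
    have := Rat.num_pos.2 hb
    omega
  have hQ0 : 0 < b.den := b.den_pos
  have hco : P.Coprime b.den := by
    have := b.reduced
    rwa [← hP, Int.natAbs_natCast] at this
  have hbPQ : (b : ℝ) = P / b.den := by
    have : (b : ℝ) = (b.num : ℝ) / b.den := by exact_mod_cast (Rat.num_div_den b).symm
    rw [this, ← hP, Int.cast_natCast]
  have hbQP : (b : ℝ)⁻¹ = b.den / P := by rw [hbPQ, inv_div]
  have hQH : ∀ r ∈ H, r / b.den ∈ H := fun r hr =>
    div_mem_of_coprime hQ0 hco (fun r hr => hbPQ ▸ hmul r hr) hr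
  have hPH : ∀ r ∈ H, r / P ∈ H := fun r hr =>
    div_mem_of_coprime hP0 hco.symm (fun r hr => hbQP ▸ hdiv r hr) hr
  -- `F(A) = diag(F(a), F(b)) = diag(0, F(b))` preserves `G`.
  have hFH : ((Polynomial.aeval b F : ℚ) : ℝ) ∈ H := by
    intro v hv
    have := aeval_mem_of_isInvariant ha.ne' hbR.ne' h F hv
    rw [hFa, zero_mul] at this
    have e : Polynomial.aeval (b : ℝ) F = ((Polynomial.aeval b F : ℚ) : ℝ) :=
      Polynomial.aeval_algebraMap_apply ℝ b F
    rwa [e] at this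
  obtain ⟨N₀, hN₀, hN₀H⟩ : ∃ N₀ : ℕ, 0 < N₀ ∧ (N₀ : ℝ) ∈ H := by
    set q : ℚ := Polynomial.aeval b F
    refine ⟨q.num.natAbs, Int.natAbs_pos.2 (Rat.num_ne_zero.2 hFb), ?_⟩
    have h3 : ((q.num : ℤ) : ℝ) ∈ H := by
      have h4 := H.nsmul_mem hFH q.den
      rw [nsmul_eq_mul] at h4
      have h5 : (q.den : ℝ) * (q : ℝ) = q.num := by exact_mod_cast Rat.den_mul_eq_num q
      rwa [h5] at h4
    rcases Int.natAbs_eq q.num with h6 | h6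
    · rw [h6, Int.cast_natCast] at h3
      exact h3
    · rw [h6, Int.cast_neg, Int.cast_natCast] at h3
      simpa using H.neg_mem h3
  obtain ⟨N, hN0, hNH, hNP, hNQ⟩ := exists_nat_scalar hP0 hQ0 hPH hQH hN₀ hN₀H
  obtain ⟨R, hR1, hRN, hRH⟩ : ∃ R : ℕ, 1 < R ∧ N.Coprime R ∧ ∀ r ∈ H, r / R ∈ H := by
    by_cases hP1 : 1 < P
    · exact ⟨P, hP1, hNP, hPH⟩
    by_cases hQ1 : 1 < b.den
    · exact ⟨b.den, hQ1, hNQ, hQH⟩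
    refine absurd ?_ hb1
    have e1 : P = 1 := by omega
    have e2 : b.den = 1 := by omega
    rw [e1, e2] at hbPQ
    have : (b : ℝ) = 1 := by rw [hbPQ]; norm_num
    exact_mod_cast this
  have hphi : N.totient ≠ 0 := (Nat.totient_pos.2 hN0).ne'
  have hpow : ∀ (k : ℕ), ∀ r ∈ H, r / (R : ℝ) ^ k ∈ H := by
    intro k
    induction k with
    | zero => intro r hr; simpa using hr
    | succ k ih => intro r hr; rw [pow_succ, ← div_div]; exact hRH _ (ih r hr)
  have ht1 : 1 < R ^ N.totient := Nat.one_lt_pow hphi hR1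
  -- Euler's theorem; the witness is `t = R ^ φ(N)`. Choosing a power of `R` also keeps `(t - 1)/t`
  -- in `H`, which gives the inverse of `diag(1, t)`.
  have hmod : N ∣ R ^ N.totient - 1 :=
    (Nat.modEq_iff_dvd' ht1.le).1 (Nat.ModEq.pow_totient hRN.symm).symm
  obtain ⟨s, hs⟩ := hmod
  have htH : ((R ^ N.totient : ℕ) : ℝ) - 1 ∈ H := by
    have h3 := H.nsmul_mem hNH s
    convert h3 using 1
    rw [nsmul_eq_mul, ← Nat.cast_one, ← Nat.cast_sub ht1.le, hs]
    push_cast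
    ring
  refine ⟨R ^ N.totient, ht1, (isInvariant_diag_iff one_ne_zero
    (by exact_mod_cast (zero_lt_one.trans ht1).ne')).2 ⟨fun v hv => ?_, fun v hv => ?_⟩⟩
  · convert G.add_mem hv (htH v hv) using 1
    ext i
    fin_cases i <;> simp
    ring
  · convert G.sub_mem hv (hpow N.totient _ htH v hv) using 1
    have : (R : ℝ) ≠ 0 := by exact_mod_cast (zero_lt_one.trans hR1).ne'
    ext i
    fin_cases i <;> simp
    field_simp
    ring

theorem diag_one_notMem_diagPowers {a b : ℝ} {t : ℕ} (ha : 0 < a) (ha1 : a ≠ 1) (ht : 1 < t) :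
    !![1, 0; 0, (t : ℝ)] ∉ diagPowers a b := by
  rintro ⟨n, hn⟩
  have h1 : (1 : ℝ) = a ^ n := congrFun (congrFun hn 0) 0
  have h2 : (t : ℝ) = b ^ n := congrFun (congrFun hn 1) 1
  have h3 : n = 0 := (zpow_eq_one_iff_right₀ ha.le ha1).1 h1.symm
  rw [h3, zpow_zero] at h2
  exact ht.ne' (by exact_mod_cast h2)

theorem diagPowers_ssubset {a : ℝ} {b : ℚ} (ha : 0 < a) (hb : 0 < b)
    (ha_alg : IsAlgebraic ℚ a) (hab : a ≠ (b : ℝ)) (ha1 : a ≠ 1) (hb1 : b ≠ 1)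
    (h : IsInvariant !![a, 0; 0, (b : ℝ)] G) : diagPowers a b ⊂ invarianceGroup G := by
  obtain ⟨t, ht, hG⟩ := exists_isInvariant_nat ha hb ha_alg hab hb1 h
  refine (Set.ssubset_iff_of_subset (diagPowers_subset ha (by exact_mod_cast hb) h)).2
    ⟨_, ⟨⟨1, t, one_pos, ?_, Or.inl rfl⟩, hG⟩, diag_one_notMem_diagPowers ha ha1 ht⟩
  exact_mod_cast zero_lt_one.trans ht

end Plane

/-! ### Trace values of classes -/

section Values

variable {A : Type u} [CStarAlgebra A]

theorem vTrace_nonneg {τ : traceSpace A} (hτ : τ ∈ tracialStates A) (x : MvNMonoid A) :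
    0 ≤ vTrace τ x := by
  obtain ⟨p, rfl⟩ := exists_cls_eq x
  obtain ⟨h1, h2⟩ := isStarProjection_iff_conj.1 p.2.2
  rw [vTrace_cls _ p.2.2, ← h1]
  conv_rhs => rw [← h2]
  simp only [h2, trMat]
  refine Finset.sum_nonneg fun i _ => ?_
  have : (p.2.1 * p.2.1) i i = ∑ j, star (p.2.1 j i) * p.2.1 j i := by
    rw [Matrix.mul_apply]
    refine Finset.sum_congr rfl fun j _ => ?_
    conv_lhs => rw [← h2]
    rw [Matrix.conjTranspose_apply, h2]
  rw [this, map_sum]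
  exact Finset.sum_nonneg fun j _ => hτ.1 _

theorem gammaMonoid_apply {n : ℕ} (φ : Fin n → traceSpace A) (x : MvNMonoid A) (i : Fin n) :
    gammaMonoid φ x i = (vTrace (φ i) x).re := by
  obtain ⟨p, rfl⟩ := Quotient.exists_rep x
  rfl

theorem gammaMonoid_nonneg {n : ℕ} {φ : Fin n → traceSpace A} (h : EnumeratesExtremeTraces φ)
    (x : MvNMonoid A) (i : Fin n) : 0 ≤ gammaMonoid φ x i := by
  rw [gammaMonoid_apply]
  exact (Complex.nonneg_iff.1 (vTrace_nonneg (h.mem i) x)).1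

theorem vTrace_eq_gammaMonoid {n : ℕ} {φ : Fin n → traceSpace A} (h : EnumeratesExtremeTraces φ)
    (x : MvNMonoid A) (i : Fin n) : vTrace (φ i) x = (gammaMonoid φ x i : ℂ) := by
  rw [gammaMonoid_apply]
  exact Complex.ext rfl (Complex.nonneg_iff.1 (vTrace_nonneg (h.mem i) x)).2.symm

theorem Gamma_of {n : ℕ} (φ : Fin n → traceSpace A) (x : MvNMonoid A) :
    Gamma φ (Algebra.GrothendieckAddGroup.of x) = gammaMonoid φ x :=
  DFunLike.congr_fun (Algebra.GrothendieckAddGroup.lift.symm_apply_apply (gammaMonoid φ)) x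

theorem mem_range_Gamma_iff {n : ℕ} {φ : Fin n → traceSpace A} {v : Fin n → ℝ} :
    v ∈ (Gamma φ).range ↔ ∃ x y, v = gammaMonoid φ x - gammaMonoid φ y := by
  constructor
  · rintro ⟨z, rfl⟩
    exact ⟨_, _, Algebra.GrothendieckAddGroup.lift_apply _ z⟩
  · rintro ⟨x, y, rfl⟩
    exact ⟨Algebra.GrothendieckAddGroup.of x - Algebra.GrothendieckAddGroup.of y, by
      rw [map_sub, Gamma_of, Gamma_of]⟩

/-- Cancellation embeds `V(A)` into `K₀(A)`, so injectivity of `Γ` descends to classes. -/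
theorem gammaMonoid_injective (D : AFSystem A) {n : ℕ} {φ : Fin n → traceSpace A}
    (h : Function.Injective (Gamma φ)) : Function.Injective (gammaMonoid φ) := by
  have : IsCancelAdd (MvNMonoid A) :=
    { add_left_cancel := fun x y z hxyz => D.v_add_right_cancel (z := x) (by
        rw [add_comm y, add_comm z]; exact hxyz)
      add_right_cancel := fun x y z hxyz => D.v_add_right_cancel hxyz }
  intro x y hxy
  rw [← Gamma_of, ← Gamma_of] at hxy
  exact Algebra.GrothendieckAddGroup.of_injective (h hxy)

/-- Write `v` as a difference of two classes: strict positivity says that the first dominates the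
second on every extreme trace, so the difference is itself a class. -/
theorem exists_gammaMonoid_eq (D : AFSystem A) [FiniteDimensional ℂ (traceSpace A)] {n : ℕ}
    {φ : Fin n → traceSpace A} (h : EnumeratesExtremeTraces φ) {v : Fin n → ℝ}
    (hv : v ∈ (Gamma φ).range) (hpos : ∀ i, 0 < v i) : ∃ x, gammaMonoid φ x = v := by
  obtain ⟨x, y, rfl⟩ := mem_range_Gamma_iff.1 hv
  obtain ⟨r, rfl⟩ := D.exists_eq_add_of_trace_lt h (x := x) (y := y) fun i => by
    rw [← gammaMonoid_apply, ← gammaMonoid_apply]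
    exact sub_pos.1 (hpos i)
  exact ⟨r, by rw [map_add, add_sub_cancel_left]⟩

end Values

/-! ### Action of the fundamental group on trace values -/

section Amplification

variable {A : Type u} [CStarAlgebra A]

/-- A `*`-homomorphism into matrices that scales traces acts on classes. -/
theorem exists_vTrace_eq_mul {J : Type} {φ : J → traceSpace A} {μ : J → ℂ} {k : ℕ}
    (Φ : A →⋆ₙₐ[ℂ] Matrix (Fin k) (Fin k) A)
    (hΦ : ∀ j x, trMat (φ j) (Φ x) = μ j * (φ j).1 x) (x : MvNMonoid A) :
    ∃ y, ∀ j, vTrace (φ j) y = μ j * vTrace (φ j) x := by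
  obtain ⟨p, rfl⟩ := exists_cls_eq x
  obtain ⟨h1, h2⟩ := isStarProjection_iff_conj.1 p.2.2
  -- Apply `Φ` to each entry and flatten the nested matrix.
  let P : Matrix (Fin p.1 × Fin k) (Fin p.1 × Fin k) A :=
    Matrix.of fun a b => Φ (p.2.1 a.1 b.1) a.2 b.2
  have hP : IsStarProjection P := by
    refine isStarProjection_iff_conj.2 ⟨?_, ?_⟩
    · ext a b
      have h3 : Φ (p.2.1 a.1 b.1) = ∑ i, Φ (p.2.1 a.1 i) * Φ (p.2.1 i b.1) := by
        conv_lhs => rw [← h1, Matrix.mul_apply, map_sum]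
        simp only [map_mul]
      change _ = Φ (p.2.1 a.1 b.1) a.2 b.2
      rw [h3, Matrix.mul_apply, Fintype.sum_prod_type, Matrix.sum_apply]
      simp only [Matrix.mul_apply]
      rfl
    · ext a b
      have h3 : Φ (p.2.1 a.1 b.1) = (Φ (p.2.1 b.1 a.1))ᴴ := by
        conv_lhs => rw [← h2, Matrix.conjTranspose_apply, map_star]
        rfl
      change star (Φ (p.2.1 b.1 a.1) b.2 a.2) = Φ (p.2.1 a.1 b.1) a.2 b.2
      rw [h3]
      rfl
  refine ⟨cls P, fun j => ?_⟩
  rw [vTrace_cls _ hP, vTrace_cls _ p.2.2]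
  calc trMat (φ j) P = ∑ i, trMat (φ j) (Φ (p.2.1 i i)) := Fintype.sum_prod_type _
    _ = μ j * trMat (φ j) p.2.1 := by
      rw [trMat, Finset.mul_sum]
      exact Finset.sum_congr rfl fun i _ => hΦ j _

theorem gammaMonoid_of_mem_fundamentalGroup {φ : Fin 2 → traceSpace A}
    (h : EnumeratesExtremeTraces φ) {c d : ℝ} (hM : !![c, 0; 0, d] ∈ fundamentalGroup φ)
    (x : MvNMonoid A) : ∃ y, gammaMonoid φ y = ![c * gammaMonoid φ x 0, d * gammaMonoid φ x 1] := by
  obtain ⟨k, p, Φ, -, hΦ⟩ := hM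
  obtain ⟨y, hy⟩ := exists_vTrace_eq_mul (φ := φ) (μ := ![(c : ℂ), (d : ℂ)]) Φ (fun j x => by
    rw [hΦ]
    fin_cases j <;> simp) x
  refine ⟨y, ?_⟩
  ext i
  have := hy i
  rw [vTrace_eq_gammaMonoid h, vTrace_eq_gammaMonoid h] at this
  fin_cases i
  · exact Complex.ofReal_injective (by simpa using this)
  · exact Complex.ofReal_injective (by simpa using this)

theorem range_Gamma_mem_of_mem_fundamentalGroup {φ : Fin 2 → traceSpace A}
    (h : EnumeratesExtremeTraces φ) {c d : ℝ} (hM : !![c, 0; 0, d] ∈ fundamentalGroup φ)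
    {v : Fin 2 → ℝ} (hv : v ∈ (Gamma φ).range) : ![c * v 0, d * v 1] ∈ (Gamma φ).range := by
  obtain ⟨x, y, rfl⟩ := mem_range_Gamma_iff.1 hv
  obtain ⟨x', hx⟩ := gammaMonoid_of_mem_fundamentalGroup h hM x
  obtain ⟨y', hy⟩ := gammaMonoid_of_mem_fundamentalGroup h hM y
  refine mem_range_Gamma_iff.2 ⟨x', y', ?_⟩
  rw [hx, hy]
  ext i
  fin_cases i <;> simp [mul_sub]

end Amplification

/-! ### Realization of the extra symmetry and conclusion -/

section Main

variable {A : Type u} [CStarAlgebra A]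

theorem gammaMonoid_one {n : ℕ} {φ : Fin n → traceSpace A} (h : EnumeratesExtremeTraces φ)
    (K : ℕ) (i : Fin n) : gammaMonoid φ (cls (1 : Matrix (Fin K) (Fin K) A)) i = K := by
  rw [gammaMonoid_apply, vTrace_cls _ (IsStarProjection.one _)]
  simp [trMat, (h.mem i).2]

/-- A projection with strictly positive trace values is full. -/
theorem AFSystem.span_eq_top (D : AFSystem A) [FiniteDimensional ℂ (traceSpace A)] {n : ℕ}
    {φ : Fin n → traceSpace A} (h : EnumeratesExtremeTraces φ) {K : ℕ}
    {p : Matrix (Fin K) (Fin K) A} (hp : IsStarProjection p)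
    (hpos : ∀ i, 1 ≤ gammaMonoid φ (cls p) i) :
    TwoSidedIdeal.span {p} = (⊤ : TwoSidedIdeal (Matrix (Fin K) (Fin K) A)) := by
  -- `K + 1` copies of `p` have trace at least `K + 1 > K`, so the unit of `M_K` is equivalent to a
  -- subprojection of them; its block of the system gives `1 = ∑ aᵢ p aᵢ*`.
  obtain ⟨r, hr⟩ := D.exists_eq_add_of_trace_lt h (x := (K + 1) • cls p)
    (y := cls (1 : Matrix (Fin K) (Fin K) A)) fun i => by
      rw [← gammaMonoid_apply, ← gammaMonoid_apply, gammaMonoid_one h, map_nsmul, Pi.smul_apply,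
        nsmul_eq_mul]
      push_cast
      nlinarith [hpos i, (Nat.cast_nonneg K : (0 : ℝ) ≤ K)]
  obtain ⟨r, rfl⟩ := exists_cls_eq r
  rw [← cls_fromBlocks (IsStarProjection.one _) r.2.2] at hr
  obtain ⟨w, hw⟩ := exists_isSystem (c := fun _ : Fin (K + 1) => ()) (q := fun _ => p)
    (fun _ => hp) (isStarProjection_fromBlocks (IsStarProjection.one _) r.2.2)
    (by rw [← hr]; simp)
  refine (TwoSidedIdeal.one_mem_iff _).1 ?_
  have h1 : (1 : Matrix (Fin K) (Fin K) A) = ∑ i, (w i).toRows₁ * p * (w i).toRows₁ᴴ := by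
    have h2 := congrArg Matrix.toBlocks₁₁ hw.sum
    rw [Matrix.toBlocks_fromBlocks₁₁] at h2
    rw [← h2]
    have h3 : ∀ i, (w i).toRows₁ * p = (w i).toRows₁ := fun i => by
      conv_rhs => rw [← hw.right i]
      rfl
    simp only [h3]
    ext a b
    simp [Matrix.toBlocks₁₁, Matrix.sum_apply, Matrix.mul_apply]
  rw [h1]
  refine sum_mem fun i _ => ?_
  exact TwoSidedIdeal.mul_mem_right _ _ _ (TwoSidedIdeal.mul_mem_left _ _ _
    (TwoSidedIdeal.subset_span (Set.mem_singleton p)))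

/-- Invariance of `G` scales differences of classes, and strict positivity makes the scaled vectors
classes again. On the boundary: a zero second coordinate leaves the vector fixed, and a zero first
coordinate is handled by multiples of `t` in one direction and by unperforation in the other. -/
theorem AFSystem.scalesClasses (D : AFSystem A) [FiniteDimensional ℂ (traceSpace A)]
    {φ : Fin 2 → traceSpace A} (h : EnumeratesExtremeTraces φ)
    (hinj : Function.Injective (Gamma φ)) {t : ℕ} (ht : 0 < t)
    (hG : IsInvariant !![1, 0; 0, (t : ℝ)] (Gamma φ).range) :
    ScalesClasses φ ![1, (t : ℂ)] := by
  have ht0 : (0 : ℝ) < t := by exact_mod_cast ht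
  obtain ⟨hG1, hG2⟩ := (isInvariant_diag_iff one_ne_zero ht0.ne').1 hG
  have hγ := gammaMonoid_injective D hinj
  have hmem : ∀ x, gammaMonoid φ x ∈ (Gamma φ).range := fun x => ⟨_, Gamma_of φ x⟩
  have hlift : ∀ {x y : MvNMonoid A} {c : ℝ},
      gammaMonoid φ y = ![gammaMonoid φ x 0, c * gammaMonoid φ x 1] →
      ∀ j, vTrace (φ j) y = (![1, (c : ℂ)] : Fin 2 → ℂ) j * vTrace (φ j) x := by
    intro x y c hy j
    rw [vTrace_eq_gammaMonoid h, vTrace_eq_gammaMonoid h, hy]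
    fin_cases j <;> simp
  have key : ∀ (c : ℝ), 0 < c →
      (∀ x, ![gammaMonoid φ x 0, c * gammaMonoid φ x 1] ∈ (Gamma φ).range) →
      (∀ x, gammaMonoid φ x 0 = 0 → ∃ y, gammaMonoid φ y = ![0, c * gammaMonoid φ x 1]) →
      ∀ x, ∃ y, gammaMonoid φ y = ![gammaMonoid φ x 0, c * gammaMonoid φ x 1] := by
    intro c hc hc1 hc2 x
    rcases (gammaMonoid_nonneg h x 0).eq_or_lt with h0 | h0
    · obtain ⟨y, hy⟩ := hc2 x h0.symm
      exact ⟨y, by rw [hy, ← h0]⟩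
    rcases (gammaMonoid_nonneg h x 1).eq_or_lt with h1 | h1
    · refine ⟨x, ?_⟩
      ext i
      fin_cases i
      · rfl
      · simp [← h1]
    · refine exists_gammaMonoid_eq D h (hc1 x) fun i => ?_
      fin_cases i
      · exact h0
      · exact mul_pos hc h1
  refine ⟨fun x y hxy => hγ ?_, fun j => ?_, fun x => ?_, fun x => ?_⟩
  · ext i
    rw [gammaMonoid_apply, gammaMonoid_apply, hxy]
  · fin_cases j
    · exact one_ne_zero
    · exact Nat.cast_ne_zero.2 ht.ne'
  · obtain ⟨y, hy⟩ := key t ht0 (fun x => by simpa using hG1 _ (hmem x)) (fun x hx => by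
      refine ⟨t • x, ?_⟩
      ext i
      fin_cases i <;> simp [hx]) x
    exact ⟨y, by simpa using hlift hy⟩
  · obtain ⟨y, hy⟩ := key (t : ℝ)⁻¹ (inv_pos.2 ht0) (fun x => by simpa using hG2 _ (hmem x))
      (fun x hx => by
        have h1 := hG2 _ (hmem x)
        rw [hx, mul_zero] at h1
        obtain ⟨y₁, y₂, hy⟩ := mem_range_Gamma_iff.1 h1
        -- `(0, x₁/t)` lies in `G` as `γ(y₁) - γ(y₂)`. Multiplying by `t` gives an identity of
        -- classes, and unperforation then yields `y₂ ≤ y₁`.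
        have h2 : t • y₁ = t • y₂ + x := by
          refine hγ ?_
          rw [map_add, map_nsmul, map_nsmul, ← sub_eq_iff_eq_add', ← smul_sub, ← hy]
          ext i
          fin_cases i
          · simp [hx]
          · simp [mul_inv_cancel_left₀ ht0.ne']
        obtain ⟨r, rfl⟩ := D.v_unperforated ht.ne' h2
        exact ⟨r, by rw [hy, map_add, add_sub_cancel_left]⟩) x
    refine ⟨y, fun j => (hlift hy j).trans ?_⟩
    fin_cases j <;> simp

/-- Scaling the class of the unit gives a projection `p` with trace values `(1, t)`. It is full
since both values are at least `1`, and the classification argument supplies an isomorphism onto its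
corner. -/
theorem AFSystem.mem_fundamentalGroup (D : AFSystem A) [FiniteDimensional ℂ (traceSpace A)]
    {φ : Fin 2 → traceSpace A} (h : EnumeratesExtremeTraces φ)
    (hinj : Function.Injective (Gamma φ)) {t : ℕ} (ht : 0 < t)
    (hG : IsInvariant !![1, 0; 0, (t : ℝ)] (Gamma φ).range) :
    !![1, 0; 0, (t : ℝ)] ∈ fundamentalGroup φ := by
  have H := D.scalesClasses h hinj ht hG
  obtain ⟨y, hy⟩ := H.fwd (cls (1 : Matrix (Fin 1) (Fin 1) A))
  obtain ⟨p, rfl⟩ := exists_cls_eq y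
  have h1 : ∀ j, vTrace (φ j) (cls (1 : Matrix (Fin 1) (Fin 1) A)) = (φ j).1 1 := fun j => by
    rw [vTrace_cls _ (IsStarProjection.one _)]
    simp [trMat]
  obtain ⟨Φ, hΦ1, hΦ2, hΦ3⟩ := D.exists_starHom_corner H p.2.2
    ⟨0, by rw [(h.mem 0).2]; exact one_ne_zero⟩ fun j => by rw [← vTrace_cls _ p.2.2, hy, h1]
  refine ⟨p.1, p.2.1, Φ, ⟨p.2.2, D.span_eq_top h p.2.2 fun i => ?_, hΦ1, hΦ2⟩, fun j x => ?_⟩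
  · rw [gammaMonoid_apply, hy, h1, (h.mem i).2]
    fin_cases i
    · simp
    · simpa using Nat.succ_le_of_lt ht
  · rw [hΦ3]
    fin_cases j <;> simp

theorem not_exists_fundamentalGroup_eq {a : ℝ} {b : ℚ} (ha : 0 < a) (hb : 0 < b)
    (ha_alg : IsAlgebraic ℚ a) (hab : a ≠ (b : ℝ)) (ha1 : a ≠ 1) (hb1 : b ≠ 1)
    {φ : Fin 2 → traceSpace A} (hAF : IsAF A) (hdim : Module.finrank ℂ (traceSpace A) = 2)
    (h : EnumeratesExtremeTraces φ) (hK : K0Embedded φ) : fundamentalGroup φ ≠ diagPowers a b := by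
  intro hF
  obtain ⟨D⟩ := hAF.nonempty_afSystem
  have : FiniteDimensional ℂ (traceSpace A) := .of_finrank_pos (by omega)
  have hbR : (0 : ℝ) < b := by exact_mod_cast hb
  have hmem : ∀ n : ℤ, !![a ^ n, 0; 0, (b : ℝ) ^ n] ∈ fundamentalGroup φ := fun n =>
    hF ▸ ⟨n, rfl⟩
  -- The members `n = 1` and `n = -1` of the supposed fundamental group give the two inclusions.
  have hG : IsInvariant !![a, 0; 0, (b : ℝ)] (Gamma φ).range := by
    refine (isInvariant_diag_iff ha.ne' hbR.ne').2 ⟨fun v hv => ?_, fun v hv => ?_⟩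
    · have := hmem 1
      rw [zpow_one, zpow_one] at this
      exact range_Gamma_mem_of_mem_fundamentalGroup h this hv
    · have := hmem (-1)
      rw [zpow_neg_one, zpow_neg_one] at this
      exact range_Gamma_mem_of_mem_fundamentalGroup h this hv
  obtain ⟨t, ht, htG⟩ := exists_isInvariant_nat ha hb ha_alg hab hb1 hG
  have := D.mem_fundamentalGroup h hK.1 (zero_lt_one.trans ht) htG
  rw [hF] at this
  exact diag_one_notMem_diagPowers ha ha1 ht this

end Main
end AFFund

end

theorem mainTheorem7 (a : ℝ) (b : ℚ) (ha : 0 < a) (hb : 0 < b) (ha_alg : IsAlgebraic ℚ a)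
    (hab : a ≠ (b : ℝ)) (ha1 : a ≠ 1) (hb1 : b ≠ 1) :
    (∀ G : AddSubgroup (Fin 2 → ℝ), (1 : Fin 2 → ℝ) ∈ G →
      AFFund.IsInvariant !![a, 0; 0, (b : ℝ)] G →
      AFFund.diagPowers a b ⊂ AFFund.invarianceGroup G) ∧
    ¬ ∃ (A : Type u) (_ : CStarAlgebra A) (φ : Fin 2 → AFFund.traceSpace A),
      AFFund.IsAF A ∧ Module.finrank ℂ (AFFund.traceSpace A) = 2 ∧
      AFFund.EnumeratesExtremeTraces φ ∧ AFFund.K0Embedded φ ∧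
      AFFund.fundamentalGroup φ = AFFund.diagPowers a b :=
  ⟨fun _ _ hG => AFFund.diagPowers_ssubset ha hb ha_alg hab ha1 hb1 hG,
    fun ⟨_, _, _, hAF, hdim, hφ, hK, hF⟩ =>
      AFFund.not_exists_fundamentalGroup_eq ha hb ha_alg hab ha1 hb1 hAF hdim hφ hK hF⟩
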